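/- Let $M$ be a loopless matroid on a finite ground set $E$, with lattice of flats $\mathcal L$ (so $\operatorname{cl}(\emptyset)=\emptyset$ is its minimum, meet is intersection, and the join of flats is the closure of their union). A set $\mathscr G\subseteq\mathcal L_{>\operatorname{cl}(\emptyset)}$ is a building set if for every flat $X>\operatorname{cl}(\emptyset)$, writing $\max\mathscr G_{\le X}=\{G_1,\dots,G_k\}$, there is an isomorphism of posets $\varphi_X\colon\prod_{i=1}^k[\operatorname{cl}(\emptyset),G_i]\to[\operatorname{cl}(\emptyset),X]$ with $\varphi_X(\operatorname{cl}(\emptyset),\dots,G_i,\dots,\operatorname{cl}(\emptyset))=G_i$ for all $i$; put $\operatorname{fact}_{\mathscr G}(X)=\max\mathscr G_{\le X}$. A subset $\mathcal S\subseteq\mathscr G$ is nested if for all pairwise incomparable $G_1,\dots,G_t\in\mathcal S$ with $t\ge2$ the join $G_1\vee\dots\vee G_t$ is not in $\mathscr G$. Let $\mathcal N(M,\mathscr G)$ be the collection of nested sets, and $\mathcal N^*(M,\mathscr G)$ the collection of those nested sets that contain $\operatorname{fact}_{\mathscr G}(E)$. The characteristic polynomial of a matroid $N$ on $E$ is $\chi_N(q)=\sum_{S\subseteq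 E}(-1)^{\#S}q^{\operatorname{rk}N-\operatorname{rk}_N S}$. For $w\in\mathbb R^E$ let $M_w$ be the matroid on $E$ whose bases are the bases $B$ of $M$ for which $\sum_{e\in B}w_e$ is maximal. For $\mathcal S\in\mathcal N(M,\mathscr G)$ let $M_{\mathcal S}=M_w$ with $w=\sum_{F\in\mathcal S}v_F$, where $v_F\in\mathbb R^E$ is the indicator vector of $F$. (This $w$ lies in the relative interior of the cone $\sum_{F\in\mathcal S}\mathbb R_{\ge0}v_F$; all $w$ in the relative interior give the same $M_w$.) Set $$P_{M,\mathscr G}(q)=\sum_{\mathcal S\in\mathcal N^*(M,\mathscr G)}\frac{\chi_{M_{\mathcal S}}(q)}{(q-1)^{\#\mathcal S}}.$$ Let $D^\bullet(M,\mathscr G)=\mathbb Z[\{x_G\}_{G\in\mathscr G}]/\mathcal I_{\mathscr G}$ be the graded ring in which each $x_G$ has degree $2$ and $\mathcal I_{\mathscr G}$ is generated by the products $\prod_{i=1}^k x_{G_i}$ for $\{G_1,\dots,G_k\}\subseteq\mathscr G$ not in $\mathcal N(M,\mathscr G)$ and by the sums $\sum_{G\in\mathscr G,\,G\supseteq A}x_G$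 for $A$ an atom of $\mathcal L$. Theorem. For every building set $\mathscr G$ in the lattice of flats of $M$, $P_{M,\mathscr G}(q)$ is a polynomial with integer coefficients, and $$P_{M,\mathscr G}(q^2)=\sum_{i\ge0}\operatorname{rk}_{\mathbb Z}D^i(M,\mathscr G)\,q^i .$$ -/

import Mathlib

namespace Matroid

/-! ### Characteristic polynomial -/

/-- The rank `rk X` of a set, as a natural number (used for finite matroids only). -/
noncomputable def natRk {α : Type*} (M : Matroid α) (X : Set α) : ℕ := (M.eRk X).toNat

/-- The characteristic polynomial `χ_M(q) = ∑_{S ⊆ E} (-1)^{#S} q^{rk M - rk S}`. -/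
noncomputable def characteristicPoly {α : Type*} (M : Matroid α) [M.Finite] : Polynomial ℤ :=
  ∑ S ∈ M.ground_finite.toFinset.powerset,
    (-1) ^ S.card * Polynomial.X ^ (M.natRk M.E - M.natRk (S : Set α))

/-! ### The matroid of bases of maximal weight -/

/-- The weight `∑_{e ∈ B} w_e`. -/
noncomputable def weightOf {α : Type*} (w : α → ℝ) (B : Set α) : ℝ := ∑ᶠ e ∈ B, w e

/-- `B` is a basis of `M` whose weight is the maximum of the weights of the bases of `M`. -/
def IsMaxWeightBase {α : Type*} (M : Matroid α) (w : α → ℝ) (B : Set α) : Prop :=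
  M.IsBase B ∧ ∀ B', M.IsBase B' → weightOf w B' ≤ weightOf w B

theorem exists_isMaxWeightBase {α : Type*} (M : Matroid α) [M.Finite] (w : α → ℝ) :
    ∃ B, M.IsMaxWeightBase w B := by
  have hfin : {B | M.IsBase B}.Finite :=
    M.ground_finite.finite_subsets.subset fun B hB => hB.subset_ground
  obtain ⟨B, hB, hmax⟩ := Set.exists_max_image _ (weightOf w) hfin M.exists_isBase
  exact ⟨B, hB, hmax⟩

theorem weightOf_exchange {α : Type*} (w : α → ℝ) {B : Set α} (hB : B.Finite) {e f : α}
    (he : e ∈ B) (hf : f ∉ B) :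
    weightOf w (insert f (B \ {e})) = weightOf w B - w e + w f := by
  unfold weightOf
  have hd : (B \ {e}).Finite := hB.subset Set.sdiff_subset
  have h1 : ∑ᶠ i ∈ insert f (B \ {e}), w i = w f + ∑ᶠ i ∈ B \ {e}, w i :=
    finsum_mem_insert w (fun h => hf h.1) hd
  have h2 : ∑ᶠ i ∈ insert e (B \ {e}), w i = w e + ∑ᶠ i ∈ B \ {e}, w i :=
    finsum_mem_insert w (fun h => h.2 rfl) hd
  rw [Set.insert_sdiff_singleton, Set.insert_eq_of_mem he] at h2
  rw [h1, h2]
  ring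

theorem isMaxWeightBase_exchange {α : Type*} (M : Matroid α) [M.Finite] (w : α → ℝ) :
    Matroid.ExchangeProperty (M.IsMaxWeightBase w) := by
  rintro B₁ B₂ ⟨hB₁, h₁⟩ ⟨hB₂, h₂⟩ e ⟨he₁, he₂⟩
  have heE : e ∈ M.E := hB₁.subset_ground he₁
  have hC := hB₂.fundCircuit_isCircuit heE he₂
  have heC : e ∈ M.closure (M.fundCircuit e B₂ \ {e}) :=
    hC.mem_closure_sdiff_singleton_of_mem (M.mem_fundCircuit e B₂)
  obtain ⟨f, hfC, hf⟩ : ∃ f ∈ M.fundCircuit e B₂ \ {e}, f ∉ M.closure (B₁ \ {e}) := by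
    by_contra! hcon
    have hsub : M.closure (M.fundCircuit e B₂ \ {e}) ⊆ M.closure (B₁ \ {e}) :=
      M.closure_subset_closure_of_subset_closure hcon
    exact hB₁.indep.notMem_closure_sdiff_of_mem he₁ (hsub heC)
  have hfE : f ∈ M.E := hC.subset_ground hfC.1
  have hfB₂ : f ∈ B₂ := (M.fundCircuit_subset_insert e B₂ hfC.1).resolve_left hfC.2
  have hfB₁ : f ∉ B₁ := fun h => hf (M.mem_closure_of_mem' ⟨h, hfC.2⟩ hfE)
  have hne : f ≠ e := hfC.2
  have hb₁ : M.IsBase (insert f (B₁ \ {e})) := hB₁.exchange_base_of_notMem_closure he₁ hf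
  have hb₂ : M.IsBase (insert e (B₂ \ {f})) := by
    have heq : insert e (B₂ \ {f}) = insert e B₂ \ {f} := by
      ext x
      simp only [Set.mem_insert_iff, Set.mem_sdiff, Set.mem_singleton_iff]
      grind
    rw [heq]
    refine hB₂.exchange_isBase_of_indep' hfB₂ he₂ ?_
    exact (hB₂.indep.mem_fundCircuit_iff (by rwa [hB₂.closure_eq]) he₂).1 hfC.1
  have e₁ := weightOf_exchange w (M.ground_finite.subset hB₁.subset_ground) he₁ hfB₁
  have e₂ := weightOf_exchange w (M.ground_finite.subset hB₂.subset_ground) hfB₂ he₂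
  refine ⟨f, ⟨hfB₂, hfB₁⟩, hb₁, fun B' hB' => ?_⟩
  have := h₂ _ hb₂
  have := h₁ _ hB'
  linarith

/-- The matroid `M_w` on the ground set of `M`, whose bases are the bases of `M` of maximal
weight. -/
noncomputable def initialMatroid {α : Type*} (M : Matroid α) [M.Finite] (w : α → ℝ) :
    Matroid α :=
  Matroid.ofIsBaseOfFinite M.ground_finite (M.IsMaxWeightBase w)
    (M.exists_isMaxWeightBase w) (M.isMaxWeightBase_exchange w)
    (fun _ hB => hB.1.subset_ground)

instance initialMatroid_finite {α : Type*} (M : Matroid α) [M.Finite] (w : α → ℝ) :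
    (M.initialMatroid w).Finite := ⟨M.ground_finite⟩

/-! ### Building sets and nested sets -/

/-- The interval `[cl ∅, X]` in the lattice of flats, ordered by inclusion. (Every
flat contains `cl ∅`.) -/
abbrev FlatsBelow {α : Type*} (M : Matroid α) (X : Set α) : Type _ :=
  {F : Set α // M.IsFlat F ∧ F ⊆ X}

/-- The set `max 𝒢_{≤ X}` of factors of `X` in `𝒢`. -/
def buildingFactors {α : Type*} (𝒢 : Set (Set α)) (X : Set α) : Set (Set α) :=
  {G | Maximal (fun H => H ∈ 𝒢 ∧ H ⊆ X) G}

/-- `𝒢` is a building set in the lattice of flats of `M`. -/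
structure IsBuildingSet {α : Type*} (M : Matroid α) (𝒢 : Set (Set α)) : Prop where
  isFlat : ∀ G ∈ 𝒢, M.IsFlat G
  ssubset : ∀ G ∈ 𝒢, M.closure ∅ ⊂ G
  /-- For each flat `X > cl ∅` with factors `G₁, …, G_k` there is an isomorphism of posets
  `φ : ∏ [cl ∅, G_i] ≃ [cl ∅, X]` with `φ (cl ∅, …, G_i, …, cl ∅) = G_i` for each `i`. -/
  exists_orderIso : ∀ X, M.IsFlat X → M.closure ∅ ⊂ X →
    ∃ φ : ((G : buildingFactors 𝒢 X) → M.FlatsBelow (G : Set α)) ≃o M.FlatsBelow X,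
      ∀ (G : buildingFactors 𝒢 X) (v : (H : buildingFactors 𝒢 X) → M.FlatsBelow (H : Set α)),
        (v G : Set α) = G → (∀ H, H ≠ G → (v H : Set α) = M.closure ∅) →
          (φ v : Set α) = G

/-- The nested set complex `𝒩(M, 𝒢)`. The join of a family `T` of flats is the closure of
their union. -/
def nestedSets {α : Type*} (M : Matroid α) (𝒢 : Set (Set α)) : Set (Finset (Set α)) :=
  {S | (S : Set (Set α)) ⊆ 𝒢 ∧
    ∀ T ⊆ S, IsAntichain (· ⊆ ·) (T : Set (Set α)) → 2 ≤ T.card →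
      M.closure (⋃₀ (T : Set (Set α))) ∉ 𝒢}

/-- The collection `𝒩*(M, 𝒢)` of the nested sets that contain every factor of the ground set. -/
def fullNestedSets {α : Type*} (M : Matroid α) (𝒢 : Set (Set α)) : Set (Finset (Set α)) :=
  {S | S ∈ M.nestedSets 𝒢 ∧ buildingFactors 𝒢 M.E ⊆ (S : Set (Set α))}

/-- The building set is finite, so the sums below are finite sums. -/
theorem IsBuildingSet.finite {α : Type*} {M : Matroid α} [M.Finite] {𝒢 : Set (Set α)}
    (h : M.IsBuildingSet 𝒢) : 𝒢.Finite :=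
  M.ground_finite.finite_subsets.subset fun G hG => (h.isFlat G hG).subset_ground

theorem IsBuildingSet.finite_nestedSets {α : Type*} {M : Matroid α} [M.Finite]
    {𝒢 : Set (Set α)} (h : M.IsBuildingSet 𝒢) : (M.nestedSets 𝒢).Finite :=
  (h.finite.finite_subsets.preimage Finset.coe_injective.injOn).subset fun _ hS => hS.1

/-! ### The Euler-Poincaré polynomial -/

/-- The indicator vector `v_F ∈ ℝ^E`. -/
noncomputable def indicatorVec {α : Type*} (F : Set α) : α → ℝ := F.indicator fun _ => 1

/-- The cone `σ_S = ∑_{F ∈ S} ℝ_{≥ 0} v_F`. -/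
def nestedCone {α : Type*} (S : Finset (Set α)) : Set (α → ℝ) :=
  {w | ∃ c : Set α → ℝ, (∀ F ∈ S, 0 ≤ c F) ∧ w = ∑ F ∈ S, c F • indicatorVec F}

/-- The sum of the indicator vectors lies in the relative interior of the cone, so it is one of
the weights `w` for which `M_S = M_w`. -/
theorem sum_indicatorVec_mem_intrinsicInterior {α : Type*} (S : Finset (Set α)) :
    ∑ F ∈ S, indicatorVec F ∈ intrinsicInterior ℝ (nestedCone S) := by
  classical
  let L : (S → ℝ) →ₗ[ℝ] (α → ℝ) := Fintype.linearCombination ℝ fun F : S => indicatorVec F.1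
  have hL : ∀ c : S → ℝ, L c = ∑ F : S, c F • indicatorVec F.1 := fun c =>
    Fintype.linearCombination_apply ℝ _ c
  have hcone : ∀ c : S → ℝ, (∀ F, 0 ≤ c F) → L c ∈ nestedCone S := by
    intro c hc
    refine ⟨fun F => if h : F ∈ S then c ⟨F, h⟩ else 0, fun F hF => ?_, ?_⟩
    · simpa [hF] using hc ⟨F, hF⟩
    · rw [hL, ← Finset.sum_coe_sort S]
      simp
  have hrange : nestedCone S ⊆ (LinearMap.range L : Set (α → ℝ)) := by
    rintro w ⟨c, -, rfl⟩
    refine ⟨fun F => c F.1, ?_⟩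
    rw [hL, ← Finset.sum_coe_sort S]
  have hone : L (fun _ => 1) = ∑ F ∈ S, indicatorVec F := by
    rw [hL, ← Finset.sum_coe_sort S]
    simp
  have hspan : (affineSpan ℝ (nestedCone S) : Set (α → ℝ)) ⊆ LinearMap.range L := by
    have : affineSpan ℝ (nestedCone S) ≤ (LinearMap.range L).toAffineSubspace :=
      affineSpan_le.2 hrange
    exact this
  have hopen : IsOpenMap L.rangeRestrict :=
    LinearMap.isOpenMap_of_finiteDimensional _ L.surjective_rangeRestrict
  have hU : IsOpen {c : S → ℝ | ∀ F, 0 < c F} := by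
    simp only [Set.ofPred_forall]
    exact isOpen_iInter_of_finite fun F => isOpen_lt continuous_const (continuous_apply F)
  have hnhds : nestedCone S ∈ nhdsWithin (∑ F ∈ S, indicatorVec F)
      (LinearMap.range L : Set (α → ℝ)) := by
    have hmem : L.rangeRestrict '' {c : S → ℝ | ∀ F, 0 < c F} ∈
        nhds (L.rangeRestrict fun _ => 1) :=
      (hopen _ hU).mem_nhds ⟨_, fun _ => one_pos, rfl⟩
    have hsub : L.rangeRestrict '' {c : S → ℝ | ∀ F, 0 < c F} ⊆
        Subtype.val ⁻¹' nestedCone S := by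
      rintro _ ⟨c, hc, rfl⟩
      exact hcone c fun F => (hc F).le
    have := preimage_coe_mem_nhds_subtype.1 (Filter.mem_of_superset hmem hsub)
    rw [← hone]
    exact this
  have hself : ∑ F ∈ S, indicatorVec F ∈ nestedCone S := by
    rw [← hone]
    exact hcone _ fun _ => zero_le_one
  refine mem_intrinsicInterior.2 ⟨⟨_, subset_affineSpan ℝ _ hself⟩, ?_, rfl⟩
  exact mem_interior_iff_mem_nhds.2
    (preimage_coe_mem_nhds_subtype.2 (nhdsWithin_mono _ hspan hnhds))

/-- The matroid `M_S`, that is, `M_w` for a weight `w` in the relative interior of `σ_S`; we take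
`w = ∑_{F ∈ S} v_F`. -/
noncomputable def nestedMatroid {α : Type*} (M : Matroid α) [M.Finite] (S : Finset (Set α)) :
    Matroid α :=
  M.initialMatroid (∑ F ∈ S, indicatorVec F)

instance nestedMatroid_finite {α : Type*} (M : Matroid α) [M.Finite] (S : Finset (Set α)) :
    (M.nestedMatroid S).Finite := ⟨M.ground_finite⟩

/-- The `𝒢`-Euler-Poincaré polynomial
`P_{M,𝒢}(q) = ∑_{S ∈ 𝒩*(M,𝒢)} χ_{M_S}(q) / (q - 1)^{#S}`, as an element of `ℤ(q)`. -/
noncomputable def eulerPoincare {α : Type*} (M : Matroid α) [M.Finite] (𝒢 : Set (Set α)) :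
    RatFunc ℤ :=
  ∑ᶠ S ∈ M.fullNestedSets 𝒢,
    algebraMap (Polynomial ℤ) (RatFunc ℤ) (M.nestedMatroid S).characteristicPoly /
      (RatFunc.X - 1) ^ S.card

/-! ### The Feichtner-Yuzvinsky ring -/

/-- `A` is an atom of the lattice of flats: a minimal element among the flats strictly
containing `cl ∅`. -/
def IsFlatAtom {α : Type*} (M : Matroid α) (A : Set α) : Prop :=
  Minimal (fun F => M.IsFlat F ∧ M.closure ∅ ⊂ F) A

/-- The ideal generated by the monomials `∏ x_{G_i}` for `{G_1, …, G_k} ⊆ 𝒢` not nested and by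
the linear forms `∑_{G ⊇ A} x_G` for the atoms `A`. -/
noncomputable def fyIdeal {α : Type*} (M : Matroid α) (𝒢 : Set (Set α)) :
    Ideal (MvPolynomial 𝒢 ℤ) :=
  Ideal.span
    ({p | ∃ T : Finset 𝒢, T.map (Function.Embedding.subtype _) ∉ M.nestedSets 𝒢 ∧
        p = ∏ G ∈ T, MvPolynomial.X G} ∪
      {p | ∃ A, M.IsFlatAtom A ∧ p = ∑ᶠ (G : 𝒢) (_ : A ⊆ (G : Set α)), MvPolynomial.X G})

/-- The ring `D(M, 𝒢)`. -/
abbrev FYRing {α : Type*} (M : Matroid α) (𝒢 : Set (Set α)) : Type _ :=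
  MvPolynomial 𝒢 ℤ ⧸ M.fyIdeal 𝒢

/-- The graded piece `D^i(M, 𝒢)`, where each `x_G` has degree `2`: the image in the quotient of
the polynomials that are homogeneous of degree `i`. -/
noncomputable def fyDegree {α : Type*} (M : Matroid α) (𝒢 : Set (Set α)) (i : ℕ) :
    Submodule ℤ (M.FYRing 𝒢) :=
  (MvPolynomial.weightedHomogeneousSubmodule ℤ (fun _ : 𝒢 => 2) i).map
    (Ideal.Quotient.mkₐ ℤ (M.fyIdeal 𝒢)).toLinearMap

/-- Each graded piece is finitely generated, so its rank over `ℤ` is finite. -/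
theorem IsBuildingSet.finite_fyDegree {α : Type*} {M : Matroid α} [M.Finite]
    {𝒢 : Set (Set α)} (h : M.IsBuildingSet 𝒢) (i : ℕ) : Module.Finite ℤ (M.fyDegree 𝒢 i) := by
  have : _root_.Finite 𝒢 := h.finite
  exact Module.Finite.iff_fg.2
    ((MvPolynomial.weightedHomogeneousSubmodule_fg ℤ _ (fun _ => two_ne_zero) i).map _)

end Matroid

set_option linter.unusedSectionVars false

namespace Matroid

/-! ### The natural-valued rank -/

section NatRk

variable {α : Type*} (M : Matroid α) [M.Finite]

/-! Both sides are compared with `nestedPoly`, the sum over nested sets T of ∏_{G ∈ T} (q + ⋯ +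
q^(d_G - 1)), where d_G = rk G - rk (⋃ T_{<G}).

Ring side: the monomials with nested support T and exponents 1 ≤ m_G < d_G are a ℤ-basis of D(M, 𝒢).
They span because every product ∏_{A ∈ T} x_A · (∑_{H ⊇ B} x_H)^n with all A ⊂ B and n ≥ rk B - rk
(⋃ T) is zero in the ring (`prod_mul_upSum_pow_mem_fyIdeal`), so a monomial with too large an
exponent at B can be rewritten with members of larger rank (`monomial_mem_sup`). They are
independent already modulo the ideal `relIdeal` of all such products, which contains the defining
ideal (`fyIdeal_le_relIdeal`). For this the variables are added one at a time, from large flats to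
small. Adding x_G has the shape of the Chow ring of a blow-up, R[X] / (I, X J, P) with P monic of
degree d and P(0) J ⊆ I: the constant coefficient is tested modulo I and the coefficients of X, …,
X^(d-1) modulo J (`coeff_mem_of_mem_blowup`, `upSum_sub_pow_mul_mem`). Here J is an ideal of the
same kind, relative to the enlarged set S ∪ {G}, so an induction over all S closes up
(`eq_zero_of_mem_relIdeal`).

Matroid side: for S in 𝒩* the matroid M_S has the rank function of the direct sum of the minors (M |
G) / ⋃ S_{<G}, G ∈ S, so its characteristic polynomial is a product
(`characteristicPoly_nestedMatroid`). Möbius inversion gives ∑_{Z ⊆ F ⊆ G} χ_{(M|G)/F} = q^(rk G -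
rk Z) (`sum_intervalChar`), so each factor q + ⋯ + q^(d_G - 1) is a sum of c(G, F) over flats F
between ⋃ T_{<G} and G, where c(G, F) = χ_{(M|G)/F} / (q - 1) for F ≠ G and c(G, G) = -1. Expanding
the products gives a sum over pairs of a nested set T and a choice φ of flats. For fixed φ, toggling
a suitable K with φ(K) = K in T reverses the sign; only the choices φ(G) = ⋃ S_{<G} on some S in 𝒩*
survive, and they give exactly the terms of P (`exists_toggle`, `sum_nestedSets`). -/

theorem coe_natRk (X : Set α) : (M.natRk X : ℕ∞) = M.eRk X :=
  ENat.natCast_toNat (eRk_ne_top_iff.2 (M.isRkFinite_set X))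

theorem natRk_mono {X Y : Set α} (h : X ⊆ Y) : M.natRk X ≤ M.natRk Y := by
  have := M.eRk_mono h
  rwa [← coe_natRk, ← coe_natRk, Nat.cast_le] at this

theorem natRk_submod (X Y : Set α) :
    M.natRk (X ∩ Y) + M.natRk (X ∪ Y) ≤ M.natRk X + M.natRk Y := by
  have := M.eRk_inter_add_eRk_union_le X Y
  simp only [← coe_natRk] at this
  exact_mod_cast this

theorem natRk_closure (X : Set α) : M.natRk (M.closure X) = M.natRk X := by
  simp [natRk]

@[simp] theorem natRk_empty : M.natRk ∅ = 0 := by simp [natRk]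

theorem natRk_union_le (X Y : Set α) : M.natRk (X ∪ Y) ≤ M.natRk X + M.natRk Y :=
  (Nat.le_add_left _ _).trans (M.natRk_submod X Y)

theorem natRk_le_ncard {X : Set α} (h : X.Finite) : M.natRk X ≤ X.ncard := by
  have := M.eRk_le_encard X
  rw [← coe_natRk, ← h.cast_ncard_eq] at this
  exact_mod_cast this

theorem natRk_eq_of_isBasis' {I X : Set α} (h : M.IsBasis' I X) : M.natRk X = I.ncard := by
  rw [natRk, h.eRk_eq_encard]; rfl

theorem natRk_eq_of_indep {I : Set α} (h : M.Indep I) : M.natRk I = I.ncard := by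
  rw [natRk, h.eRk_eq_encard]; rfl

theorem indep_of_ncard_le_natRk {I : Set α} (hf : I.Finite) (h : I.ncard ≤ M.natRk I) :
    M.Indep I := by
  refine (M.isRkFinite_of_finite hf).indep_of_encard_le_eRk ?_
  rw [← coe_natRk, ← hf.cast_ncard_eq]
  exact_mod_cast h

theorem subset_closure_of_natRk_le {X Y : Set α} (hXY : X ⊆ Y) (hY : Y ⊆ M.E)
    (h : M.natRk Y ≤ M.natRk X) : Y ⊆ M.closure X := by
  have := (M.isRkFinite_set X).closure_eq_closure_of_subset_of_eRk_ge_eRk hXY (by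
    rw [← coe_natRk, ← coe_natRk]; exact_mod_cast h)
  rw [this]
  exact M.subset_closure Y

theorem natRk_eq_of_subset_closure {X Y : Set α} (hXY : X ⊆ Y) (h : Y ⊆ M.closure X) :
    M.natRk Y = M.natRk X :=
  ((M.natRk_mono h).trans (M.natRk_closure X).le).antisymm (M.natRk_mono hXY)

variable {M}

theorem IsFlat.closure_subset {F X : Set α} (hF : M.IsFlat F) (h : X ⊆ F) : M.closure X ⊆ F := by
  simpa [hF.closure] using M.closure_subset_closure h

theorem IsFlat.natRk_lt {F Y : Set α} (hF : M.IsFlat F) (h : F ⊂ Y) (hY : Y ⊆ M.E) :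
    M.natRk F < M.natRk Y := by
  by_contra! hle
  have := M.subset_closure_of_natRk_le h.subset hY hle
  rw [hF.closure] at this
  exact h.not_subset this

theorem IsFlat.inter' {F F' : Set α} (hF : M.IsFlat F) (hF' : M.IsFlat F') : M.IsFlat (F ∩ F') := by
  rw [Set.inter_eq_iInter]
  exact IsFlat.iInter (by rintro (_ | _) <;> assumption)

variable (M) in
theorem isFlat_empty [M.Loopless] : M.IsFlat ∅ := by
  rw [isFlat_iff_closure_eq, closure_empty, loops_eq_empty]

/-- A nonempty flat contains a flat of rank one less. -/
theorem IsFlat.exists_natRk_add_one {F : Set α} [M.Loopless] (hF : M.IsFlat F)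
    (hne : F.Nonempty) : ∃ F', M.IsFlat F' ∧ F' ⊂ F ∧ M.natRk F = M.natRk F' + 1 := by
  obtain ⟨I, hI⟩ := M.exists_isBasis F hF.subset_ground
  obtain ⟨e, he⟩ : I.Nonempty := by
    by_contra! h
    subst h
    have := hI.subset_closure
    rw [closure_empty, loops_eq_empty] at this
    exact hne.ne_empty (Set.subset_empty_iff.1 this)
  have hJ : M.Indep (I \ {e}) := hI.indep.subset Set.sdiff_subset
  have hIF : M.closure I = F := by rw [hI.closure_eq_closure, hF.closure]
  refine ⟨M.closure (I \ {e}), isFlat_closure _, ?_, ?_⟩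
  · rw [← hIF]
    exact hI.indep.closure_sdiff_singleton_ssubset he
  · rw [natRk_closure, natRk_eq_of_indep _ hJ, natRk_eq_of_isBasis' _ hI.isBasis',
      Set.ncard_sdiff_singleton_add_one he (M.ground_finite.subset hI.indep.subset_ground)]

end NatRk

/-! ### Building sets -/

section BuildingSet

variable {α : Type*} {M : Matroid α} [M.Finite] [M.Loopless] {𝒢 : Set (Set α)}

theorem closure_empty_of_loopless : M.closure ∅ = ∅ := by
  rw [closure_empty, loops_eq_empty]

theorem IsBuildingSet.nonempty (h : M.IsBuildingSet 𝒢) {G : Set α} (hG : G ∈ 𝒢) : G.Nonempty := by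
  have := h.ssubset G hG
  rwa [closure_empty_of_loopless, Set.empty_ssubset] at this

theorem buildingFactors_subset (X : Set α) : buildingFactors 𝒢 X ⊆ 𝒢 := fun _ h => h.1.1

theorem subset_of_mem_buildingFactors {X G : Set α} (hG : G ∈ buildingFactors 𝒢 X) : G ⊆ X :=
  hG.1.2

theorem IsBuildingSet.finite_buildingFactors (h : M.IsBuildingSet 𝒢) (X : Set α) :
    (buildingFactors 𝒢 X).Finite :=
  h.finite.subset (buildingFactors_subset X)

theorem IsBuildingSet.exists_mem_buildingFactors (h : M.IsBuildingSet 𝒢) {G X : Set α}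
    (hG : G ∈ 𝒢) (hGX : G ⊆ X) : ∃ K ∈ buildingFactors 𝒢 X, G ⊆ K := by
  have hfin : {H | H ∈ 𝒢 ∧ H ⊆ X}.Finite := h.finite.subset fun _ h => h.1
  obtain ⟨K, hGK, hK⟩ := hfin.exists_le_maximal (a := G) ⟨hG, hGX⟩
  exact ⟨K, hK, hGK⟩

/-- The properties of the factors of a flat that follow from the product decomposition. -/
theorem IsBuildingSet.buildingFactors_spec (h : M.IsBuildingSet 𝒢) {X : Set α}
    (hX : M.IsFlat X) (hne : X.Nonempty) :
    (buildingFactors 𝒢 X).PairwiseDisjoint id ∧ X ⊆ ⋃₀ buildingFactors 𝒢 X ∧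
      ∑ᶠ G ∈ buildingFactors 𝒢 X, M.natRk G ≤ M.natRk X := by
  classical
  obtain ⟨φ, hφ⟩ := h.exists_orderIso X hX (by
    rw [closure_empty_of_loopless]; exact Set.empty_ssubset.2 hne)
  rw [closure_empty_of_loopless] at hφ
  have := (h.finite_buildingFactors X).fintype
  let bot : ∀ G : buildingFactors 𝒢 X, M.FlatsBelow (G : Set α) :=
    fun G => ⟨∅, M.isFlat_empty, Set.empty_subset _⟩
  let e : ∀ G : buildingFactors 𝒢 X, M.FlatsBelow (G : Set α) → ∀ H : buildingFactors 𝒢 X,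
    M.FlatsBelow (H : Set α) := fun G F => Function.update bot G F
  have hbot : ∀ v, bot ≤ v := fun v G => Set.empty_subset _
  let top : ∀ G : buildingFactors 𝒢 X, M.FlatsBelow (G : Set α) :=
    fun G => ⟨G, h.isFlat _ G.2.1.1, subset_rfl⟩
  have he : ∀ G, (φ (e G (top G)) : Set α) = G := by
    intro G
    refine hφ G _ (by simp [e, top]) fun H hH => ?_
    simp [e, hH, bot]
  have hφbot : (φ bot : Set α) = ∅ := by
    have h1 : φ bot ≤ ⟨∅, M.isFlat_empty, Set.empty_subset _⟩ := by
      rw [← φ.le_symm_apply]; exact hbot _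
    exact Set.subset_empty_iff.1 h1
  refine ⟨?_, ?_, ?_⟩
  -- Disjointness: the preimage of G ∩ H lies below the tuples supported at G alone and at H alone,
  -- hence is the bottom.
  · intro G hG H hH hne
    have h1 : φ.symm ⟨G ∩ H, (h.isFlat _ hG.1.1).inter' (h.isFlat _ hH.1.1),
        Set.inter_subset_left.trans hG.1.2⟩ ≤ bot := by
      intro K
      have hl : φ.symm ⟨G ∩ H, (h.isFlat _ hG.1.1).inter' (h.isFlat _ hH.1.1),
          Set.inter_subset_left.trans hG.1.2⟩ ≤ e ⟨G, hG⟩ (top ⟨G, hG⟩) := by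
        rw [φ.symm_apply_le, ← Subtype.coe_le_coe, he]
        exact Set.inter_subset_left
      have hr : φ.symm ⟨G ∩ H, (h.isFlat _ hG.1.1).inter' (h.isFlat _ hH.1.1),
          Set.inter_subset_left.trans hG.1.2⟩ ≤ e ⟨H, hH⟩ (top ⟨H, hH⟩) := by
        rw [φ.symm_apply_le, ← Subtype.coe_le_coe, he]
        exact Set.inter_subset_right
      by_cases hK : K = ⟨G, hG⟩
      · refine (hr K).trans_eq ?_
        have : K ≠ ⟨H, hH⟩ := by rintro rfl; exact hne (congrArg Subtype.val hK).symm
        simp [e, this]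
      · exact (hl K).trans_eq (by simp [e, hK])
    rw [φ.symm_apply_le, ← Subtype.coe_le_coe, hφbot] at h1
    exact Set.disjoint_iff_inter_eq_empty.2 (Set.subset_empty_iff.1 h1)
  -- Covering: the preimage of the atom cl {x} has a nontrivial coordinate G. The tuple with only
  -- that coordinate maps to a nonempty flat inside the atom, which contains x, and inside G.
  · intro x hx
    have hxE := hX.subset_ground hx
    let A : M.FlatsBelow X := ⟨M.closure {x}, isFlat_closure _,
      hX.closure_subset (Set.singleton_subset_iff.2 hx)⟩
    have hxA : x ∈ (A : Set α) := M.mem_closure_self x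
    obtain ⟨G, hG⟩ : ∃ G, φ.symm A G ≠ bot G := by
      by_contra! hc
      have : φ.symm A = bot := funext hc
      rw [φ.symm_apply_eq] at this
      rw [this, hφbot] at hxA
      exact hxA
    have h1 : φ (e G (φ.symm A G)) ≤ A := by
      rw [← φ.le_symm_apply]
      intro H
      by_cases hH : H = G
      · subst hH; simp [e]
      · simp only [e, Function.update_of_ne hH]; exact hbot _ H
    have h2 : (φ (e G (φ.symm A G)) : Set α).Nonempty := by
      rw [Set.nonempty_iff_ne_empty]
      intro h0
      have : φ (e G (φ.symm A G)) = φ bot := Subtype.ext (h0.trans hφbot.symm)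
      have := congrFun (φ.injective this) G
      simp only [e, Function.update_self] at this
      exact hG this
    obtain ⟨y, hy⟩ := h2
    have hyE : y ∈ M.E := (φ (e G (φ.symm A G))).2.1.subset_ground hy
    have hxy : M.closure {y} = M.closure {x} :=
      (isNonloop_of_loopless (M := M) hyE).closure_eq_of_mem_closure (h1 hy)
    have h3 : x ∈ (φ (e G (φ.symm A G)) : Set α) :=
      (φ (e G (φ.symm A G))).2.1.closure_subset (Set.singleton_subset_iff.2 hy)
        (by rw [hxy]; exact M.mem_closure_self x)
    have h4 : φ (e G (φ.symm A G)) ≤ φ (e G (top G)) := by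
      rw [φ.le_iff_le]
      intro H
      by_cases hH : H = G
      · subst hH
        simp only [e, Function.update_self]
        exact (φ.symm A H).2.2
      · simp [e, Function.update_of_ne hH]
    rw [← Subtype.coe_le_coe, he] at h4
    exact ⟨G, G.2, h4 h3⟩
  -- Rank: lowering one coordinate by one rank strictly lowers the image, so the rank of the image
  -- is at least the sum of the ranks of the coordinates.
  · have key : ∀ n, ∀ v : ∀ G : buildingFactors 𝒢 X, M.FlatsBelow (G : Set α),
        ∑ G, M.natRk (v G) = n → n ≤ M.natRk (φ v) := by
      intro n
      induction n with
      | zero => intro v _; exact Nat.zero_le _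
      | succ n ih =>
        intro v hv
        obtain ⟨G, hG⟩ : ∃ G, M.natRk (v G) ≠ 0 := by
          by_contra! hc
          simp [hc] at hv
        have hGne : (v G : Set α).Nonempty := by
          rw [Set.nonempty_iff_ne_empty]
          intro h0
          rw [h0, natRk_empty] at hG
          exact hG rfl
        obtain ⟨F, hF, hlt, hrk⟩ := (v G).2.1.exists_natRk_add_one hGne
        let v' := Function.update v G ⟨F, hF, hlt.subset.trans (v G).2.2⟩
        have hv' : v' < v := by
          refine lt_of_le_of_ne ?_ ?_
          · intro H
            by_cases hH : H = G
            · subst hH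
              simp only [v', Function.update_self]
              exact hlt.subset
            · simp [v', hH]
          · intro h0
            have := congrArg Subtype.val (congrFun h0 G)
            simp only [v', Function.update_self] at this
            exact hlt.ne this
        have hs : ∑ H, M.natRk (v' H) = n := by
          have h1 := Finset.add_sum_erase Finset.univ (fun H => M.natRk (v H)) (Finset.mem_univ G)
          have h2 := Finset.add_sum_erase Finset.univ (fun H => M.natRk (v' H)) (Finset.mem_univ G)
          have h3 : ∑ H ∈ Finset.univ.erase G, M.natRk (v' H) =
              ∑ H ∈ Finset.univ.erase G, M.natRk (v H) :=
            Finset.sum_congr rfl fun H hH => by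
              simp only [v', Function.update_of_ne (Finset.ne_of_mem_erase hH)]
          have h4 : M.natRk (v' G) = M.natRk F := by simp [v']
          omega
        have := (φ v').2.1.natRk_lt (φ.strictMono hv') (φ v).2.1.subset_ground
        have := ih v' hs
        omega
    have := key _ top rfl
    rw [finsum_mem_eq_finite_toFinset_sum _ (h.finite_buildingFactors X)]
    refine le_trans (le_of_eq ?_) (this.trans (M.natRk_mono (φ top).2.2))
    rw [← Finset.sum_coe_sort]
    exact Fintype.sum_equiv
      (Equiv.subtypeEquivRight fun G => Set.Finite.mem_toFinset _) _ _ fun G => rfl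

/-- Flats of a building set with a common point have their join in the building set. -/
theorem IsBuildingSet.closure_union_mem (h : M.IsBuildingSet 𝒢) {G H : Set α} (hG : G ∈ 𝒢)
    (hH : H ∈ 𝒢) (hGH : (G ∩ H).Nonempty) : M.closure (G ∪ H) ∈ 𝒢 := by
  have hsub : G ∪ H ⊆ M.closure (G ∪ H) := M.subset_closure _
    (Set.union_subset (h.isFlat G hG).subset_ground (h.isFlat H hH).subset_ground)
  obtain ⟨x, hx⟩ := hGH
  obtain ⟨hd, -, -⟩ := h.buildingFactors_spec (isFlat_closure (M := M) (G ∪ H))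
    ⟨x, hsub (Or.inl hx.1)⟩
  obtain ⟨K, hK, hGK⟩ := h.exists_mem_buildingFactors hG (Set.subset_union_left.trans hsub)
  obtain ⟨L, hL, hHL⟩ := h.exists_mem_buildingFactors hH (Set.subset_union_right.trans hsub)
  -- The factors of the join are disjoint, so the common point forces G and H into one factor, which
  -- is then the join itself.
  have hKL : K = L := hd.elim_set hK hL x (hGK hx.1) (hHL hx.2)
  subst hKL
  have : M.closure (G ∪ H) = K := subset_antisymm
    ((h.isFlat K hK.1.1).closure_subset (Set.union_subset hGK hHL)) hK.1.2
  rw [this]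
  exact hK.1.1

/-! ### Joins of nested antichains -/

theorem natRk_sUnion_le (M : Matroid α) [M.Finite] (T : Finset (Set α)) :
    M.natRk (⋃₀ (T : Set (Set α))) ≤ ∑ G ∈ T, M.natRk G := by
  classical
  induction T using Finset.induction with
  | empty => simp
  | insert G T hG ih =>
    rw [Finset.coe_insert, Set.sUnion_insert, Finset.sum_insert hG]
    exact (M.natRk_union_le _ _).trans (Nat.add_le_add_left ih _)

/-- A nested antichain is the set of factors of its join. -/
theorem IsBuildingSet.buildingFactors_closure_sUnion (h : M.IsBuildingSet 𝒢)
    {T : Finset (Set α)} (hT : T ∈ M.nestedSets 𝒢)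
    (hanti : IsAntichain (· ⊆ ·) (T : Set (Set α))) (hne : T.Nonempty) :
    buildingFactors 𝒢 (M.closure (⋃₀ (T : Set (Set α)))) = T := by
  classical
  have hTE : ⋃₀ (T : Set (Set α)) ⊆ M.E :=
    Set.sUnion_subset fun G hG => (h.isFlat G (hT.1 hG)).subset_ground
  set X := M.closure (⋃₀ (T : Set (Set α))) with hX
  have hTX : ∀ G ∈ T, G ⊆ X := fun G hG =>
    (Set.subset_sUnion_of_mem hG).trans (M.subset_closure _ hTE)
  have hXne : X.Nonempty := by
    obtain ⟨G, hG⟩ := hne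
    exact (h.nonempty (hT.1 hG)).mono (hTX G hG)
  obtain ⟨hd, -, hrk⟩ := h.buildingFactors_spec (isFlat_closure (M := M) _) hXne
  have hfin := h.finite_buildingFactors X
  rw [finsum_mem_eq_finite_toFinset_sum _ hfin] at hrk
  -- `f K` collects the members of T inside the factor K. Since ∑ rk K ≤ rk X ≤ ∑ rk (f K), each `f
  -- K` must span K.
  let f : Set α → Set α := fun K => ⋃₀ ({G ∈ T | G ⊆ K} : Finset (Set α))
  have hfK : ∀ K, f K ⊆ K := fun K => Set.sUnion_subset fun G hG => by simp_all
  have hle : M.natRk X ≤ ∑ K ∈ hfin.toFinset, M.natRk (f K) := by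
    refine (M.natRk_closure _).le.trans ?_
    have : ⋃₀ (T : Set (Set α)) ⊆ ⋃₀ ((hfin.toFinset.image f : Finset (Set α)) : Set (Set α)) := by
      refine Set.sUnion_subset fun G hG => ?_
      obtain ⟨K, hK, hGK⟩ := h.exists_mem_buildingFactors (hT.1 hG) (hTX G hG)
      have h1 : G ⊆ f K := Set.subset_sUnion_of_mem (by simpa using ⟨hG, hGK⟩)
      exact h1.trans (Set.subset_sUnion_of_mem (by
        simp only [Finset.coe_image, Set.Finite.coe_toFinset]; exact ⟨K, hK, rfl⟩))
    refine (M.natRk_mono this).trans ((M.natRk_sUnion_le _).trans ?_)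
    exact Finset.sum_image_le_of_nonneg fun _ _ => Nat.zero_le _
  have heq : ∀ K ∈ hfin.toFinset, M.natRk (f K) = M.natRk K :=
    (Finset.sum_eq_sum_iff_of_le fun K _ => M.natRk_mono (hfK K)).1
      (le_antisymm (Finset.sum_le_sum fun K _ => M.natRk_mono (hfK K)) (hrk.trans hle))
  have hmem : ∀ K ∈ buildingFactors 𝒢 X, K ∈ T := by
    intro K hK
    have hKne := h.nonempty hK.1.1
    have hcl : M.closure (f K) = K := by
      refine subset_antisymm ((h.isFlat K hK.1.1).closure_subset (hfK K)) ?_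
      exact M.subset_closure_of_natRk_le (hfK K) (h.isFlat K hK.1.1).subset_ground
        (heq K (hfin.mem_toFinset.2 hK)).ge
    -- Two or more members of T spanning K would have their join K in 𝒢, against nestedness; none
    -- would make K empty. So K is a single member of T.
    have hcard : ¬ 2 ≤ ({G ∈ T | G ⊆ K} : Finset (Set α)).card := fun hc =>
      hT.2 _ (Finset.filter_subset _ _)
        (hanti.subset (Finset.coe_subset.2 (Finset.filter_subset _ _))) hc
        (by rw [show M.closure (⋃₀ _) = K from hcl]; exact hK.1.1)
    have hcard' : ({G ∈ T | G ⊆ K} : Finset (Set α)).card ≠ 0 := by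
      intro h0
      rw [Finset.card_eq_zero] at h0
      simp only [f, h0, Finset.coe_empty, Set.sUnion_empty, closure_empty_of_loopless] at hcl
      exact hKne.ne_empty hcl.symm
    obtain ⟨G, hG⟩ := Finset.card_eq_one.1
      (show ({G ∈ T | G ⊆ K} : Finset (Set α)).card = 1 by omega)
    have hGT : G ∈ T ∧ G ⊆ K := by
      have h1 := Finset.mem_singleton_self G
      rw [← hG] at h1
      exact Finset.mem_filter.1 h1
    simp only [f, hG, Finset.coe_singleton, Set.sUnion_singleton] at hcl
    rw [(h.isFlat G (hT.1 hGT.1)).closure] at hcl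
    exact hcl ▸ hGT.1
  refine subset_antisymm hmem fun G hG => ?_
  obtain ⟨K, hK, hGK⟩ := h.exists_mem_buildingFactors (hT.1 hG) (hTX G hG)
  rwa [hanti.eq hG (hmem K hK) hGK]

theorem nestedSets_subset {S T : Finset (Set α)} (hS : S ∈ M.nestedSets 𝒢) (hTS : T ⊆ S) :
    T ∈ M.nestedSets 𝒢 :=
  ⟨(Finset.coe_subset.2 hTS).trans hS.1, fun U hU => hS.2 U (hU.trans hTS)⟩

/-- The join of a nested antichain is its union. -/
theorem IsBuildingSet.isFlat_sUnion (h : M.IsBuildingSet 𝒢)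
    {T : Finset (Set α)} (hT : T ∈ M.nestedSets 𝒢)
    (hanti : IsAntichain (· ⊆ ·) (T : Set (Set α))) : M.IsFlat (⋃₀ (T : Set (Set α))) := by
  rcases T.eq_empty_or_nonempty with rfl | hne
  · simpa using M.isFlat_empty
  have hTE : ⋃₀ (T : Set (Set α)) ⊆ M.E :=
    Set.sUnion_subset fun G hG => (h.isFlat G (hT.1 hG)).subset_ground
  have hXne : (M.closure (⋃₀ (T : Set (Set α)))).Nonempty := by
    obtain ⟨G, hG⟩ := hne
    exact (h.nonempty (hT.1 hG)).mono
      ((Set.subset_sUnion_of_mem hG).trans (M.subset_closure _ hTE))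
  obtain ⟨-, hU, -⟩ := h.buildingFactors_spec (isFlat_closure (M := M) _) hXne
  rw [h.buildingFactors_closure_sUnion hT hanti hne] at hU
  rw [isFlat_iff_closure_eq]
  exact subset_antisymm hU (M.subset_closure _ hTE)

/-- The members of T are the factors of their join, and the ranks of factors add up. Subadditivity
gives the other inequality. -/
theorem IsBuildingSet.sum_natRk_le (h : M.IsBuildingSet 𝒢)
    {T : Finset (Set α)} (hT : T ∈ M.nestedSets 𝒢)
    (hanti : IsAntichain (· ⊆ ·) (T : Set (Set α))) :
    ∑ G ∈ T, M.natRk G ≤ M.natRk (⋃₀ (T : Set (Set α))) := by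
  rcases T.eq_empty_or_nonempty with rfl | hne
  · simp
  have hTE : ⋃₀ (T : Set (Set α)) ⊆ M.E :=
    Set.sUnion_subset fun G hG => (h.isFlat G (hT.1 hG)).subset_ground
  have hXne : (M.closure (⋃₀ (T : Set (Set α)))).Nonempty := by
    obtain ⟨G, hG⟩ := hne
    exact (h.nonempty (hT.1 hG)).mono
      ((Set.subset_sUnion_of_mem hG).trans (M.subset_closure _ hTE))
  obtain ⟨-, -, hU⟩ := h.buildingFactors_spec (isFlat_closure (M := M) _) hXne
  rw [h.buildingFactors_closure_sUnion hT hanti hne, natRk_closure] at hU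
  rwa [finsum_mem_coe_finset] at hU

/-- A member of the building set below the join of a nested antichain is below one of its
members. -/
theorem IsBuildingSet.exists_subset_of_subset_sUnion (h : M.IsBuildingSet 𝒢)
    {T : Finset (Set α)} (hT : T ∈ M.nestedSets 𝒢)
    (hanti : IsAntichain (· ⊆ ·) (T : Set (Set α))) {G : Set α} (hG : G ∈ 𝒢)
    (hGT : G ⊆ ⋃₀ (T : Set (Set α))) : ∃ H ∈ T, G ⊆ H := by
  rcases T.eq_empty_or_nonempty with rfl | hne
  · simp only [Finset.coe_empty, Set.sUnion_empty] at hGT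
    exact absurd (Set.subset_empty_iff.1 hGT) (h.nonempty hG).ne_empty
  have := h.buildingFactors_closure_sUnion hT hanti hne
  rw [(h.isFlat_sUnion hT hanti).closure] at this
  obtain ⟨K, hK, hGK⟩ := h.exists_mem_buildingFactors hG hGT
  rw [this] at hK
  exact ⟨K, hK, hGK⟩

/-- Incomparable members of a nested set are disjoint. -/
theorem IsBuildingSet.disjoint_of_nested (h : M.IsBuildingSet 𝒢) {S : Finset (Set α)}
    (hS : S ∈ M.nestedSets 𝒢) {G H : Set α} (hG : G ∈ S) (hH : H ∈ S) (hGH : ¬ G ⊆ H)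
    (hHG : ¬ H ⊆ G) : Disjoint G H := by
  classical
  by_contra hd
  have hne : G ≠ H := by rintro rfl; exact hGH subset_rfl
  refine hS.2 {G, H} (by simp [Finset.insert_subset_iff, hG, hH]) ?_
    (by rw [Finset.card_pair hne]) ?_
  · simp only [Finset.coe_insert, Finset.coe_singleton]
    intro A hA B hB hAB
    rcases hA with rfl | rfl <;> rcases hB with rfl | rfl <;> first | exact (hAB rfl).elim | assumption
  · simpa using h.closure_union_mem (hS.1 hG) (hS.1 hH) (Set.not_disjoint_iff_nonempty_inter.1 hd)

/-- The maximal members of a finite set of sets. -/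
noncomputable def maxMembers (S : Finset (Set α)) : Finset (Set α) := by
  classical exact S.filter fun G => ∀ H ∈ S, G ⊆ H → H ⊆ G

theorem mem_maxMembers {S : Finset (Set α)} {G : Set α} :
    G ∈ maxMembers S ↔ G ∈ S ∧ ∀ H ∈ S, G ⊆ H → H ⊆ G := by
  simp [maxMembers]

theorem maxMembers_subset (S : Finset (Set α)) : maxMembers S ⊆ S :=
  fun _ h => (mem_maxMembers.1 h).1

theorem isAntichain_maxMembers (S : Finset (Set α)) :
    IsAntichain (· ⊆ ·) (maxMembers S : Set (Set α)) := fun _ hA _ hB hAB hle =>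
  hAB (subset_antisymm hle ((mem_maxMembers.1 hA).2 _ (mem_maxMembers.1 hB).1 hle))

theorem exists_mem_maxMembers {S : Finset (Set α)} {G : Set α} (hG : G ∈ S) :
    ∃ H ∈ maxMembers S, G ⊆ H := by
  obtain ⟨H, hGH, hH⟩ := S.finite_toSet.exists_le_maximal hG
  exact ⟨H, mem_maxMembers.2 ⟨hH.1, fun K hK hHK => hH.2 hK hHK⟩, hGH⟩

theorem sUnion_maxMembers (S : Finset (Set α)) :
    ⋃₀ (maxMembers S : Set (Set α)) = ⋃₀ (S : Set (Set α)) := by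
  refine subset_antisymm (Set.sUnion_mono (Finset.coe_subset.2 (maxMembers_subset S))) ?_
  refine Set.sUnion_subset fun G hG => ?_
  obtain ⟨H, hH, hGH⟩ := exists_mem_maxMembers hG
  exact hGH.trans (Set.subset_sUnion_of_mem hH)

/-- The union of the members of `S` strictly below `G`. -/
def below (S : Finset (Set α)) (G : Set α) : Set α := ⋃₀ {H | H ∈ S ∧ H ⊂ G}

theorem below_subset (S : Finset (Set α)) (G : Set α) : below S G ⊆ G :=
  Set.sUnion_subset fun _ h => h.2.subset

theorem subset_below {S : Finset (Set α)} {G H : Set α} (hH : H ∈ S) (hHG : H ⊂ G) :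
    H ⊆ below S G := Set.subset_sUnion_of_mem ⟨hH, hHG⟩

theorem below_mono {S T : Finset (Set α)} (h : S ⊆ T) (G : Set α) : below S G ⊆ below T G :=
  Set.sUnion_mono fun _ hH => ⟨h hH.1, hH.2⟩

/-- The maximal members of `S` strictly below `G`. -/
noncomputable def maxBelow (S : Finset (Set α)) (G : Set α) : Finset (Set α) := by
  classical exact maxMembers (S.filter (· ⊂ G))

theorem mem_of_mem_maxBelow {S : Finset (Set α)} {G H : Set α} (h : H ∈ maxBelow S G) :
    H ∈ S ∧ H ⊂ G := by
  classical
  simpa using maxMembers_subset _ h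

theorem maxBelow_subset (S : Finset (Set α)) (G : Set α) : maxBelow S G ⊆ S :=
  fun _ h => (mem_of_mem_maxBelow h).1

theorem isAntichain_maxBelow (S : Finset (Set α)) (G : Set α) :
    IsAntichain (· ⊆ ·) (maxBelow S G : Set (Set α)) := isAntichain_maxMembers _

theorem sUnion_maxBelow (S : Finset (Set α)) (G : Set α) :
    ⋃₀ (maxBelow S G : Set (Set α)) = below S G := by
  classical
  rw [maxBelow, sUnion_maxMembers, below]
  congr 1
  ext H
  simp

theorem IsBuildingSet.isFlat_below (h : M.IsBuildingSet 𝒢) {S : Finset (Set α)}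
    (hS : S ∈ M.nestedSets 𝒢) (G : Set α) : M.IsFlat (below S G) := by
  rw [← sUnion_maxBelow]
  exact h.isFlat_sUnion (nestedSets_subset hS (maxBelow_subset S G)) (isAntichain_maxBelow S G)

theorem IsBuildingSet.exists_of_subset_below (h : M.IsBuildingSet 𝒢) {S : Finset (Set α)}
    (hS : S ∈ M.nestedSets 𝒢) {G H : Set α} (hH : H ∈ 𝒢) (hHG : H ⊆ below S G) :
    ∃ K ∈ S, K ⊂ G ∧ H ⊆ K := by
  rw [← sUnion_maxBelow] at hHG
  obtain ⟨K, hK, hHK⟩ := h.exists_subset_of_subset_sUnion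
    (nestedSets_subset hS (maxBelow_subset S G)) (isAntichain_maxBelow S G) hH hHG
  exact ⟨K, (mem_of_mem_maxBelow hK).1, (mem_of_mem_maxBelow hK).2, hHK⟩

/-- A member of 𝒢 inside the union below G lies in a single K ⊂ G, so G itself is not inside it.
Hence all the rank drops d_G are positive. -/
theorem IsBuildingSet.below_ssubset (h : M.IsBuildingSet 𝒢) {S : Finset (Set α)}
    (hS : S ∈ M.nestedSets 𝒢) {G : Set α} (hG : G ∈ 𝒢) : below S G ⊂ G := by
  refine (below_subset S G).ssubset_of_not_subset fun hle => ?_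
  obtain ⟨K, -, hK, hGK⟩ := h.exists_of_subset_below hS hG hle
  exact hK.not_subset hGK

theorem IsBuildingSet.natRk_below_lt (h : M.IsBuildingSet 𝒢) {S : Finset (Set α)}
    (hS : S ∈ M.nestedSets 𝒢) {G : Set α} (hG : G ∈ 𝒢) :
    M.natRk (below S G) < M.natRk G :=
  (h.isFlat_below hS G).natRk_lt (h.below_ssubset hS hG) (h.isFlat G hG).subset_ground

theorem IsBuildingSet.natRk_below (h : M.IsBuildingSet 𝒢) {S : Finset (Set α)}
    (hS : S ∈ M.nestedSets 𝒢) (G : Set α) :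
    M.natRk (below S G) = ∑ H ∈ maxBelow S G, M.natRk H := by
  rw [← sUnion_maxBelow]
  exact le_antisymm (M.natRk_sUnion_le _)
    (h.sum_natRk_le (nestedSets_subset hS (maxBelow_subset S G)) (isAntichain_maxBelow S G))

end BuildingSet

/-! ### A blow-up presentation -/

/-- In `R[X] / (I, X J, P)` with `P` monic and `P(0) J ⊆ I`, a polynomial of degree less than
that of `P` vanishes only if its constant coefficient is in `I` and all its coefficients
are in `J`. -/
theorem coeff_mem_of_mem_blowup {R : Type*} [CommRing R] {I J : Ideal R} (hIJ : I ≤ J)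
    {P : Polynomial R} (hP : P.Monic) (h0 : ∀ j ∈ J, P.coeff 0 * j ∈ I) {f : Polynomial R}
    (hdeg : f.degree < P.degree)
    (hf : f ∈ I.map Polynomial.C ⊔ Ideal.span {Polynomial.X} * J.map Polynomial.C ⊔
      Ideal.span {P}) :
    f.coeff 0 ∈ I ∧ ∀ i, f.coeff i ∈ J := by
  obtain ⟨g, hg, r, hr, rfl⟩ := Submodule.mem_sup.1 hf
  obtain ⟨a, ha, b, hb, rfl⟩ := Submodule.mem_sup.1 hg
  obtain ⟨b, hb', rfl⟩ := Ideal.mem_span_singleton_mul.1 hb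
  clear hb
  obtain ⟨q, rfl⟩ := Ideal.mem_span_singleton.1 hr
  rw [Ideal.mem_map_C_iff] at ha hb'
  let φ := Polynomial.mapRingHom (Ideal.Quotient.mk J)
  have hφ : ∀ g : Polynomial R, φ g = 0 ↔ ∀ i, g.coeff i ∈ J := by
    intro g
    simp only [φ, Polynomial.ext_iff, Polynomial.coe_mapRingHom, Polynomial.coeff_map,
      Polynomial.coeff_zero, Ideal.Quotient.eq_zero_iff_mem]
  have hPm : (φ P).Monic := hP.map _
  -- Modulo J only the multiple of the monic P is left. Its degree is too small unless it vanishes,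
  -- and then q vanishes modulo J too, so the constant coefficient is a(0) + P(0) q(0) with q(0) in
  -- J.
  have h1 : φ (a + Polynomial.X * b + P * q) = φ P * φ q := by
    rw [map_add, map_add, map_mul, map_mul, (hφ a).2 fun i => hIJ (ha i), (hφ b).2 hb']
    ring
  have h2 : φ (a + Polynomial.X * b + P * q) = 0 := by
    by_contra hne
    have hnt : Nontrivial (R ⧸ J) := by
      by_contra hn
      rw [not_nontrivial_iff_subsingleton] at hn
      exact hne (Subsingleton.elim _ _)
    refine hPm.not_dvd_of_degree_lt hne ?_ ⟨φ q, h1⟩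
    refine Polynomial.degree_map_le.trans_lt (hdeg.trans_eq ?_)
    exact (hP.degree_map _).symm
  have h3 : φ q = 0 := by
    rw [h2] at h1
    exact (hPm.mul_right_eq_zero_iff).1 h1.symm
  refine ⟨?_, (hφ _).1 h2⟩
  have h4 := (hφ q).1 h3 0
  simp only [Polynomial.coeff_add, Polynomial.mul_coeff_zero, Polynomial.coeff_X_zero, zero_mul,
    add_zero]
  exact I.add_mem (ha 0) (h0 _ h4)

/-- If `a b = a c` modulo `I`, then `a b ^ n = a c ^ n` modulo `I`. -/
theorem mul_pow_sub_mul_pow_mem {R : Type*} [CommRing R] {I : Ideal R} {a b c : R}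
    (h : a * b - a * c ∈ I) (n : ℕ) : a * b ^ n - a * c ^ n ∈ I := by
  obtain ⟨d, hd⟩ := sub_dvd_pow_sub_pow b c n
  have : a * b ^ n - a * c ^ n = (a * b - a * c) * d := by
    rw [← mul_sub, hd, ← mul_sub, mul_assoc]
  rw [this]
  exact I.mul_mem_right _ h

/-! ### Relations of the Feichtner-Yuzvinsky ring -/

section Relations

variable {α : Type*} {M : Matroid α} [M.Finite] [M.Loopless] {𝒢 : Set (Set α)} [Fintype 𝒢]

open MvPolynomial

open scoped Classical in
/-- The sum of the variables of the members of `𝒢` that contain `B`. -/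
noncomputable def upSum (B : 𝒢) : MvPolynomial 𝒢 ℤ := ∑ H : 𝒢 with B ≤ H, X H

/-- The union of a finite family of members of `𝒢`. -/
def unionOf (T : Finset 𝒢) : Set α := ⋃ A ∈ T, (A : Set α)

theorem subset_unionOf {T : Finset 𝒢} {A : 𝒢} (h : A ∈ T) : (A : Set α) ⊆ unionOf T :=
  Set.subset_biUnion_of_mem (u := fun A : 𝒢 => (A : Set α)) h

theorem unionOf_subset {T : Finset 𝒢} {Y : Set α} (h : ∀ A ∈ T, (A : Set α) ⊆ Y) :
    unionOf T ⊆ Y := Set.iUnion₂_subset h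

theorem unionOf_insert [DecidableEq 𝒢] (T : Finset 𝒢) (A : 𝒢) :
    unionOf (insert A T) = (A : Set α) ∪ unionOf T := by
  rw [unionOf, unionOf, Finset.set_biUnion_insert]

/-- The relation `∏_{A ∈ T} x_A · (∑_{H ⊇ B} x_H) ^ (rk B - rk (⋃ T ∪ ⋃ S_{< B}))`. -/
noncomputable def relator (M : Matroid α) (S : Finset (Set α)) (T : Finset 𝒢) (B : 𝒢) :
    MvPolynomial 𝒢 ℤ :=
  (∏ A ∈ T, X A) * upSum B ^ (M.natRk (B : Set α) - M.natRk (unionOf T ∪ below S B))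

/-- The ideal of relations among the variables in `U`, relative to the flats in `S`; the variables
outside `U` are set to zero. -/
noncomputable def relIdeal (M : Matroid α) (U : Finset 𝒢) (S : Finset (Set α)) :
    Ideal (MvPolynomial 𝒢 ℤ) :=
  Ideal.span ({p | ∃ H ∉ U, p = X H} ∪
    {p | ∃ B ∈ U, ∃ T ⊆ U, (∀ A ∈ T, A < B) ∧ p = relator M S T B})

theorem X_mem_relIdeal {U : Finset 𝒢} (S : Finset (Set α)) {H : 𝒢} (hH : H ∉ U) :
    X H ∈ relIdeal M U S := Ideal.subset_span (Or.inl ⟨H, hH, rfl⟩)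

/-- The generator in its usable form: any exponent that is at least the rank deficit, with the bound
stated without truncated subtraction. -/
theorem prod_mul_upSum_pow_mem_relIdeal {U : Finset 𝒢} {S : Finset (Set α)} {B : 𝒢} (hB : B ∈ U)
    {T : Finset 𝒢} (hT : T ⊆ U) (hTB : ∀ A ∈ T, A < B) {n : ℕ}
    (hn : M.natRk (B : Set α) ≤ n + M.natRk (unionOf T ∪ below S B)) :
    (∏ A ∈ T, X A) * upSum B ^ n ∈ relIdeal M U S := by
  have h1 : relator M S T B ∈ relIdeal M U S := Ideal.subset_span (Or.inr ⟨B, hB, T, hT, hTB, rfl⟩)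
  obtain ⟨k, rfl⟩ := Nat.exists_eq_add_of_le (Nat.sub_le_iff_le_add.2 hn)
  rw [pow_add, ← mul_assoc]
  exact Ideal.mul_mem_right _ _ h1

theorem IsBuildingSet.exists_join (h : M.IsBuildingSet 𝒢) {G H : 𝒢}
    (hGH : ((G : Set α) ∩ H).Nonempty) : ∃ J : 𝒢, G ≤ J ∧ H ≤ J ∧
      M.natRk (J : Set α) = M.natRk ((G : Set α) ∪ H) ∧ ∀ L : 𝒢, G ≤ L → H ≤ L → J ≤ L := by
  have hsub : (G : Set α) ∪ H ⊆ M.closure (G ∪ H) := M.subset_closure _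
    (Set.union_subset (h.isFlat G G.2).subset_ground (h.isFlat H H.2).subset_ground)
  exact ⟨⟨_, h.closure_union_mem G.2 H.2 hGH⟩, Set.subset_union_left.trans hsub,
    Set.subset_union_right.trans hsub, M.natRk_closure _, fun L hG hH =>
    (h.isFlat L L.2).closure_subset (Set.union_subset hG hH)⟩

/-- Multiplication by `x_H` turns the sum over the members above `B` into the sum over those above
the join of `B` and `H`. -/
theorem X_mul_upSum_sub_mem {I : Ideal (MvPolynomial 𝒢 ℤ)} {B H J : 𝒢} (hBJ : B ≤ J)
    (hJ : ∀ L : 𝒢, B ≤ L → H ≤ L → J ≤ L) (hBH : ¬ B ≤ H)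
    (hI : ∀ K : 𝒢, B ≤ K → ¬ K ≤ H → ¬ H ≤ K → (X H * X K : MvPolynomial 𝒢 ℤ) ∈ I) :
    X H * upSum B - X H * upSum J ∈ I := by
  classical
  have hsub : ({L : 𝒢 | J ≤ L} : Finset 𝒢) ⊆ ({L : 𝒢 | B ≤ L} : Finset 𝒢) := by
    intro L hL
    simp only [Finset.mem_filter, Finset.mem_univ, true_and] at hL ⊢
    exact hBJ.trans hL
  rw [← mul_sub, upSum, upSum, ← Finset.sum_sdiff_eq_sub hsub, Finset.mul_sum]
  refine I.sum_mem fun K hK => ?_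
  simp only [Finset.mem_sdiff, Finset.mem_filter, Finset.mem_univ, true_and] at hK
  exact hI K hK.1 (fun hKH => hBH (hK.1.trans hKH)) fun hHK => hK.2 (hJ K hK.1 hHK)

/-- The join J of G and H is in 𝒢, and in U since U is upward closed. The relation at J for {G, H}
has exponent zero because G ∪ H already has the rank of J. -/
theorem IsBuildingSet.X_mul_X_mem_relIdeal (h : M.IsBuildingSet 𝒢) {U : Finset 𝒢}
    (hU : ∀ G ∈ U, ∀ H, G ≤ H → H ∈ U) (S : Finset (Set α)) {G H : 𝒢} (hG : G ∈ U) (hH : H ∈ U)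
    (hGH : ¬ G ≤ H) (hHG : ¬ H ≤ G) (hne : ((G : Set α) ∩ H).Nonempty) :
    (X G * X H : MvPolynomial 𝒢 ℤ) ∈ relIdeal M U S := by
  classical
  obtain ⟨J, hGJ, hHJ, hrk, -⟩ := h.exists_join hne
  have hne' : G ≠ H := fun h0 => hGH h0.le
  have := prod_mul_upSum_pow_mem_relIdeal (M := M) (U := U) (S := S) (hU G hG J hGJ)
    (T := {G, H}) (by simp [Finset.insert_subset_iff, hG, hH]) (by
      intro A hA
      simp only [Finset.mem_insert, Finset.mem_singleton] at hA
      rcases hA with rfl | rfl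
      · exact lt_of_le_of_ne hGJ fun h0 => hHG (hHJ.trans h0.ge)
      · exact lt_of_le_of_ne hHJ fun h0 => hGH (hGJ.trans h0.ge)) (n := 0) (by
      rw [zero_add, hrk]
      refine M.natRk_mono (Set.union_subset ?_ ?_ |>.trans Set.subset_union_left)
      · exact subset_unionOf (by simp)
      · exact subset_unionOf (by simp))
  simpa [Finset.prod_pair hne'] using this

theorem prod_insert_dvd (T : Finset 𝒢) (H : 𝒢) [DecidableEq 𝒢] :
    (∏ A ∈ insert H T, X A : MvPolynomial 𝒢 ℤ) ∣ (∏ A ∈ T, X A) * X H := by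
  by_cases hH : H ∈ T
  · rw [Finset.insert_eq_of_mem hH]
    exact dvd_mul_right _ _
  · rw [Finset.prod_insert hH, mul_comm]

/-- The factor x_H turns the sum above B into the sum above J = B ∨ H. The relation at J for T ∪ {H}
then applies with the same exponent: by submodularity the deficit at J is at most rk B - rk Z. -/
theorem IsBuildingSet.prod_mul_X_mul_upSum_pow_mem (h : M.IsBuildingSet 𝒢) {U : Finset 𝒢}
    (hU : ∀ G ∈ U, ∀ H, G ≤ H → H ∈ U) (S : Finset (Set α)) {B H : 𝒢} (hB : B ∈ U) (hH : H ∈ U)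
    (hBH : ¬ B ≤ H) (hne : ((B : Set α) ∩ H).Nonempty) {T : Finset 𝒢} (hT : T ⊆ U)
    (hTB : ∀ A ∈ T, A < B) {Z : Set α} (hZB : Z ⊆ B)
    (hZ : Z ⊆ H ∪ unionOf T ∪ below S B) {n : ℕ}
    (hn : M.natRk (B : Set α) ≤ n + M.natRk Z) :
    (∏ A ∈ T, X A) * X H * upSum B ^ n ∈ relIdeal M U S := by
  classical
  obtain ⟨J, hBJ, hHJ, hrk, hJ⟩ := h.exists_join hne
  have h1 : X H * upSum B ^ n - X H * upSum J ^ n ∈ relIdeal M U S :=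
    mul_pow_sub_mul_pow_mem (X_mul_upSum_sub_mem hBJ hJ hBH fun K hBK hKH hHK =>
      h.X_mul_X_mem_relIdeal hU S hH (hU B hB K hBK) hHK hKH
        (hne.mono fun x hx => ⟨hx.2, hBK hx.1⟩)) n
  have h2 : (∏ A ∈ insert H T, X A) * upSum J ^ n ∈ relIdeal M U S := by
    refine prod_mul_upSum_pow_mem_relIdeal (hU B hB J hBJ)
      (Finset.insert_subset_iff.2 ⟨hH, hT⟩) ?_ ?_
    · intro A hA
      rcases Finset.mem_insert.1 hA with rfl | hA
      · exact lt_of_le_of_ne hHJ fun h0 => hBH (hBJ.trans h0.ge)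
      · exact (hTB A hA).trans_le hBJ
    · rw [unionOf_insert]
      set W : Set α := H ∪ unionOf T ∪ below S J with hW
      have hbel : below S B ⊆ below S J :=
        Set.sUnion_mono fun K hK => ⟨hK.1, hK.2.trans_subset hBJ⟩
      have hsm := M.natRk_submod B W
      have hz : M.natRk Z ≤ M.natRk (B ∩ W) := M.natRk_mono (Set.subset_inter hZB
        (hZ.trans (Set.union_subset_union_right _ hbel)))
      have hj : M.natRk (J : Set α) ≤ M.natRk (B ∪ W) := by
        rw [hrk]
        exact M.natRk_mono (Set.union_subset_union_right _
          (Set.subset_union_left.trans Set.subset_union_left))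
      omega
  obtain ⟨c, hc⟩ := prod_insert_dvd T H
  have h3 : (∏ A ∈ T, X A) * X H * upSum J ^ n ∈ relIdeal M U S := by
    rw [hc, mul_right_comm]
    exact Ideal.mul_mem_right _ _ h2
  have h4 := Ideal.mul_mem_left _ (∏ A ∈ T, X A) h1
  have h5 := Ideal.add_mem _ h4 h3
  convert h5 using 1
  ring

theorem below_insert_of_ssubset [DecidableEq (Set α)] (S : Finset (Set α)) {G B : Set α}
    (h : G ⊂ B) : below (insert G S) B = G ∪ below S B := by
  have : {H | H ∈ insert G S ∧ H ⊂ B} = insert G {H | H ∈ S ∧ H ⊂ B} := by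
    ext H
    simp only [Finset.mem_insert, Set.mem_ofPred_eq, Set.mem_insert_iff]
    constructor
    · rintro ⟨rfl | h1, h2⟩
      · exact Or.inl rfl
      · exact Or.inr ⟨h1, h2⟩
    · rintro (rfl | h1)
      · exact ⟨Or.inl rfl, h⟩
      · exact ⟨Or.inr h1.1, h1.2⟩
  rw [below, this, Set.sUnion_insert, below]

theorem below_insert_of_not_ssubset [DecidableEq (Set α)] (S : Finset (Set α)) {G B : Set α}
    (h : ¬ G ⊂ B) : below (insert G S) B = below S B := by
  have : {H | H ∈ insert G S ∧ H ⊂ B} = {H | H ∈ S ∧ H ⊂ B} := by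
    ext H
    simp only [Finset.mem_insert, Set.mem_ofPred_eq]
    constructor
    · rintro ⟨rfl | h1, h2⟩
      · exact absurd h2 h
      · exact ⟨h1, h2⟩
    · exact fun h1 => ⟨Or.inr h1.1, h1.2⟩
  rw [below, this, below]

/-- The constant coefficient of the equation of the blow-up of `G` annihilates the ideal of its
center. -/
theorem IsBuildingSet.upSum_sub_pow_mul_mem (h : M.IsBuildingSet 𝒢) [DecidableEq (Set α)]
    {U : Finset 𝒢} (hU : ∀ G ∈ U, ∀ H, G ≤ H → H ∈ U) (S : Finset (Set α)) {G : 𝒢} (hGU : G ∉ U)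
    (hG : ∀ H, G < H → H ∈ U) {j : MvPolynomial 𝒢 ℤ}
    (hj : j ∈ relIdeal M U (insert (G : Set α) S)) :
    (upSum G - X G) ^ (M.natRk (G : Set α) - M.natRk (below S G)) * j ∈ relIdeal M U S := by
  classical
  suffices relIdeal M U (insert (G : Set α) S) ≤ Submodule.comap
      (LinearMap.mulLeft (MvPolynomial 𝒢 ℤ)
        ((upSum G - X G) ^ (M.natRk (G : Set α) - M.natRk (below S G)))) (relIdeal M U S)
      from this hj
  refine Submodule.span_le.2 ?_
  rintro _ (⟨H, hH, rfl⟩ | ⟨B, hB, T, hT, hTB, rfl⟩)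
  · exact Ideal.mul_mem_left _ _ (X_mem_relIdeal S hH)
  · change (upSum G - X G) ^ (M.natRk (G : Set α) - M.natRk (below S G)) *
      relator M (insert (G : Set α) S) T B ∈ relIdeal M U S
    -- If G is not below B, adding G to S does not change the relation at B.
    by_cases hGB : G < B
    swap
    · refine Ideal.mul_mem_left _ _ ?_
      rw [relator, below_insert_of_not_ssubset S hGB]
      exact prod_mul_upSum_pow_mem_relIdeal hB hT hTB (by omega)
    rw [relator, below_insert_of_ssubset S hGB]
    set e := M.natRk (B : Set α) - M.natRk (unionOf T ∪ (G ∪ below S B)) with he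
    set d := M.natRk (G : Set α) - M.natRk (below S G) with hd
    have hTsub : unionOf T ⊆ B := unionOf_subset fun A hA => (hTB A hA).le
    have hGsub : (G : Set α) ⊆ B := hGB.le
    have h1 : upSum G - X G = upSum B + ∑ H : 𝒢 with G < H ∧ ¬ B ≤ H, X H := by
      have h2 : ({L : 𝒢 | G ≤ L} : Finset 𝒢) = insert G
          (({L : 𝒢 | B ≤ L} : Finset 𝒢) ∪ ({H : 𝒢 | G < H ∧ ¬ B ≤ H} : Finset 𝒢)) := by
        ext L
        simp only [Finset.mem_filter, Finset.mem_univ, true_and, Finset.mem_insert,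
          Finset.mem_union]
        constructor
        · intro hL
          rcases hL.eq_or_lt with rfl | hL
          · exact Or.inl rfl
          · by_cases hBL : B ≤ L
            · exact Or.inr (Or.inl hBL)
            · exact Or.inr (Or.inr ⟨hL, hBL⟩)
        · rintro (rfl | hL | hL)
          · exact le_rfl
          · exact hGB.le.trans hL
          · exact hL.1.le
      rw [upSum, h2, Finset.sum_insert, Finset.sum_union, upSum]
      · ring
      · rw [Finset.disjoint_left]
        intro L hL hL'
        simp only [Finset.mem_filter, Finset.mem_univ, true_and] at hL hL'
        exact hL'.2 hL
      · simp only [Finset.mem_filter, Finset.mem_univ, true_and, Finset.mem_union, lt_irrefl,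
          false_and, or_false]
        exact hGB.not_ge
    -- The terms x_H with G < H and B not below H kill the relation, so multiplying by `upSum G - X
    -- G` is the same as multiplying by `upSum B`.
    have h3 : ((∏ A ∈ T, X A) * upSum B ^ e) * (upSum G - X G) -
        ((∏ A ∈ T, X A) * upSum B ^ e) * upSum B ∈ relIdeal M U S := by
      rw [h1, mul_add, add_sub_cancel_left, Finset.mul_sum]
      refine Ideal.sum_mem _ fun H hH => ?_
      simp only [Finset.mem_filter, Finset.mem_univ, true_and] at hH
      rw [mul_right_comm]
      have hGH : (G : Set α) ⊆ H := hH.1.le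
      refine h.prod_mul_X_mul_upSum_pow_mem hU S hB (hG H hH.1) hH.2
        ((h.nonempty G.2).mono (Set.subset_inter hGsub hGH)) hT hTB
        (Z := unionOf T ∪ (G ∪ below S B)) ?_ ?_ ?_
      · exact Set.union_subset hTsub (Set.union_subset hGsub (below_subset _ _))
      · intro x hx
        rcases hx with hx | hx | hx
        · exact Or.inl (Or.inr hx)
        · exact Or.inl (Or.inl (hGH hx))
        · exact Or.inr hx
      · omega
    have h4 := mul_pow_sub_mul_pow_mem h3 d
    -- By submodularity, leaving G out of the union lowers the rank by at most d = rk G - rk (⋃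
    -- S_{<G}), which the d extra factors make up for.
    have h5 : (∏ A ∈ T, X A) * upSum B ^ (e + d) ∈ relIdeal M U S := by
      refine prod_mul_upSum_pow_mem_relIdeal hB hT hTB ?_
      have hsm := M.natRk_submod (unionOf T ∪ below S B) G
      have h6 : M.natRk (below S G) ≤ M.natRk ((unionOf T ∪ below S B) ∩ G) := by
        refine M.natRk_mono (Set.subset_inter ?_ (below_subset _ _))
        refine Set.subset_union_of_subset_right ?_ _
        exact Set.sUnion_mono fun K hK => ⟨hK.1, hK.2.trans hGB⟩
      have h7 : unionOf T ∪ (G ∪ below S B) = unionOf T ∪ below S B ∪ G := by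
        rw [Set.union_assoc, Set.union_comm (G : Set α)]
      rw [h7] at he
      omega
    have h8 := Ideal.add_mem _ h4 h5
    convert h8 using 1
    ring

end Relations

/-! ### Independence of the normal monomials -/

section Independence

variable {α : Type*} {M : Matroid α} [M.Finite] [M.Loopless] {𝒢 : Set (Set α)} [Fintype 𝒢]

open MvPolynomial

/-- A finite family of members of `𝒢` as a family of sets. -/
def coeFinset (T : Finset 𝒢) : Finset (Set α) := T.map (Function.Embedding.subtype _)

theorem mem_coeFinset {T : Finset 𝒢} {A : 𝒢} : (A : Set α) ∈ coeFinset T ↔ A ∈ T := by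
  simp [coeFinset]

theorem coe_mem_of_mem_coeFinset {T : Finset 𝒢} {A : Set α} (h : A ∈ coeFinset T) :
    ∃ B ∈ T, (B : Set α) = A := by
  simpa [coeFinset] using h

open scoped Classical in
/-- The exponents of the normal monomials in the variables in `U`, relative to `S`. -/
def normalExponents (M : Matroid α) (U : Finset 𝒢) (S : Finset (Set α)) : Set (𝒢 →₀ ℕ) :=
  {m | m.support ⊆ U ∧ S ∪ coeFinset m.support ∈ M.nestedSets 𝒢 ∧
    ∀ G ∈ m.support,
      m G + M.natRk (below (S ∪ coeFinset m.support) (G : Set α)) < M.natRk (G : Set α)}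

open scoped Classical in
/-- The polynomial ring as polynomials in `x_G`. -/
noncomputable def isolate (G : 𝒢) :
    MvPolynomial 𝒢 ℤ →ₐ[ℤ] Polynomial (MvPolynomial 𝒢 ℤ) :=
  aeval fun H => if H = G then Polynomial.X else Polynomial.C (X H)

theorem isolate_X_self (G : 𝒢) : isolate G (X G) = Polynomial.X := by simp [isolate]

theorem isolate_X_of_ne {G H : 𝒢} (h : H ≠ G) : isolate G (X H) = Polynomial.C (X H) := by
  simp [isolate, h]

/-- Substituting x_G back loses nothing, so p is zero once all coefficients of `isolate G p` are.
The coefficients stay in the same polynomial ring, so the index type never changes in the induction.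
-/
theorem eval_isolate (G : 𝒢) (p : MvPolynomial 𝒢 ℤ) : (isolate G p).eval (X G) = p := by
  have : ((Polynomial.evalRingHom (X G : MvPolynomial 𝒢 ℤ)).comp (isolate G).toRingHom) =
      RingHom.id _ := by
    refine MvPolynomial.ringHom_ext (fun r => by simp) fun H => ?_
    by_cases h : H = G
    · subst h; simp [isolate_X_self]
    · simp [isolate_X_of_ne h]
  exact congrArg (fun f => f p) this

theorem isolate_monomial (G : 𝒢) (m : 𝒢 →₀ ℕ) (a : ℤ) :
    isolate G (monomial m a) =
      Polynomial.C (monomial (m.erase G) a) * Polynomial.X ^ (m G) := by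
  classical
  have h1 : ∀ n : 𝒢 →₀ ℕ, n G = 0 → isolate G (monomial n 1) = Polynomial.C (monomial n 1) := by
    intro n hn
    rw [monomial_eq, C_1, one_mul, Finsupp.prod, map_prod, map_prod]
    refine Finset.prod_congr rfl fun H hH => ?_
    rw [map_pow, map_pow, isolate_X_of_ne]
    rintro rfl
    exact Finsupp.mem_support_iff.1 hH hn
  have h2 : monomial m a = C a * monomial (m.erase G) 1 * X G ^ (m G) := by
    rw [C_mul_monomial, mul_one, X_pow_eq_monomial, monomial_mul, mul_one,
      Finsupp.erase_add_single]
  have h3 : isolate G (C a) = Polynomial.C (C a) := by simp [isolate]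
  rw [h2, map_mul, map_mul, h1 _ (by simp), map_pow, isolate_X_self, h3, ← map_mul,
    C_mul_monomial, mul_one]

theorem isolate_of_sum (G : 𝒢) (s : Finset 𝒢) (hs : G ∉ s) :
    isolate G (∑ H ∈ s, X H) = Polynomial.C (∑ H ∈ s, X H) := by
  rw [map_sum, map_sum]
  exact Finset.sum_congr rfl fun H hH => isolate_X_of_ne (by rintro rfl; exact hs hH)

theorem isolate_prod (G : 𝒢) (s : Finset 𝒢) (hs : G ∉ s) :
    isolate G (∏ H ∈ s, X H) = Polynomial.C (∏ H ∈ s, X H) := by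
  rw [map_prod, map_prod]
  exact Finset.prod_congr rfl fun H hH => isolate_X_of_ne (by rintro rfl; exact hs hH)

theorem isolate_upSum_of_not_le {G B : 𝒢} (h : ¬ B ≤ G) :
    isolate G (upSum B) = Polynomial.C (upSum B) :=
  isolate_of_sum G _ (by simpa using h)

theorem isolate_upSum_self (G : 𝒢) :
    isolate G (upSum G) = Polynomial.X + Polynomial.C (upSum G - X G) := by
  classical
  have h : (upSum G - X G : MvPolynomial 𝒢 ℤ) =
      ∑ H ∈ ({H : 𝒢 | G ≤ H} : Finset 𝒢).erase G, X H := by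
    rw [upSum, Finset.sum_erase_eq_sub (by simp)]
  rw [← isolate_X_self, h, ← isolate_of_sum G _ (Finset.notMem_erase _ _), ← map_add, ← h]
  congr 1
  ring

/-- A larger S has larger unions below each B, so the relations hold with smaller exponents. This is
I ≤ J in the blow-up presentation. -/
theorem relIdeal_le_relIdeal_insert [DecidableEq (Set α)] (U : Finset 𝒢) (S : Finset (Set α))
    (G : Set α) : relIdeal M U S ≤ relIdeal M U (insert G S) := by
  refine Ideal.span_le.2 ?_
  rintro _ (⟨H, hH, rfl⟩ | ⟨B, hB, T, hT, hTB, rfl⟩)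
  · exact X_mem_relIdeal _ hH
  · refine prod_mul_upSum_pow_mem_relIdeal hB hT hTB ?_
    have := M.natRk_mono (Set.union_subset_union_right (unionOf T)
      (below_mono (Finset.subset_insert G S) (B : Set α)))
    omega

/-- The relations sort by the role of G. At B = G, T is empty because nothing in U lies below G, and
the relation is the monic equation. If G ∈ T, it is X times a relation relative to S ∪ {G}.
Otherwise it does not involve x_G. -/
theorem isolate_mem_of_mem_relIdeal [DecidableEq 𝒢] [DecidableEq (Set α)] {U : Finset 𝒢}
    (hU : ∀ G ∈ U, ∀ H, G ≤ H → H ∈ U) (S : Finset (Set α)) {G : 𝒢} (hGU : G ∉ U)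
    {p : MvPolynomial 𝒢 ℤ} (hp : p ∈ relIdeal M (insert G U) S) :
    isolate G p ∈ (relIdeal M U S).map Polynomial.C ⊔
      Ideal.span {Polynomial.X} * (relIdeal M U (insert (G : Set α) S)).map Polynomial.C ⊔
        Ideal.span {(Polynomial.X + Polynomial.C (upSum G - X G)) ^
          (M.natRk (G : Set α) - M.natRk (below S G))} := by
  set K := (relIdeal M U S).map Polynomial.C ⊔
      Ideal.span {Polynomial.X} * (relIdeal M U (insert (G : Set α) S)).map Polynomial.C ⊔
        Ideal.span {(Polynomial.X + Polynomial.C (upSum G - X G)) ^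
          (M.natRk (G : Set α) - M.natRk (below S G))} with hK
  have hI : ∀ q ∈ relIdeal M U S, Polynomial.C q ∈ K := fun q hq =>
    (le_sup_left.trans le_sup_left : _ ≤ K) (Ideal.mem_map_of_mem _ hq)
  have hJ : ∀ q ∈ relIdeal M U (insert (G : Set α) S), Polynomial.X * Polynomial.C q ∈ K :=
    fun q hq => (le_sup_right.trans le_sup_left : _ ≤ K)
      (Ideal.mul_mem_mul (Ideal.mem_span_singleton_self _) (Ideal.mem_map_of_mem _ hq))
  suffices relIdeal M (insert G U) S ≤ K.comap (isolate G).toRingHom from this hp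
  refine Ideal.span_le.2 ?_
  rintro _ (⟨H, hH, rfl⟩ | ⟨B, hB, T, hT, hTB, rfl⟩)
  · change isolate G (X H) ∈ K
    rw [Finset.mem_insert, not_or] at hH
    rw [isolate_X_of_ne hH.1]
    exact hI _ (X_mem_relIdeal _ hH.2)
  · change isolate G (relator M S T B) ∈ K
    rcases Finset.mem_insert.1 hB with rfl | hBU
    · have hT0 : T = ∅ := by
        rw [Finset.eq_empty_iff_forall_notMem]
        intro A hA
        rcases Finset.mem_insert.1 (hT hA) with rfl | hAU
        · exact lt_irrefl _ (hTB _ hA)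
        · exact hGU (hU A hAU _ (hTB A hA).le)
      subst hT0
      rw [relator, Finset.prod_empty, one_mul, map_pow, isolate_upSum_self]
      simp only [unionOf, Finset.notMem_empty, Set.iUnion_of_empty, Set.iUnion_empty,
        Set.empty_union]
      exact (le_sup_right : _ ≤ K) (Ideal.mem_span_singleton_self _)
    · have hBG : ¬ B ≤ G := fun h => hGU (hU B hBU G h)
      by_cases hGT : G ∈ T
      · have h1 : relator M S T B = X G * relator M (insert (G : Set α) S) (T.erase G) B := by
          have h2 : unionOf T ∪ below S B =
              unionOf (T.erase G) ∪ below (insert (G : Set α) S) B := by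
            rw [below_insert_of_ssubset S (hTB G hGT), ← Finset.insert_erase hGT, unionOf_insert,
              Finset.erase_insert (Finset.notMem_erase _ _)]
            rw [← Set.union_assoc, Set.union_comm (G : Set α)]
          rw [relator, relator, h2, ← mul_assoc, Finset.mul_prod_erase T _ hGT]
        have h2 : isolate G (relator M (insert (G : Set α) S) (T.erase G) B) =
            Polynomial.C (relator M (insert (G : Set α) S) (T.erase G) B) := by
          rw [relator, map_mul, map_pow, isolate_upSum_of_not_le hBG,
            isolate_prod G _ (Finset.notMem_erase _ _), ← map_pow, ← map_mul]
        rw [h1, map_mul, isolate_X_self, h2]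
        refine hJ _ (Ideal.subset_span (Or.inr ⟨B, hBU, T.erase G, ?_, ?_, rfl⟩))
        · exact fun A hA => (Finset.mem_insert.1 (hT (Finset.mem_of_mem_erase hA))).resolve_left
            (Finset.ne_of_mem_erase hA)
        · exact fun A hA => hTB A (Finset.mem_of_mem_erase hA)
      · have h2 : isolate G (relator M S T B) = Polynomial.C (relator M S T B) := by
          rw [relator, map_mul, map_pow, isolate_upSum_of_not_le hBG,
            isolate_prod G _ hGT, ← map_pow, ← map_mul]
        rw [h2]
        refine hI _ (Ideal.subset_span (Or.inr ⟨B, hBU, T, ?_, hTB, rfl⟩))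
        exact (Finset.subset_insert_iff_of_notMem hGT).1 hT

theorem coeff_isolate_support (G : 𝒢) (p : MvPolynomial 𝒢 ℤ) (i : ℕ) {n : 𝒢 →₀ ℕ}
    (hn : n ∈ ((isolate G p).coeff i).support) :
    ∃ m ∈ p.support, m G = i ∧ n = m.erase G := by
  classical
  rw [p.as_sum, map_sum, Polynomial.finsetSum_coeff] at hn
  obtain ⟨m, hm, hn⟩ := Finset.mem_biUnion.1 (MvPolynomial.support_sum hn)
  rw [isolate_monomial, Polynomial.coeff_C_mul_X_pow] at hn
  split_ifs at hn with h
  · exact ⟨m, hm, h.symm, Finset.mem_singleton.1 (support_monomial_subset hn)⟩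
  · simp at hn

/-- The normal monomials are linearly independent modulo the relations. -/
theorem IsBuildingSet.eq_zero_of_mem_relIdeal (h : M.IsBuildingSet 𝒢) :
    ∀ (U : Finset 𝒢), (∀ G ∈ U, ∀ H, G ≤ H → H ∈ U) → ∀ (S : Finset (Set α))
      (p : MvPolynomial 𝒢 ℤ), p ∈ relIdeal M U S → (∀ m ∈ p.support, m ∈ normalExponents M U S) →
      p = 0 := by
  classical
  intro U
  induction U using Finset.strongInduction with
  | H U ih =>
  intro hU S p hp hsupp
  by_contra hp0
  rcases U.eq_empty_or_nonempty with rfl | hne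
  -- With no variables allowed, the ideal contains no nonzero constant and the only normal monomial
  -- is 1.
  · have h1 : relIdeal M (∅ : Finset 𝒢) S ≤ RingHom.ker (constantCoeff (R := ℤ) (σ := 𝒢)) := by
      refine Ideal.span_le.2 ?_
      rintro _ (⟨H, hH, rfl⟩ | ⟨B, hB, -⟩)
      · simp
      · simp at hB
    have h2 : constantCoeff p = 0 := h1 hp
    obtain ⟨m, hm⟩ := MvPolynomial.support_nonempty.2 hp0
    have h3 := (hsupp m hm).1
    rw [Finset.subset_empty, Finsupp.support_eq_empty] at h3
    subst h3
    exact mem_support_iff.1 hm h2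
  -- Removing a minimal G leaves an upward closed set that contains everything strictly above G.
  · obtain ⟨G, hG⟩ := U.exists_minimal hne
    have hGU := hG.1
    set U₀ := U.erase G with hU₀
    have hins : insert G U₀ = U := Finset.insert_erase hGU
    have hlt : U₀ ⊂ U := Finset.erase_ssubset hGU
    have hG0 : G ∉ U₀ := Finset.notMem_erase _ _
    have hup : ∀ A ∈ U₀, ∀ H, A ≤ H → H ∈ U₀ := by
      intro A hA H hAH
      rw [hU₀, Finset.mem_erase] at hA ⊢
      refine ⟨?_, hU A hA.2 H hAH⟩
      rintro rfl
      exact hA.1 (le_antisymm hAH (hG.2 hA.2 hAH))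
    have habove : ∀ H, G < H → H ∈ U₀ := fun H hH =>
      Finset.mem_erase.2 ⟨hH.ne', hU G hGU H hH.le⟩
    -- Nestedness of S is not assumed; a normal monomial occurring in the nonzero p provides it.
    have hS : S ∈ M.nestedSets 𝒢 := by
      obtain ⟨m, hm⟩ := MvPolynomial.support_nonempty.2 hp0
      exact nestedSets_subset (hsupp m hm).2.1 Finset.subset_union_left
    set d := M.natRk (G : Set α) - M.natRk (below S G) with hd
    have hd0 : 0 < d := Nat.sub_pos_of_lt (h.natRk_below_lt hS G.2)
    set P : Polynomial (MvPolynomial 𝒢 ℤ) :=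
      (Polynomial.X + Polynomial.C (upSum G - X G)) ^ d with hP
    have hPm : P.Monic := (Polynomial.monic_X_add_C _).pow d
    have hPd : P.degree = d := by
      rw [hP, Polynomial.degree_pow, Polynomial.degree_X_add_C, nsmul_one]
    have hmd : ∀ m ∈ p.support, m G < d := by
      intro m hm
      by_cases h0 : G ∈ m.support
      · have h1 := (hsupp m hm).2.2 G h0
        have h2 := M.natRk_mono (below_mono (S := S) (T := S ∪ coeFinset m.support)
          Finset.subset_union_left (G : Set α))
        omega
      · rw [Finsupp.notMem_support_iff.1 h0]; exact hd0
    have hdeg : (isolate G p).degree < P.degree := by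
      rw [hPd, p.as_sum, map_sum]
      refine (Polynomial.degree_lt_iff_coeff_zero _ _).2 fun k hk => ?_
      rw [Polynomial.finsetSum_coeff]
      refine Finset.sum_eq_zero fun m hm => ?_
      rw [isolate_monomial, Polynomial.coeff_C_mul_X_pow, if_neg]
      have := hmd m hm
      have : d ≤ k := by exact_mod_cast hk
      omega
    rw [← hins] at hp
    obtain ⟨hc0, hcJ⟩ := coeff_mem_of_mem_blowup (relIdeal_le_relIdeal_insert U₀ S (G : Set α)) hPm
      (fun j hj => by
        have := h.upSum_sub_pow_mul_mem hup S hG0 habove hj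
        rwa [hP, Polynomial.coeff_zero_eq_eval_zero, Polynomial.eval_pow, Polynomial.eval_add,
          Polynomial.eval_X, Polynomial.eval_C, zero_add]) hdeg
      (isolate_mem_of_mem_relIdeal hup S hG0 hp)
    have hz : ∀ i, (isolate G p).coeff i = 0 := by
      intro i
      rcases Nat.eq_zero_or_pos i with rfl | hi
      · refine ih U₀ hlt hup S _ hc0 fun n hn => ?_
        obtain ⟨m, hm, hmG, rfl⟩ := coeff_isolate_support G p 0 hn
        have hm0 : m.erase G = m := Finsupp.erase_of_notMem_support (by simpa using hmG)
        rw [hm0]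
        refine ⟨fun A hA => Finset.mem_erase.2 ⟨?_, (hsupp m hm).1 hA⟩, (hsupp m hm).2⟩
        rintro rfl
        exact Finsupp.mem_support_iff.1 hA hmG
      -- For i > 0, G moves from the support of the monomial into S. Their union, which governs
      -- normality, is unchanged.
      · refine ih U₀ hlt hup (insert (G : Set α) S) _ (hcJ i) fun n hn => ?_
        obtain ⟨m, hm, hmG, rfl⟩ := coeff_isolate_support G p i hn
        have hGm : G ∈ m.support := Finsupp.mem_support_iff.2 (by omega)
        have hun : insert (G : Set α) S ∪ coeFinset (m.erase G).support =
            S ∪ coeFinset m.support := by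
          rw [Finsupp.support_erase, ← Finset.insert_erase hGm]
          rw [Finset.erase_insert (Finset.notMem_erase _ _), coeFinset, coeFinset, Finset.map_insert,
            Finset.insert_union, Finset.union_insert]
          rfl
        refine ⟨?_, ?_, ?_⟩
        · rw [Finsupp.support_erase]
          exact Finset.erase_subset_erase _ (hsupp m hm).1
        · rw [hun]; exact (hsupp m hm).2.1
        · intro A hA
          rw [hun]
          rw [Finsupp.support_erase, Finset.mem_erase] at hA
          rw [Finsupp.erase_ne hA.1]
          exact (hsupp m hm).2.2 A hA.2
    have : isolate G p = 0 := Polynomial.ext hz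
    have h5 := eval_isolate G p
    rw [this, Polynomial.eval_zero] at h5
    exact hp0 h5.symm

end Independence

/-! ### The defining ideal and the relations -/

section Presentation

variable {α : Type*} {M : Matroid α} [M.Finite] [M.Loopless] {𝒢 : Set (Set α)} [Fintype 𝒢]

open MvPolynomial

theorem IsBuildingSet.natRk_closure_singleton (e : α) (he : e ∈ M.E) :
    M.natRk (M.closure {e}) = 1 := by
  rw [natRk_closure, natRk, eRk_singleton_eq he]; rfl

theorem closure_singleton_subset_of_inter {e : α} {F : Set α} (hF : M.IsFlat F)
    (hne : (F ∩ M.closure {e}).Nonempty) : M.closure {e} ⊆ F := by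
  obtain ⟨y, hyF, hy⟩ := hne
  have hyE : y ∈ M.E := hF.subset_ground hyF
  rw [← (isNonloop_of_loopless (M := M) hyE).closure_eq_of_mem_closure hy]
  exact hF.closure_subset (Set.singleton_subset_iff.2 hyF)

theorem isFlatAtom_closure_singleton {e : α} (he : e ∈ M.E) : M.IsFlatAtom (M.closure {e}) := by
  refine ⟨⟨isFlat_closure _, ?_⟩, ?_⟩
  · rw [closure_empty_of_loopless, Set.empty_ssubset]
    exact ⟨e, M.mem_closure_self e⟩
  · rintro F ⟨hF, hne⟩ hle
    rw [closure_empty_of_loopless, Set.empty_ssubset] at hne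
    exact closure_singleton_subset_of_inter hF (hne.mono fun x hx => ⟨hx, hle hx⟩)

theorem IsFlatAtom.exists_eq_closure_singleton {A : Set α} (hA : M.IsFlatAtom A) :
    ∃ e ∈ M.E, A = M.closure {e} := by
  have hne := hA.1.2
  rw [closure_empty_of_loopless, Set.empty_ssubset] at hne
  obtain ⟨e, he⟩ := hne
  have heE := hA.1.1.subset_ground he
  refine ⟨e, heE, subset_antisymm ?_ (hA.1.1.closure_subset (Set.singleton_subset_iff.2 he))⟩
  exact hA.2 (isFlatAtom_closure_singleton heE).1
    (hA.1.1.closure_subset (Set.singleton_subset_iff.2 he))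

/-- The factors cover the atom, and a factor that meets the atom equals it. So every linear
generator is an `upSum`. -/
theorem IsBuildingSet.closure_singleton_mem (h : M.IsBuildingSet 𝒢) {e : α} (he : e ∈ M.E) :
    M.closure {e} ∈ 𝒢 := by
  have heA : e ∈ M.closure {e} := M.mem_closure_self e
  obtain ⟨-, hU, -⟩ := h.buildingFactors_spec (isFlat_closure (M := M) {e}) ⟨e, heA⟩
  obtain ⟨G, hG, heG⟩ := hU heA
  have : M.closure {e} = G := subset_antisymm
    (closure_singleton_subset_of_inter (h.isFlat G hG.1.1) ⟨e, heG, heA⟩) hG.1.2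
  exact this ▸ hG.1.1

theorem finsum_X_eq_upSum (A : 𝒢) :
    (∑ᶠ (G : 𝒢) (_ : (A : Set α) ⊆ (G : Set α)), X G : MvPolynomial 𝒢 ℤ) = upSum A := by
  classical
  refine (finsum_mem_eq_finite_toFinset_sum (s := {G : 𝒢 | (A : Set α) ⊆ G}) _
    (Set.toFinite _)).trans ?_
  refine Finset.sum_congr ?_ fun _ _ => rfl
  ext G
  simp [← Subtype.coe_le_coe]

theorem coeFinset_eq_map (T : Finset 𝒢) :
    T.map (Function.Embedding.subtype _) = coeFinset T := rfl

theorem sUnion_coeFinset (T : Finset 𝒢) : ⋃₀ (coeFinset T : Set (Set α)) = unionOf T := by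
  ext x
  simp only [coeFinset, Finset.coe_map, Function.Embedding.subtype_apply, Set.sUnion_image,
    unionOf, Set.mem_iUnion, Finset.mem_coe]

theorem exists_coeFinset_eq {S : Finset (Set α)} (h : (S : Set (Set α)) ⊆ 𝒢) :
    ∃ T : Finset 𝒢, coeFinset T = S := by
  classical
  refine ⟨Finset.univ.filter fun G : 𝒢 => (G : Set α) ∈ S, ?_⟩
  ext A
  constructor
  · intro hA
    obtain ⟨B, hB, rfl⟩ := coe_mem_of_mem_coeFinset hA
    simpa using hB
  · intro hA
    exact (mem_coeFinset (A := ⟨A, h hA⟩)).2 (by simpa using hA)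

theorem prod_mem_fyIdeal {T : Finset 𝒢} (hT : coeFinset T ∉ M.nestedSets 𝒢) :
    (∏ G ∈ T, X G) ∈ M.fyIdeal 𝒢 := Ideal.subset_span (Or.inl ⟨T, hT, rfl⟩)

theorem IsBuildingSet.upSum_mem_fyIdeal {A : 𝒢} (hA : M.IsFlatAtom (A : Set α)) :
    upSum A ∈ M.fyIdeal 𝒢 :=
  Ideal.subset_span (Or.inr ⟨A, hA, (finsum_X_eq_upSum A).symm⟩)

/-- A family that is not nested contains an antichain with join in 𝒢; its product is the relation at
that join with exponent 0. The linear form of an atom is the relation with T empty and exponent 1.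
-/
theorem IsBuildingSet.fyIdeal_le_relIdeal (h : M.IsBuildingSet 𝒢) :
    M.fyIdeal 𝒢 ≤ relIdeal M (Finset.univ : Finset 𝒢) ∅ := by
  classical
  refine Ideal.span_le.2 ?_
  rintro _ (⟨T, hT, rfl⟩ | ⟨A, hA, rfl⟩)
  · rw [coeFinset_eq_map] at hT
    have hsub : (coeFinset T : Set (Set α)) ⊆ 𝒢 := by
      intro A hA
      obtain ⟨B, -, rfl⟩ := coe_mem_of_mem_coeFinset hA
      exact B.2
    have : ∃ T' ⊆ coeFinset T, IsAntichain (· ⊆ ·) (T' : Set (Set α)) ∧ 2 ≤ T'.card ∧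
        M.closure (⋃₀ (T' : Set (Set α))) ∈ 𝒢 := by
      by_contra! hc
      exact hT ⟨hsub, hc⟩
    obtain ⟨T', hT', hanti, hcard, hmem⟩ := this
    obtain ⟨T'', rfl⟩ := exists_coeFinset_eq ((Finset.coe_subset.2 hT').trans hsub)
    have hE : unionOf T'' ⊆ M.E := unionOf_subset fun A _ => (h.isFlat A A.2).subset_ground
    have hsubT : T'' ⊆ T := fun A hA => mem_coeFinset.1 (hT' (mem_coeFinset.2 hA))
    rw [sUnion_coeFinset] at hmem
    have h1 := prod_mul_upSum_pow_mem_relIdeal (M := M) (U := Finset.univ) (S := ∅)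
      (Finset.mem_univ (⟨_, hmem⟩ : 𝒢)) (Finset.subset_univ T'') (by
        intro A hA
        have hle : A ≤ (⟨_, hmem⟩ : 𝒢) := (subset_unionOf hA).trans (M.subset_closure _ hE)
        refine lt_of_le_of_ne hle fun h0 => ?_
        -- If A were the join, it would contain another member of the antichain.
        obtain ⟨B, hB, hBA⟩ := Finset.exists_mem_ne (Nat.lt_of_succ_le hcard) (A : Set α)
        obtain ⟨B, hB', rfl⟩ := coe_mem_of_mem_coeFinset hB
        refine hanti hB (mem_coeFinset.2 hA) hBA ?_
        change B ≤ A
        rw [h0]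
        exact (subset_unionOf hB').trans (M.subset_closure _ hE)) (n := 0) (by
        rw [natRk_closure, zero_add]
        exact M.natRk_mono Set.subset_union_left)
    rw [pow_zero, mul_one] at h1
    exact Ideal.mem_of_dvd _ (Finset.prod_dvd_prod_of_subset _ _ _ hsubT) h1
  · obtain ⟨e, he, rfl⟩ := hA.exists_eq_closure_singleton
    have h1 := prod_mul_upSum_pow_mem_relIdeal (M := M) (U := Finset.univ) (S := ∅)
      (Finset.mem_univ (⟨_, h.closure_singleton_mem he⟩ : 𝒢)) (Finset.empty_subset _) (by simp)
      (n := 1) (by rw [natRk_closure_singleton e he]; omega)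
    rw [Finset.prod_empty, one_mul, pow_one] at h1
    change (∑ᶠ (G : 𝒢) (_ : M.closure {e} ⊆ (G : Set α)), X G : MvPolynomial 𝒢 ℤ) ∈ _
    rw [finsum_X_eq_upSum ⟨_, h.closure_singleton_mem he⟩]
    exact h1

theorem IsBuildingSet.X_mul_X_mem_fyIdeal (h : M.IsBuildingSet 𝒢) {G H : 𝒢}
    (hGH : ¬ G ≤ H) (hHG : ¬ H ≤ G) (hne : ((G : Set α) ∩ H).Nonempty) :
    (X G * X H : MvPolynomial 𝒢 ℤ) ∈ M.fyIdeal 𝒢 := by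
  classical
  have hne' : G ≠ H := fun h0 => hGH h0.le
  have : coeFinset ({G, H} : Finset 𝒢) ∉ M.nestedSets 𝒢 := fun hn =>
    Set.not_disjoint_iff_nonempty_inter.2 hne (h.disjoint_of_nested hn
      (mem_coeFinset.2 (by simp)) (mem_coeFinset.2 (by simp)) hGH hHG)
  simpa [Finset.prod_pair hne'] using prod_mem_fyIdeal this

/-- In a nested T the members below B have a union of rank less than rk B. -/
theorem IsBuildingSet.not_nested_of_natRk_le (h : M.IsBuildingSet 𝒢) {T : Finset 𝒢} {B : 𝒢}
    (hTB : ∀ A ∈ T, A < B) (hrk : M.natRk (B : Set α) ≤ M.natRk (unionOf T)) :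
    coeFinset T ∉ M.nestedSets 𝒢 := by
  intro hn
  have h1 := h.natRk_below_lt hn B.2
  have h2 : unionOf T ⊆ below (coeFinset T) (B : Set α) :=
    unionOf_subset fun A hA => subset_below (mem_coeFinset.2 hA) (hTB A hA)
  have := M.natRk_mono h2
  omega

/-- Induction on the exponent. For an atom A in B outside the span of T, the linear relation at A
trades one factor `upSum B` for the negated sum of the x_H with A ≤ H and B not below H. Each x_H
moves the other factors to the join of B and H, and enlarges T to T ∪ {H}. -/
theorem IsBuildingSet.prod_mul_upSum_pow_mem_fyIdeal (h : M.IsBuildingSet 𝒢) :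
    ∀ (n : ℕ) (T : Finset 𝒢) (B : 𝒢), (∀ A ∈ T, A < B) →
      M.natRk (B : Set α) ≤ n + M.natRk (unionOf T) →
      (∏ A ∈ T, X A) * upSum B ^ n ∈ M.fyIdeal 𝒢 := by
  classical
  intro n
  induction n with
  | zero =>
    intro T B hTB hrk
    rw [pow_zero, mul_one]
    exact prod_mem_fyIdeal (h.not_nested_of_natRk_le hTB (by omega))
  | succ n ih =>
    intro T B hTB hrk
    by_cases hlt : M.natRk (B : Set α) ≤ M.natRk (unionOf T)
    · exact Ideal.mul_mem_right _ _ (prod_mem_fyIdeal (h.not_nested_of_natRk_le hTB hlt))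
    have hBE := (h.isFlat B B.2).subset_ground
    have hTsub : unionOf T ⊆ (B : Set α) := unionOf_subset fun A hA => (hTB A hA).le
    obtain ⟨e, heB, heT⟩ : ∃ e ∈ (B : Set α), e ∉ M.closure (unionOf T) := by
      by_contra! hc
      exact hlt (natRk_eq_of_subset_closure M hTsub hc).le
    have heE := hBE heB
    let A : 𝒢 := ⟨_, h.closure_singleton_mem heE⟩
    have hAB : A ≤ B := (h.isFlat B B.2).closure_subset (Set.singleton_subset_iff.2 heB)
    have heA : e ∈ (A : Set α) := M.mem_closure_self e
    have h1 : upSum A ∈ M.fyIdeal 𝒢 :=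
      IsBuildingSet.upSum_mem_fyIdeal (isFlatAtom_closure_singleton heE)
    have h2 : (upSum B : MvPolynomial 𝒢 ℤ) = upSum A - ∑ H : 𝒢 with A ≤ H ∧ ¬ B ≤ H, X H := by
      have h3 : ({L : 𝒢 | A ≤ L} : Finset 𝒢) =
          ({L : 𝒢 | B ≤ L} : Finset 𝒢) ∪ ({H : 𝒢 | A ≤ H ∧ ¬ B ≤ H} : Finset 𝒢) := by
        ext L
        simp only [Finset.mem_filter, Finset.mem_univ, true_and, Finset.mem_union]
        by_cases hBL : B ≤ L
        · simp [hBL, hAB.trans hBL]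
        · simp [hBL]
      rw [upSum, upSum, h3, Finset.sum_union, add_sub_cancel_right]
      rw [Finset.disjoint_left]
      intro L hL hL'
      simp only [Finset.mem_filter, Finset.mem_univ, true_and] at hL hL'
      exact hL'.2 hL
    rw [pow_succ', ← mul_assoc]
    nth_rewrite 1 [h2]
    rw [mul_sub, sub_mul]
    refine Ideal.sub_mem _ (Ideal.mul_mem_right _ _ (Ideal.mul_mem_left _ _ h1)) ?_
    rw [Finset.mul_sum, Finset.sum_mul]
    refine Ideal.sum_mem _ fun H hH => ?_
    simp only [Finset.mem_filter, Finset.mem_univ, true_and] at hH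
    obtain ⟨hAH, hBH⟩ := hH
    have hne : ((B : Set α) ∩ H).Nonempty := ⟨e, heB, hAH heA⟩
    obtain ⟨J, hBJ, hHJ, hrkJ, hJ⟩ := h.exists_join hne
    have h4 : X H * upSum B ^ n - X H * upSum J ^ n ∈ M.fyIdeal 𝒢 :=
      mul_pow_sub_mul_pow_mem (X_mul_upSum_sub_mem hBJ hJ hBH fun K hBK hKH hHK =>
        h.X_mul_X_mem_fyIdeal hHK hKH (hne.mono fun x hx => ⟨hx.2, hBK hx.1⟩)) n
    have h5 : (∏ A ∈ insert H T, X A) * upSum J ^ n ∈ M.fyIdeal 𝒢 := by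
      refine ih _ _ ?_ ?_
      · intro A hA
        rcases Finset.mem_insert.1 hA with rfl | hA
        · exact lt_of_le_of_ne hHJ fun h0 => hBH (hBJ.trans h0.ge)
        · exact (hTB A hA).trans_le hBJ
      · rw [unionOf_insert, hrkJ]
        have hsm := M.natRk_submod B (H ∪ unionOf T)
        -- The point e is outside the span of T, so it adds the one rank that pays for the factor
        -- traded away.
        have h6 : M.natRk (unionOf T) + 1 ≤ M.natRk ((B : Set α) ∩ (H ∪ unionOf T)) := by
          have h7 : insert e (unionOf T) ⊆ (B : Set α) ∩ (H ∪ unionOf T) := by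
            refine Set.insert_subset ⟨heB, Or.inl (hAH heA)⟩ ?_
            exact Set.subset_inter hTsub Set.subset_union_right
          refine le_trans ?_ (M.natRk_mono h7)
          by_contra hc
          refine heT (M.subset_closure_of_natRk_le (Set.subset_insert e (unionOf T)) ?_
            (by omega) (Set.mem_insert e _))
          exact Set.insert_subset heE (hTsub.trans hBE)
        have h8 : M.natRk ((B : Set α) ∪ H) ≤ M.natRk ((B : Set α) ∪ (H ∪ unionOf T)) :=
          M.natRk_mono (Set.union_subset_union_right _ Set.subset_union_left)
        omega
    obtain ⟨c, hc⟩ := prod_insert_dvd T H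
    have h6 : (∏ A ∈ T, X A) * X H * upSum J ^ n ∈ M.fyIdeal 𝒢 := by
      rw [hc, mul_right_comm]
      exact Ideal.mul_mem_right _ _ h5
    have h7 := Ideal.add_mem _ (Ideal.mul_mem_left _ (∏ A ∈ T, X A) h4) h6
    convert h7 using 1
    ring

/-! ### Normal monomials span -/

/-- A monomial is normal if its support is nested and each exponent is less than a rank drop. -/
theorem mem_normalExponents_univ {m : 𝒢 →₀ ℕ} :
    m ∈ normalExponents M (Finset.univ : Finset 𝒢) ∅ ↔
      coeFinset m.support ∈ M.nestedSets 𝒢 ∧ ∀ G ∈ m.support,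
        m G + M.natRk (below (coeFinset m.support) (G : Set α)) < M.natRk (G : Set α) := by
  classical
  simp [normalExponents]

/-- The weight of a monomial that decreases in the rewriting. -/
noncomputable def corankWeight (M : Matroid α) (𝒢 : Set (Set α)) : (𝒢 →₀ ℕ) →+ ℕ :=
  Finsupp.weight fun G : 𝒢 => M.natRk M.E - M.natRk (G : Set α)

theorem corankWeight_single (G : 𝒢) (n : ℕ) :
    corankWeight M 𝒢 (Finsupp.single G n) = n * (M.natRk M.E - M.natRk (G : Set α)) := by
  simp [corankWeight, Finsupp.weight_single]

theorem corankWeight_le_mul {p q : MvPolynomial 𝒢 ℤ} {a b : ℕ}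
    (hp : ∀ m ∈ p.support, corankWeight M 𝒢 m ≤ a) (hq : ∀ m ∈ q.support, corankWeight M 𝒢 m ≤ b) :
    ∀ m ∈ (p * q).support, corankWeight M 𝒢 m ≤ a + b := by
  classical
  intro m hm
  obtain ⟨x, hx, y, hy, rfl⟩ := Finset.mem_add.1 (support_mul p q hm)
  rw [map_add]
  exact add_le_add (hp x hx) (hq y hy)

theorem corankWeight_lt_mul {p q : MvPolynomial 𝒢 ℤ} {a b : ℕ}
    (hp : ∀ m ∈ p.support, corankWeight M 𝒢 m ≤ a) (hq : ∀ m ∈ q.support, corankWeight M 𝒢 m < b) :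
    ∀ m ∈ (p * q).support, corankWeight M 𝒢 m < a + b := by
  classical
  intro m hm
  obtain ⟨x, hx, y, hy, rfl⟩ := Finset.mem_add.1 (support_mul p q hm)
  rw [map_add]
  exact add_lt_add_of_le_of_lt (hp x hx) (hq y hy)

theorem corankWeight_le_pow {p : MvPolynomial 𝒢 ℤ} {a : ℕ}
    (hp : ∀ m ∈ p.support, corankWeight M 𝒢 m ≤ a) (n : ℕ) :
    ∀ m ∈ (p ^ n).support, corankWeight M 𝒢 m ≤ n * a := by
  induction n with
  | zero =>
    intro m hm
    rw [pow_zero] at hm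
    have : m = 0 := by
      have h1 := support_monomial_subset (R := ℤ) (s := (0 : 𝒢 →₀ ℕ)) (a := 1) hm
      simpa using h1
    simp [this]
  | succ n ih =>
    rw [pow_succ, add_mul, one_mul]
    exact corankWeight_le_mul ih hp

theorem corankWeight_lt_sum {ι : Type*} {s : Finset ι} {p : ι → MvPolynomial 𝒢 ℤ} {b : ℕ}
    (hp : ∀ i ∈ s, ∀ m ∈ (p i).support, corankWeight M 𝒢 m < b) :
    ∀ m ∈ (∑ i ∈ s, p i).support, corankWeight M 𝒢 m < b := by
  classical
  intro m hm
  obtain ⟨i, hi, hm⟩ := Finset.mem_biUnion.1 (MvPolynomial.support_sum hm)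
  exact hp i hi m hm

theorem corankWeight_X {G : 𝒢} : ∀ m ∈ (X G : MvPolynomial 𝒢 ℤ).support,
    corankWeight M 𝒢 m = M.natRk M.E - M.natRk (G : Set α) := by
  intro m hm
  rw [support_X, Finset.mem_singleton] at hm
  rw [hm, corankWeight_single, one_mul]

/-- Induction on the total corank. A nested monomial that is not normal has too large an exponent at
some B. Replacing the power of x_B by that power of the sum above B gives an element of the ideal,
and the correction involves members strictly above B, which have smaller corank. -/
theorem IsBuildingSet.monomial_mem_sup (h : M.IsBuildingSet 𝒢) :
    ∀ (w : ℕ) (m : 𝒢 →₀ ℕ), corankWeight M 𝒢 m = w → ∀ a : ℤ,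
      monomial m a ∈ restrictSupport ℤ (normalExponents M (Finset.univ : Finset 𝒢) ∅) ⊔
        (M.fyIdeal 𝒢).restrictScalars ℤ := by
  classical
  intro w
  induction w using Nat.strong_induction_on with
  | _ w ih =>
  intro m hw a
  set V := restrictSupport ℤ (normalExponents M (Finset.univ : Finset 𝒢) ∅) ⊔
        (M.fyIdeal 𝒢).restrictScalars ℤ with hV
  have hVI : ∀ p ∈ M.fyIdeal 𝒢, p ∈ V := fun p hp =>
    (le_sup_right : (M.fyIdeal 𝒢).restrictScalars ℤ ≤ V) hp
  have hVlt : ∀ p : MvPolynomial 𝒢 ℤ, (∀ n ∈ p.support, corankWeight M 𝒢 n < w) → p ∈ V := by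
    intro p hp
    rw [p.as_sum]
    exact Submodule.sum_mem _ fun n hn => ih _ (hp n hn) n rfl _
  have hdvd : ∀ T : Finset 𝒢, T ⊆ m.support →
      (∏ A ∈ T, X A : MvPolynomial 𝒢 ℤ) ∣ monomial m a := by
    intro T hT
    rw [monomial_eq]
    refine dvd_mul_of_dvd_right ((Finset.prod_dvd_prod_of_subset _ _ _ hT).trans ?_) _
    exact Finset.prod_dvd_prod_of_dvd _ _ fun A hA =>
      dvd_pow_self _ (Finsupp.mem_support_iff.1 hA)
  by_cases hm : m ∈ normalExponents M (Finset.univ : Finset 𝒢) ∅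
  · exact (le_sup_left : restrictSupport ℤ _ ≤ V) ((monomial_mem_restrictSupport ℤ).2 (Or.inl hm))
  by_cases hn : coeFinset m.support ∈ M.nestedSets 𝒢
  swap
  · exact hVI _ (Ideal.mem_of_dvd _ (hdvd _ subset_rfl) (prod_mem_fyIdeal hn))
  obtain ⟨B, hB, hrk⟩ : ∃ B ∈ m.support,
      M.natRk (B : Set α) ≤ m B + M.natRk (below (coeFinset m.support) (B : Set α)) := by
    by_contra! hc
    exact hm (mem_normalExponents_univ.2 ⟨hn, hc⟩)
  set T : Finset 𝒢 := m.support.filter (· < B) with hT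
  have hTB : ∀ A ∈ T, A < B := fun A hA => (Finset.mem_filter.1 hA).2
  have hbel : below (coeFinset m.support) (B : Set α) ⊆ unionOf T := by
    refine Set.sUnion_subset ?_
    rintro A ⟨hA, hAB⟩
    obtain ⟨A, hA', rfl⟩ := coe_mem_of_mem_coeFinset hA
    exact subset_unionOf (Finset.mem_filter.2 ⟨hA', hAB⟩)
  have h1 := h.prod_mul_upSum_pow_mem_fyIdeal (m B) T B hTB
    (hrk.trans (Nat.add_le_add_left (M.natRk_mono hbel) _))
  obtain ⟨c, hc⟩ : (∏ A ∈ T, X A : MvPolynomial 𝒢 ℤ) ∣ monomial (m.erase B) a := by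
    rw [monomial_eq]
    refine dvd_mul_of_dvd_right ((Finset.prod_dvd_prod_of_subset _ (m.erase B).support _ ?_).trans
      ?_) _
    · intro A hA
      rw [Finsupp.support_erase, Finset.mem_erase]
      exact ⟨(hTB A hA).ne, (Finset.mem_filter.1 hA).1⟩
    · exact Finset.prod_dvd_prod_of_dvd _ _ fun A hA =>
        dvd_pow_self _ (Finsupp.mem_support_iff.1 hA)
  have h2 : monomial (m.erase B) a * upSum B ^ (m B) ∈ M.fyIdeal 𝒢 := by
    rw [hc, mul_right_comm]
    exact Ideal.mul_mem_right _ _ h1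
  have h3 : monomial m a = monomial (m.erase B) a * X B ^ (m B) := by
    rw [X_pow_eq_monomial, monomial_mul, mul_one, Finsupp.erase_add_single]
  -- The difference of the two powers is written as a geometric sum times `upSum B - X B`; the last
  -- factor makes the weight drop strictly.
  have h4 : monomial m a = monomial (m.erase B) a * upSum B ^ (m B) - monomial (m.erase B) a *
      ((∑ i ∈ Finset.range (m B), upSum B ^ i * X B ^ (m B - 1 - i)) * (upSum B - X B)) := by
    rw [(Commute.all _ _).geom_sum₂_mul, h3]
    ring
  rw [h4]
  refine V.sub_mem (hVI _ h2) (hVlt _ ?_)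
  have hwB : w = corankWeight M 𝒢 (m.erase B) +
      m B * (M.natRk M.E - M.natRk (B : Set α)) := by
    rw [← hw, ← corankWeight_single, ← map_add, Finsupp.erase_add_single]
  have hmB : m B ≠ 0 := Finsupp.mem_support_iff.1 hB
  rw [hwB]
  have hrkE : ∀ H : 𝒢, M.natRk (H : Set α) ≤ M.natRk M.E := fun H =>
    M.natRk_mono (h.isFlat H H.2).subset_ground
  refine corankWeight_lt_mul (fun n hn => ?_) ?_
  · rw [Finset.mem_singleton.1 (support_monomial_subset hn)]
  rw [Finset.sum_mul]
  refine corankWeight_lt_sum fun i hi => ?_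
  have hi' : i + (m B - 1 - i) + 1 = m B := by
    have := Finset.mem_range.1 hi
    omega
  rw [← hi', add_mul _ 1, add_mul, one_mul]
  refine corankWeight_lt_mul (corankWeight_le_mul (corankWeight_le_pow ?_ _)
    (hi'.symm ▸ corankWeight_le_pow (fun n hn => (corankWeight_X n hn).le) _)) ?_
  · intro n hn
    refine Nat.lt_succ_iff.1 ?_
    refine corankWeight_lt_sum (fun H hH n hn => ?_) n hn
    rw [corankWeight_X n hn, Nat.lt_succ_iff]
    simp only [Finset.mem_filter, Finset.mem_univ, true_and] at hH
    exact Nat.sub_le_sub_left (M.natRk_mono hH) _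
  · have h5 : (upSum B - X B : MvPolynomial 𝒢 ℤ) =
        ∑ H ∈ ({H : 𝒢 | B ≤ H} : Finset 𝒢).erase B, X H := by
      rw [upSum, Finset.sum_erase_eq_sub (by simp)]
    rw [h5]
    refine corankWeight_lt_sum fun H hH n hn => ?_
    rw [corankWeight_X n hn]
    simp only [Finset.mem_erase, Finset.mem_filter, Finset.mem_univ, true_and] at hH
    have hlt : B < H := lt_of_le_of_ne hH.2 (Ne.symm hH.1)
    have := (h.isFlat B B.2).natRk_lt hlt (h.isFlat H H.2).subset_ground
    have := hrkE H
    omega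

theorem IsBuildingSet.sup_eq_top (h : M.IsBuildingSet 𝒢) :
    restrictSupport ℤ (normalExponents M (Finset.univ : Finset 𝒢) ∅) ⊔
        (M.fyIdeal 𝒢).restrictScalars ℤ = ⊤ := by
  refine eq_top_iff.2 fun p _ => ?_
  rw [p.as_sum]
  exact Submodule.sum_mem _ fun m _ => h.monomial_mem_sup _ m rfl _

theorem IsBuildingSet.eq_zero_of_mem_fyIdeal (h : M.IsBuildingSet 𝒢) {p : MvPolynomial 𝒢 ℤ}
    (hp : p ∈ restrictSupport ℤ (normalExponents M (Finset.univ : Finset 𝒢) ∅))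
    (hpI : p ∈ M.fyIdeal 𝒢) : p = 0 :=
  h.eq_zero_of_mem_relIdeal Finset.univ (fun _ _ _ _ => Finset.mem_univ _) ∅ p
    (h.fyIdeal_le_relIdeal hpI) hp

/-! ### Ranks of the graded pieces -/

theorem isHomogeneous_fyIdeal {p : MvPolynomial 𝒢 ℤ} (hp : p ∈ M.fyIdeal 𝒢) (i : ℕ) :
    weightedHomogeneousComponent (fun _ : 𝒢 => 2) i p ∈ M.fyIdeal 𝒢 := by
  classical
  let := weightedGradedAlgebra ℤ (fun _ : 𝒢 => 2)
  refine weightedHomogeneousComponent_mem_of_mem ℤ _ ?_ hp i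
  refine Ideal.homogeneous_span _ _ ?_
  rintro _ (⟨T, -, rfl⟩ | ⟨A, -, rfl⟩)
  · exact ⟨∑ _ ∈ T, 2, IsWeightedHomogeneous.prod T _ _ fun G _ => isWeightedHomogeneous_X ℤ _ G⟩
  · refine ⟨2, ?_⟩
    have hs : (∑ᶠ (G : 𝒢) (_ : A ⊆ (G : Set α)), X G : MvPolynomial 𝒢 ℤ) = _ :=
      finsum_mem_eq_finite_toFinset_sum (s := {G : 𝒢 | A ⊆ G})
        (fun G => (X G : MvPolynomial 𝒢 ℤ)) (Set.toFinite _)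
    rw [hs]
    exact IsWeightedHomogeneous.sum _ _ _ fun G _ => isWeightedHomogeneous_X ℤ _ G

/-- The rank of a graded piece is the number of normal monomials of that degree. -/
theorem IsBuildingSet.finrank_fyDegree (h : M.IsBuildingSet 𝒢) (i : ℕ) :
    Module.finrank ℤ (M.fyDegree 𝒢 i) =
      {m ∈ normalExponents M (Finset.univ : Finset 𝒢) ∅ |
        Finsupp.weight (fun _ : 𝒢 => 2) m = i}.ncard := by
  classical
  set N := normalExponents M (Finset.univ : Finset 𝒢) ∅ with hN
  set Ni : Set (𝒢 →₀ ℕ) := {m ∈ N | Finsupp.weight (fun _ : 𝒢 => 2) m = i} with hNi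
  let f : restrictSupport ℤ Ni →ₗ[ℤ] M.FYRing 𝒢 :=
    (Ideal.Quotient.mkₐ ℤ (M.fyIdeal 𝒢)).toLinearMap ∘ₗ (restrictSupport ℤ Ni).subtype
  have hf : Function.Injective f := by
    rw [injective_iff_map_eq_zero]
    rintro ⟨p, hp⟩ h0
    have h1 : p ∈ M.fyIdeal 𝒢 := Ideal.Quotient.eq_zero_iff_mem.1 h0
    exact Subtype.ext (h.eq_zero_of_mem_fyIdeal
      (restrictSupport_mono _ (fun m hm => hm.1) hp) h1)
  have hr : LinearMap.range f = M.fyDegree 𝒢 i := by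
    refine le_antisymm ?_ ?_
    · rintro _ ⟨⟨p, hp⟩, rfl⟩
      refine ⟨p, fun m hm => ?_, rfl⟩
      exact (hp (mem_support_iff.2 hm)).2
    · rintro _ ⟨p, hp, rfl⟩
      obtain ⟨n, hn, j, hj, hnj⟩ := Submodule.mem_sup.1
        (h.sup_eq_top ▸ Submodule.mem_top : p ∈ restrictSupport ℤ N ⊔ _)
      -- Normality is a condition on single monomials and the ideal is homogeneous, so the splitting
      -- into a normal part and a part in the ideal respects degrees.
      have h1 : weightedHomogeneousComponent (fun _ : 𝒢 => 2) i n ∈ restrictSupport ℤ Ni := by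
        intro m hm
        have hm' : m ∈ (weightedHomogeneousComponent (fun _ : 𝒢 => 2) i n).support := hm
        rw [support_weightedHomogeneousComponent, Finset.mem_filter] at hm'
        exact ⟨hn hm'.1, hm'.2⟩
      refine ⟨⟨_, h1⟩, ?_⟩
      have h2 : weightedHomogeneousComponent (fun _ : 𝒢 => 2) i p = p :=
        weightedHomogeneousComponent_eq_self hp
      rw [← hnj, map_add] at h2
      refine Ideal.Quotient.eq.2 ?_
      change weightedHomogeneousComponent (fun _ : 𝒢 => 2) i n - p ∈ _
      rw [← hnj, ← h2, sub_add_cancel_left]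
      exact neg_mem (isHomogeneous_fyIdeal hj i)
  rw [← hr, LinearMap.finrank_range_of_inj hf,
    Module.finrank_eq_nat_card_basis (basisRestrictSupport ℤ Ni)]
  rfl

end Presentation

section Initial

variable {α : Type*} {M : Matroid α} [M.Finite] [M.Loopless] {𝒢 : Set (Set α)}

/-! ### The rank function of the matroid of a nested set -/

theorem ncard_inter_sUnion_le (B : Set α) (T : Finset (Set α)) :
    (B ∩ ⋃₀ (T : Set (Set α))).ncard ≤ ∑ H ∈ T, (B ∩ H).ncard := by
  classical
  induction T using Finset.induction with
  | empty => simp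
  | insert H T hH ih =>
    rw [Finset.coe_insert, Set.sUnion_insert, Finset.sum_insert hH, Set.inter_union_distrib_left]
    exact (Set.ncard_union_le _ _).trans (Nat.add_le_add_left ih _)

theorem ncard_inter_biUnion {ι : Type*} (B : Set α) (hB : B.Finite) (s : Finset ι) (D : ι → Set α)
    (hD : (s : Set ι).PairwiseDisjoint D) :
    (B ∩ ⋃ i ∈ s, D i).ncard = ∑ i ∈ s, (B ∩ D i).ncard := by
  classical
  induction s using Finset.induction with
  | empty => simp
  | insert a s ha ih =>
    rw [Finset.set_biUnion_insert, Finset.sum_insert ha, Set.inter_union_distrib_left,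
      ← ih (hD.subset (by simp))]
    refine Set.ncard_union_eq ?_ (hB.subset Set.inter_subset_left) (hB.subset Set.inter_subset_left)
    refine Set.disjoint_left.2 fun x hx hx' => ?_
    obtain ⟨i, hi, hxi⟩ := Set.mem_iUnion₂.1 hx'.2
    have : a ≠ i := by rintro rfl; exact ha hi
    exact Set.disjoint_left.1 (hD (by simp) (by simp [hi]) this) hx.2 hxi

theorem IsBuildingSet.ground_subset_sUnion (h : M.IsBuildingSet 𝒢) :
    M.E ⊆ ⋃₀ buildingFactors 𝒢 M.E := by
  rcases M.E.eq_empty_or_nonempty with h0 | hne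
  · rw [h0]; exact Set.empty_subset _
  · exact (h.buildingFactors_spec M.ground_isFlat hne).2.1

theorem IsBuildingSet.sum_natRk_factors_ground_le (h : M.IsBuildingSet 𝒢) :
    ∑ G ∈ (h.finite_buildingFactors M.E).toFinset, M.natRk G ≤ M.natRk M.E := by
  rcases M.E.eq_empty_or_nonempty with h0 | hne
  · refine le_of_eq_of_le (Finset.sum_eq_zero fun G hG => ?_) (Nat.zero_le _)
    have : G ⊆ M.E := subset_of_mem_buildingFactors ((Set.Finite.mem_toFinset _).1 hG)
    rw [h0, Set.subset_empty_iff] at this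
    rw [this, natRk_empty]
  · have := (h.buildingFactors_spec M.ground_isFlat hne).2.2
    rwa [finsum_mem_eq_finite_toFinset_sum _ (h.finite_buildingFactors M.E)] at this

theorem IsBuildingSet.subset_or_subset_or_disjoint (h : M.IsBuildingSet 𝒢) {S : Finset (Set α)}
    (hS : S ∈ M.nestedSets 𝒢) {G H : Set α} (hG : G ∈ S) (hH : H ∈ S) :
    G = H ∨ G ⊂ H ∨ H ⊂ G ∨ Disjoint G H := by
  by_cases h1 : G ⊆ H
  · rcases h1.eq_or_ssubset with h2 | h2
    · exact Or.inl h2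
    · exact Or.inr (Or.inl h2)
  by_cases h2 : H ⊆ G
  · rcases h2.eq_or_ssubset with h3 | h3
    · exact Or.inl h3.symm
    · exact Or.inr (Or.inr (Or.inl h3))
  · exact Or.inr (Or.inr (Or.inr (h.disjoint_of_nested hS hG hH h1 h2)))

/-- The sets `G \ ⋃ S_{< G}` are disjoint. -/
theorem IsBuildingSet.pairwiseDisjoint_sdiff_below (h : M.IsBuildingSet 𝒢) {S : Finset (Set α)}
    (hS : S ∈ M.nestedSets 𝒢) :
    (S : Set (Set α)).PairwiseDisjoint fun G => G \ below S G := by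
  intro G hG H hH hne
  refine Set.disjoint_left.2 fun x hx hx' => ?_
  rcases h.subset_or_subset_or_disjoint hS hG hH with h1 | h1 | h1 | h1
  · exact hne h1
  · exact hx'.2 (subset_below hG h1 hx.1)
  · exact hx.2 (subset_below hH h1 hx'.1)
  · exact Set.disjoint_left.1 h1 hx.1 hx'.1

/-- A point lies in the stratum of a minimal member of S containing it; such a member exists because
S contains the factors of the ground set. -/
theorem IsBuildingSet.biUnion_sdiff_below (h : M.IsBuildingSet 𝒢) {S : Finset (Set α)}
    (hS : S ∈ M.fullNestedSets 𝒢) : ⋃ G ∈ S, G \ below S G = M.E := by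
  classical
  refine subset_antisymm (Set.iUnion₂_subset fun G hG =>
    Set.sdiff_subset.trans (h.isFlat G (hS.1.1 hG)).subset_ground) fun e he => ?_
  obtain ⟨K, hK, heK⟩ := h.ground_subset_sUnion he
  obtain ⟨G, hG⟩ := (S.filter (e ∈ ·)).exists_minimal ⟨K, Finset.mem_filter.2 ⟨hS.2 hK, heK⟩⟩
  have hG1 := Finset.mem_filter.1 hG.1
  refine Set.mem_iUnion₂.2 ⟨G, hG1.1, hG1.2, ?_⟩
  rintro ⟨H, ⟨hHS, hHG⟩, heH⟩
  exact hHG.not_subset (hG.2 (Finset.mem_filter.2 ⟨hHS, heH⟩) hHG.subset)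

/-- The rank of `X` in the matroid of the nested set `S`. -/
noncomputable def nestedRk (M : Matroid α) (S : Finset (Set α)) (X : Set α) : ℕ :=
  ∑ G ∈ S, (M.natRk ((X ∩ G) ∪ below S G) - M.natRk (below S G))

/-- A basis of Z is extended to one of Y and then of G; without its part in Z it is a basis of (M |
G) / Z with a trace on Y of maximal size. -/
theorem exists_relative_basis {Z Y G : Set α} (hZY : Z ⊆ Y) (hYG : Y ⊆ G) (hG : G ⊆ M.E) :
    ∃ I ⊆ G \ Z, I.ncard = M.natRk G - M.natRk Z ∧ G ⊆ M.closure (Z ∪ I) ∧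
      M.natRk Y - M.natRk Z ≤ (I ∩ Y).ncard := by
  obtain ⟨J₁, hJ₁⟩ := M.exists_isBasis Z ((hZY.trans hYG).trans hG)
  obtain ⟨J₂, hJ₂, h12⟩ := hJ₁.indep.subset_isBasis_of_subset (hJ₁.subset.trans hZY) (hYG.trans hG)
  obtain ⟨J₃, hJ₃, h23⟩ := hJ₂.indep.subset_isBasis_of_subset (hJ₂.subset.trans hYG) hG
  have hf3 : J₃.Finite := M.ground_finite.subset hJ₃.indep.subset_ground
  have hf2 := hf3.subset h23
  have hf1 := hf2.subset h12
  have hinter : J₃ ∩ Z ⊆ J₁ := by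
    rw [hJ₁.eq_of_subset_indep (hJ₃.indep.subset Set.inter_subset_left)
      (Set.subset_inter (h12.trans h23) hJ₁.subset) Set.inter_subset_right]
  refine ⟨J₃ \ J₁, fun x hx => ⟨hJ₃.subset hx.1, fun hxZ => hx.2 (hinter ⟨hx.1, hxZ⟩)⟩, ?_, ?_, ?_⟩
  · rw [Set.ncard_sdiff (h12.trans h23) hf1, natRk_eq_of_isBasis' _ hJ₃.isBasis',
      natRk_eq_of_isBasis' _ hJ₁.isBasis']
  · refine hJ₃.subset_closure.trans (M.closure_subset_closure fun x hx => ?_)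
    by_cases hx1 : x ∈ J₁
    · exact Or.inl (hJ₁.subset hx1)
    · exact Or.inr ⟨hx, hx1⟩
  · rw [natRk_eq_of_isBasis' _ hJ₂.isBasis', natRk_eq_of_isBasis' _ hJ₁.isBasis',
      ← Set.ncard_sdiff h12 hf1]
    exact Set.ncard_le_ncard (fun x hx => ⟨⟨h23 hx.1, hx.2⟩, hJ₂.subset hx.1⟩)
      (hf3.subset (Set.inter_subset_left.trans Set.sdiff_subset))

/-- Greedy choice: a relative basis is taken in each stratum, adapted to X. By induction on rank,
the union B spans each G ∈ S from inside G and meets it in at most rk G points. -/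
theorem IsBuildingSet.exists_isBase_nested (h : M.IsBuildingSet 𝒢) {S : Finset (Set α)}
    (hS : S ∈ M.fullNestedSets 𝒢) (X : Set α) :
    ∃ B, M.IsBase B ∧ (∀ G ∈ S, (B ∩ G).ncard = M.natRk G) ∧
      nestedRk M S X ≤ (B ∩ X).ncard := by
  classical
  have hGE : ∀ G ∈ S, G ⊆ M.E := fun G hG => (h.isFlat G (hS.1.1 hG)).subset_ground
  have hex : ∀ G ∈ S, ∃ I ⊆ G \ below S G, I.ncard = M.natRk G - M.natRk (below S G) ∧
      G ⊆ M.closure (below S G ∪ I) ∧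
      M.natRk ((X ∩ G) ∪ below S G) - M.natRk (below S G) ≤
        (I ∩ ((X ∩ G) ∪ below S G)).ncard := fun G hG =>
    exists_relative_basis Set.subset_union_right
      (Set.union_subset Set.inter_subset_right (below_subset S G)) (hGE G hG)
  choose! I hIsub hIcard hIcl hIX using hex
  set B : Set α := ⋃ G ∈ S, I G with hB
  have hIB : ∀ G ∈ S, I G ⊆ B := fun G hG => Set.subset_biUnion_of_mem (u := I) hG
  have hBE : B ⊆ M.E := Set.iUnion₂_subset fun G hG =>
    (hIsub G hG).trans (Set.sdiff_subset.trans (hGE G hG))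
  have hBfin : B.Finite := M.ground_finite.subset hBE
  have hspan : ∀ n, ∀ G ∈ S, M.natRk G = n → G ⊆ M.closure (B ∩ G) := by
    intro n
    induction n using Nat.strong_induction_on with
    | _ n ih =>
    intro G hG hn
    have h1 : below S G ∪ I G ⊆ M.closure (B ∩ G) := by
      refine Set.union_subset (Set.sUnion_subset ?_) ?_
      · rintro H ⟨hH, hHG⟩
        have hlt := (h.isFlat H (hS.1.1 hH)).natRk_lt hHG (hGE G hG)
        exact (ih _ (hn ▸ hlt) H hH rfl).trans
          (M.closure_subset_closure (Set.inter_subset_inter_right _ hHG.subset))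
      · refine Set.Subset.trans ?_ (M.subset_closure _ (Set.inter_subset_right.trans (hGE G hG)))
        exact Set.subset_inter (hIB G hG) ((hIsub G hG).trans Set.sdiff_subset)
    exact (hIcl G hG).trans (M.closure_subset_closure_of_subset_closure h1)
  have hsmall : ∀ n, ∀ G ∈ S, M.natRk G = n → (B ∩ G).ncard ≤ M.natRk G := by
    intro n
    induction n using Nat.strong_induction_on with
    | _ n ih =>
    intro G hG hn
    have h1 : B ∩ G ⊆ I G ∪ (B ∩ below S G) := by
      rintro x ⟨hxB, hxG⟩
      obtain ⟨H, hH, hxH⟩ := Set.mem_iUnion₂.1 hxB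
      have hxH' := hIsub H hH hxH
      rcases h.subset_or_subset_or_disjoint hS.1 hG hH with rfl | h2 | h2 | h2
      · exact Or.inl hxH
      · exact absurd (subset_below hG h2 hxG) hxH'.2
      · exact Or.inr ⟨hxB, subset_below hH h2 hxH'.1⟩
      · exact absurd hxH'.1 (Set.disjoint_left.1 h2 hxG)
    -- The maximal members below G form a nested antichain, so their ranks add up to the rank of
    -- their union.
    have h2 : (B ∩ below S G).ncard ≤ M.natRk (below S G) := by
      rw [h.natRk_below hS.1, ← sUnion_maxBelow]
      refine (ncard_inter_sUnion_le B _).trans (Finset.sum_le_sum fun H hH => ?_)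
      obtain ⟨hHS, hHG⟩ := mem_of_mem_maxBelow hH
      have hlt := (h.isFlat H (hS.1.1 hHS)).natRk_lt hHG (hGE G hG)
      exact ih _ (hn ▸ hlt) H hHS rfl
    have h3 := Set.ncard_le_ncard h1 ((hBfin.subset (hIB G hG)).union
      (hBfin.subset Set.inter_subset_left))
    have h4 := Set.ncard_union_le (I G) (B ∩ below S G)
    have h5 := hIcard G hG
    have h6 := M.natRk_mono (below_subset S G)
    omega
  have hEB : M.E ⊆ M.closure B := by
    refine h.ground_subset_sUnion.trans (Set.sUnion_subset fun K hK => ?_)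
    exact (hspan _ K (hS.2 hK) rfl).trans (M.closure_subset_closure Set.inter_subset_left)
  -- B spans the ground set, so a count over the factors of the ground set makes it independent.
  have hBcard : B.ncard ≤ M.natRk M.E := by
    have h1 : B = B ∩ ⋃₀ ((h.finite_buildingFactors M.E).toFinset : Set (Set α)) := by
      rw [Set.Finite.coe_toFinset]
      exact (Set.inter_eq_left.2 (hBE.trans h.ground_subset_sUnion)).symm
    rw [h1]
    refine (ncard_inter_sUnion_le B _).trans (le_trans (Finset.sum_le_sum fun K hK => ?_)
      h.sum_natRk_factors_ground_le)
    exact hsmall _ K (hS.2 ((Set.Finite.mem_toFinset _).1 hK)) rfl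
  have hBrk : M.natRk M.E = M.natRk B := natRk_eq_of_subset_closure M hBE hEB
  have hBind : M.Indep B := M.indep_of_ncard_le_natRk hBfin (hBrk ▸ hBcard)
  refine ⟨B, hBind.isBase_of_ground_subset_closure hEB, fun G hG => ?_, ?_⟩
  · refine le_antisymm (hsmall _ G hG rfl) ?_
    rw [natRk_eq_of_subset_closure M Set.inter_subset_right (hspan _ G hG rfl)]
    exact M.natRk_le_ncard (hBfin.subset Set.inter_subset_left)
  · have h1 : nestedRk M S X ≤ ∑ G ∈ S, ((B ∩ X) ∩ (G \ below S G)).ncard := by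
      refine Finset.sum_le_sum fun G hG => (hIX G hG).trans ?_
      refine Set.ncard_le_ncard ?_ (hBfin.subset (Set.inter_subset_left.trans Set.inter_subset_left))
      rintro x ⟨hxI, hx⟩
      have hxG := hIsub G hG hxI
      exact ⟨⟨hIB G hG hxI, (hx.resolve_right hxG.2).1⟩, hxG⟩
    rw [← ncard_inter_biUnion _ (hBfin.subset Set.inter_subset_left) S _
      (h.pairwiseDisjoint_sdiff_below hS.1)] at h1
    exact h1.trans (Set.ncard_le_ncard Set.inter_subset_left (hBfin.subset Set.inter_subset_left))

/-- Such a base spans each member of S from within, hence also each ⋃ S_{<G}. Its points of X in the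
stratum of G are therefore independent over ⋃ S_{<G}. -/
theorem IsBuildingSet.ncard_inter_le_nestedRk (h : M.IsBuildingSet 𝒢) {S : Finset (Set α)}
    (hS : S ∈ M.fullNestedSets 𝒢) {B : Set α} (hB : M.IsBase B)
    (hBG : ∀ G ∈ S, (B ∩ G).ncard = M.natRk G) (X : Set α) :
    (B ∩ X).ncard ≤ nestedRk M S X := by
  have hBE := hB.subset_ground
  have hBfin : B.Finite := M.ground_finite.subset hBE
  have hfin : ∀ Y, (B ∩ Y).Finite := fun Y => hBfin.subset Set.inter_subset_left
  have h1 : B ∩ X = (B ∩ X) ∩ ⋃ G ∈ S, G \ below S G := by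
    rw [h.biUnion_sdiff_below hS]
    exact (Set.inter_eq_left.2 (Set.inter_subset_left.trans hBE)).symm
  rw [h1, ncard_inter_biUnion _ (hfin X) S _ (h.pairwiseDisjoint_sdiff_below hS.1)]
  refine Finset.sum_le_sum fun G hG => ?_
  have hspan : ∀ H ∈ S, H ⊆ M.closure (B ∩ H) := fun H hH => by
    refine M.subset_closure_of_natRk_le Set.inter_subset_right
      (h.isFlat H (hS.1.1 hH)).subset_ground ?_
    rw [natRk_eq_of_indep _ (hB.indep.subset Set.inter_subset_left), hBG H hH]
  have hbel : below S G ⊆ M.closure (B ∩ below S G) := by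
    refine Set.sUnion_subset ?_
    rintro H ⟨hH, hHG⟩
    exact (hspan H hH).trans (M.closure_subset_closure
      (Set.inter_subset_inter_right _ (subset_below hH hHG)))
  have h2 : M.natRk (below S G) = (B ∩ below S G).ncard := by
    rw [natRk_eq_of_subset_closure M Set.inter_subset_right hbel,
      natRk_eq_of_indep _ (hB.indep.subset Set.inter_subset_left)]
  have h3 : M.Indep ((B ∩ X ∩ (G \ below S G)) ∪ (B ∩ below S G)) :=
    hB.indep.subset (Set.union_subset (Set.inter_subset_left.trans Set.inter_subset_left)
      Set.inter_subset_left)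
  have h4 : ((B ∩ X ∩ (G \ below S G)) ∪ (B ∩ below S G)).ncard =
      (B ∩ X ∩ (G \ below S G)).ncard + (B ∩ below S G).ncard := by
    refine Set.ncard_union_eq ?_ ((hfin X).subset Set.inter_subset_left) (hfin _)
    exact Set.disjoint_left.2 fun x hx hx' => hx.2.2 hx'.2
  have h5 := natRk_eq_of_indep _ h3
  have h6 : M.natRk ((B ∩ X ∩ (G \ below S G)) ∪ (B ∩ below S G)) ≤
      M.natRk ((X ∩ G) ∪ below S G) := by
    refine M.natRk_mono (Set.union_subset_union ?_ Set.inter_subset_right)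
    exact fun x hx => ⟨hx.1.2, hx.2.1⟩
  omega

theorem weightOf_sum_indicatorVec (S : Finset (Set α)) {B : Set α} (hB : B.Finite) :
    weightOf (∑ F ∈ S, indicatorVec F) B = ((∑ F ∈ S, (B ∩ F).ncard : ℕ) : ℝ) := by
  classical
  rw [weightOf, finsum_mem_eq_finite_toFinset_sum _ hB]
  simp only [Finset.sum_apply]
  rw [Finset.sum_comm, Nat.cast_sum]
  refine Finset.sum_congr rfl fun F _ => ?_
  have h1 : B ∩ F = ((hB.toFinset.filter (· ∈ F) : Finset α) : Set α) := by
    ext x; simp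
  rw [h1, Set.ncard_coe_finset, Finset.card_filter, Nat.cast_sum]
  refine Finset.sum_congr rfl fun x _ => ?_
  by_cases hx : x ∈ F <;> simp [indicatorVec, hx]

theorem nestedMatroid_isBase_iff {S : Finset (Set α)} {B : Set α} :
    (M.nestedMatroid S).IsBase B ↔ M.IsMaxWeightBase (∑ F ∈ S, indicatorVec F) B := by
  simp [nestedMatroid, initialMatroid]

/-- The weight of B is ∑ |B ∩ G|, with each term at most rk G. Some base attains all these bounds at
once, so maximal weight means equality in every term. -/
theorem IsBuildingSet.nestedMatroid_isBase_iff (h : M.IsBuildingSet 𝒢) {S : Finset (Set α)}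
    (hS : S ∈ M.fullNestedSets 𝒢) {B : Set α} :
    (M.nestedMatroid S).IsBase B ↔ M.IsBase B ∧ ∀ G ∈ S, (B ∩ G).ncard = M.natRk G := by
  rw [Matroid.nestedMatroid_isBase_iff]
  have hfin : ∀ B, M.IsBase B → B.Finite := fun B hB => M.ground_finite.subset hB.subset_ground
  have hle : ∀ B, M.IsBase B → ∀ G ∈ S, (B ∩ G).ncard ≤ M.natRk G := fun B hB G _ => by
    rw [← natRk_eq_of_indep M (hB.indep.subset Set.inter_subset_left)]
    exact M.natRk_mono Set.inter_subset_right
  constructor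
  · rintro ⟨hB, hmax⟩
    refine ⟨hB, ?_⟩
    obtain ⟨B₀, hB₀, hG₀, -⟩ := h.exists_isBase_nested hS ∅
    have h1 := hmax B₀ hB₀
    rw [weightOf_sum_indicatorVec S (hfin _ hB), weightOf_sum_indicatorVec S (hfin _ hB₀),
      Nat.cast_le, Finset.sum_congr rfl hG₀] at h1
    exact (Finset.sum_eq_sum_iff_of_le (hle B hB)).1
      (le_antisymm (Finset.sum_le_sum (hle B hB)) h1)
  · rintro ⟨hB, hG⟩
    refine ⟨hB, fun B' hB' => ?_⟩
    rw [weightOf_sum_indicatorVec S (hfin _ hB), weightOf_sum_indicatorVec S (hfin _ hB'),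
      Nat.cast_le, Finset.sum_congr rfl hG]
    exact Finset.sum_le_sum (hle B' hB')

theorem IsBuildingSet.natRk_nestedMatroid (h : M.IsBuildingSet 𝒢) {S : Finset (Set α)}
    (hS : S ∈ M.fullNestedSets 𝒢) (X : Set α) :
    (M.nestedMatroid S).natRk X = nestedRk M S X := by
  have hfin : ∀ B, M.IsBase B → B.Finite := fun B hB => M.ground_finite.subset hB.subset_ground
  refine le_antisymm ?_ ?_
  · obtain ⟨I, hI⟩ := (M.nestedMatroid S).exists_isBasis' X
    obtain ⟨B, hB, hIB⟩ := hI.indep.exists_isBase_superset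
    rw [h.nestedMatroid_isBase_iff hS] at hB
    rw [natRk_eq_of_isBasis' _ hI]
    exact (Set.ncard_le_ncard (Set.subset_inter hIB hI.subset)
      ((hfin B hB.1).subset Set.inter_subset_left)).trans
      (h.ncard_inter_le_nestedRk hS hB.1 hB.2 X)
  · obtain ⟨B, hB, hG, hX⟩ := h.exists_isBase_nested hS X
    have hB' := (h.nestedMatroid_isBase_iff hS).2 ⟨hB, hG⟩
    refine hX.trans ?_
    rw [← natRk_eq_of_indep _ (hB'.indep.subset Set.inter_subset_left)]
    exact natRk_mono _ Set.inter_subset_right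

end Initial

/-! ### Characteristic polynomials of intervals -/

section Char

variable {α : Type*} {M : Matroid α} [M.Finite] [M.Loopless] {𝒢 : Set (Set α)}

open scoped Classical in
/-- The difference `G \ F`, within the ground set, as a finite set. -/
noncomputable def sdiffFinset (M : Matroid α) [M.Finite] (G F : Set α) : Finset α :=
  M.ground_finite.toFinset.filter (· ∈ G \ F)

theorem coe_sdiffFinset {G F : Set α} (hG : G ⊆ M.E) :
    (M.sdiffFinset G F : Set α) = G \ F := by
  ext x
  simp only [sdiffFinset, Finset.coe_filter, Set.Finite.mem_toFinset, Set.mem_ofPred_eq]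
  exact ⟨fun hx => hx.2, fun hx => ⟨hG hx.1, hx⟩⟩

/-- The characteristic polynomial of the minor `(M | G) / F`. -/
noncomputable def intervalChar (M : Matroid α) [M.Finite] (G F : Set α) : Polynomial ℤ :=
  ∑ Y ∈ (M.sdiffFinset G F).powerset,
    (-1) ^ Y.card * Polynomial.X ^ (M.natRk G - M.natRk ((Y : Set α) ∪ F))

/-- A subset of a disjoint union is an independent choice of a subset in each block. -/
theorem sum_powerset_biUnion {ι R : Type*} [CommSemiring R] [DecidableEq α] [DecidableEq ι]
    (s : Finset ι) (D : ι → Finset α) (hD : (s : Set ι).PairwiseDisjoint D)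
    (f : ι → Finset α → R) :
    ∑ Y ∈ (s.biUnion D).powerset, ∏ i ∈ s, f i (Y ∩ D i) =
      ∏ i ∈ s, ∑ Y ∈ (D i).powerset, f i Y := by
  induction s using Finset.induction with
  | empty => simp
  | insert a s ha ih =>
    rw [Finset.prod_insert ha, ← ih (hD.subset (by simp)), Finset.sum_mul_sum,
      ← Finset.sum_product']
    have hdis : Disjoint (D a) (s.biUnion D) := by
      rw [Finset.disjoint_biUnion_right]
      intro i hi
      exact hD (by simp) (by simp [hi]) (by rintro rfl; exact ha hi)
    refine Finset.sum_nbij' (fun Y => (Y ∩ D a, Y ∩ s.biUnion D)) (fun p => p.1 ∪ p.2) ?_ ?_ ?_ ?_ ?_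
    · intro Y _
      simp [Finset.inter_subset_right]
    · rintro ⟨Y, Z⟩ hp
      simp only [Finset.mem_product, Finset.mem_powerset] at hp
      rw [Finset.mem_powerset, Finset.biUnion_insert]
      exact Finset.union_subset_union hp.1 hp.2
    · intro Y hY
      rw [Finset.mem_powerset, Finset.biUnion_insert] at hY
      simp only
      rw [← Finset.inter_union_distrib_left]
      exact Finset.inter_eq_left.2 hY
    · rintro ⟨Y, Z⟩ hp
      simp only [Finset.mem_product, Finset.mem_powerset] at hp
      have h1 : Z ∩ D a = ∅ := Finset.disjoint_iff_inter_eq_empty.1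
        (hdis.symm.mono_left hp.2)
      have h2 : Y ∩ s.biUnion D = ∅ := Finset.disjoint_iff_inter_eq_empty.1
        (hdis.mono_left hp.1)
      simp only [Finset.union_inter_distrib_right, h1, h2, Finset.union_empty, Finset.empty_union,
        Finset.inter_eq_left.2 hp.1, Finset.inter_eq_left.2 hp.2]
    · intro Y _
      rw [Finset.prod_insert ha]
      congr 1
      refine Finset.prod_congr rfl fun i hi => ?_
      rw [Finset.inter_assoc, Finset.inter_eq_right.2 (Finset.subset_biUnion_of_mem D hi)]

theorem natRk_sub_nestedRk {S : Finset (Set α)} (hS : ∀ G ∈ S, G ⊆ M.E) (X : Set α) :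
    nestedRk M S M.E - nestedRk M S X =
      ∑ G ∈ S, (M.natRk G - M.natRk ((X ∩ (G \ below S G)) ∪ below S G)) := by
  have h0 : ∀ G, (X ∩ (G \ below S G)) ∪ below S G = (X ∩ G) ∪ below S G := by
    intro G
    ext x
    simp only [Set.mem_union, Set.mem_inter_iff, Set.mem_sdiff]
    tauto
  have h1 : ∀ G ∈ S, (M.E ∩ G) ∪ below S G = G := fun G hG => by
    rw [Set.inter_eq_right.2 (hS G hG), Set.union_eq_left.2 (below_subset S G)]
  have h2 : ∀ G ∈ S, M.natRk ((X ∩ G) ∪ below S G) ≤ M.natRk G := fun G _ =>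
    M.natRk_mono (Set.union_subset Set.inter_subset_right (below_subset S G))
  have h3 : nestedRk M S M.E = nestedRk M S X +
      ∑ G ∈ S, (M.natRk G - M.natRk ((X ∩ (G \ below S G)) ∪ below S G)) := by
    rw [nestedRk, nestedRk, ← Finset.sum_add_distrib]
    refine Finset.sum_congr rfl fun G hG => ?_
    have h4 := M.natRk_mono (Set.subset_union_right (s := X ∩ G) (t := below S G))
    have h5 := h2 G hG
    rw [h0, h1 G hG]
    omega
  omega

/-- The corank in M_S is a sum of terms that each see only one stratum, and the strata partition the
ground set, so the sum over subsets factors. -/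
theorem IsBuildingSet.characteristicPoly_nestedMatroid (h : M.IsBuildingSet 𝒢)
    {S : Finset (Set α)} (hS : S ∈ M.fullNestedSets 𝒢) :
    (M.nestedMatroid S).characteristicPoly = ∏ G ∈ S, M.intervalChar G (below S G) := by
  classical
  have hGE : ∀ G ∈ S, G ⊆ M.E := fun G hG => (h.isFlat G (hS.1.1 hG)).subset_ground
  have hE : (M.nestedMatroid S).E = M.E := rfl
  set D : Set α → Finset α := fun G => M.sdiffFinset G (below S G) with hD
  have hDc : ∀ G ∈ S, (D G : Set α) = G \ below S G := fun G hG => coe_sdiffFinset (hGE G hG)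
  have hdisj : (S : Set (Set α)).PairwiseDisjoint D := by
    intro G hG H hH hne
    have := h.pairwiseDisjoint_sdiff_below hS.1 hG hH hne
    simp only [Function.onFun] at this ⊢
    rwa [← hDc G hG, ← hDc H hH, Finset.disjoint_coe] at this
  have hU : M.ground_finite.toFinset = S.biUnion D := by
    rw [← Finset.coe_inj, Finset.coe_biUnion, Set.Finite.coe_toFinset,
      ← h.biUnion_sdiff_below hS]
    exact (Set.iUnion₂_congr fun G hG => hDc G hG).symm
  have hU' : (M.nestedMatroid S).ground_finite.toFinset = S.biUnion D := hU
  rw [characteristicPoly, hU']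
  simp only [intervalChar]
  rw [← sum_powerset_biUnion S D hdisj fun G Y =>
    (-1) ^ Y.card * Polynomial.X ^ (M.natRk G - M.natRk ((Y : Set α) ∪ below S G))]
  refine Finset.sum_congr rfl fun Y hY => ?_
  rw [hE, h.natRk_nestedMatroid hS, h.natRk_nestedMatroid hS, natRk_sub_nestedRk hGE,
    Finset.prod_mul_distrib, Finset.prod_pow_eq_pow_sum, Finset.prod_pow_eq_pow_sum]
  congr 2
  · rw [← Finset.card_biUnion]
    · rw [← Finset.inter_biUnion, Finset.inter_eq_left.2 (Finset.mem_powerset.1 hY)]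
    · intro G hG H hH hne
      exact (hdisj hG hH hne).mono Finset.inter_subset_right Finset.inter_subset_right
  · refine Finset.sum_congr rfl fun G hG => ?_
    rw [Finset.coe_inter, hDc G hG]

/-! ### Möbius inversion -/

/-- The flats, as a finite set. -/
noncomputable def flatFinset (M : Matroid α) [M.Finite] : Finset (Set α) :=
  (M.ground_finite.finite_subsets.subset fun _ (hF : M.IsFlat _) => hF.subset_ground :
    {F | M.IsFlat F}.Finite).toFinset

theorem mem_flatFinset {F : Set α} : F ∈ M.flatFinset ↔ M.IsFlat F := by
  simp [flatFinset]

open scoped Classical in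
/-- The Möbius function of the lattice of flats. -/
noncomputable def flatMu (M : Matroid α) [M.Finite] (F W : Set α) : ℤ :=
  ∑ Y ∈ (M.sdiffFinset M.E F).powerset.filter fun Y : Finset α =>
    M.closure ((Y : Set α) ∪ F) = W, (-1) ^ Y.card

open scoped Classical in
theorem sdiffFinset_powerset_eq {F G : Set α} (hG : M.IsFlat G) (hF : M.IsFlat F)
    (hFG : F ⊆ G) :
    (M.sdiffFinset G F).powerset =
      (M.sdiffFinset M.E F).powerset.filter fun Y : Finset α => M.closure ((Y : Set α) ∪ F) ⊆ G := by
  ext Y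
  simp only [Finset.mem_powerset, Finset.mem_filter]
  rw [← Finset.coe_subset, ← Finset.coe_subset, coe_sdiffFinset hG.subset_ground,
    coe_sdiffFinset subset_rfl]
  constructor
  · intro hY
    exact ⟨hY.trans (Set.sdiff_subset_sdiff_left hG.subset_ground),
      hG.closure_subset (Set.union_subset (hY.trans Set.sdiff_subset) hFG)⟩
  · rintro ⟨hY, hcl⟩
    have h1 : (Y : Set α) ∪ F ⊆ M.closure (Y ∪ F) := M.subset_closure _
      (Set.union_subset (hY.trans Set.sdiff_subset) hF.subset_ground)
    exact fun x hx => ⟨hcl (h1 (Or.inl hx)), (hY hx).2⟩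

open scoped Classical in
theorem sum_filter_closure {R : Type*} [AddCommMonoid R] {F G : Set α}
    (hG : M.IsFlat G) (hF : M.IsFlat F) (hFG : F ⊆ G) (f : Finset α → R) :
    ∑ Y ∈ (M.sdiffFinset G F).powerset, f Y = ∑ W ∈ M.flatFinset,
      if W ⊆ G then ∑ Y ∈ (M.sdiffFinset M.E F).powerset.filter fun Y : Finset α =>
        M.closure ((Y : Set α) ∪ F) = W, f Y else 0 := by
  rw [sdiffFinset_powerset_eq hG hF hFG, ← Finset.sum_filter,
    ← Finset.sum_fiberwise_of_maps_to (s := Finset.filter _ _) (t := M.flatFinset.filter (· ⊆ G))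
      (g := fun Y : Finset α => M.closure ((Y : Set α) ∪ F))]
  · refine Finset.sum_congr rfl fun W hW => Finset.sum_congr ?_ fun _ _ => rfl
    rw [Finset.filter_filter]
    refine Finset.filter_congr fun Y _ => ?_
    constructor
    · exact fun hY => hY.2
    · rintro rfl
      exact ⟨(Finset.mem_filter.1 hW).2, rfl⟩
  · intro Y hY
    exact Finset.mem_filter.2 ⟨mem_flatFinset.2 (isFlat_closure _), (Finset.mem_filter.1 hY).2⟩

theorem flatMu_eq_zero {F W : Set α} (hF : M.IsFlat F) (h : ¬ F ⊆ W) : M.flatMu F W = 0 := by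
  classical
  rw [flatMu, Finset.filter_false_of_mem, Finset.sum_empty]
  rintro Y hY rfl
  rw [Finset.mem_powerset, ← Finset.coe_subset, coe_sdiffFinset subset_rfl] at hY
  exact h (Set.subset_union_right.trans (M.subset_closure _
    (Set.union_subset (hY.trans Set.sdiff_subset) hF.subset_ground)))

open scoped Classical in
-- Grouped by the closure of Y ∪ F, this is the alternating count of the subsets Y of G \ F, which
-- vanishes unless G \ F is empty.
theorem sum_flatMu_right {F G : Set α} (hG : M.IsFlat G) (hF : M.IsFlat F) :
    ∑ W ∈ M.flatFinset, (if W ⊆ G then M.flatMu F W else 0) =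
      if F = G then 1 else 0 := by
  by_cases hFG : F ⊆ G
  · have h1 := sum_filter_closure hG hF hFG (fun Y => (-1 : ℤ) ^ Y.card)
    rw [Finset.sum_powerset_neg_one_pow_card] at h1
    rw [show (if F = G then (1 : ℤ) else 0) = if M.sdiffFinset G F = ∅ then 1 else 0 from ?_]
    · exact h1.symm
    · refine if_congr ?_ rfl rfl
      rw [← Finset.coe_eq_empty, coe_sdiffFinset hG.subset_ground, Set.sdiff_eq_empty]
      exact ⟨fun h => h.ge, fun h => subset_antisymm hFG h⟩
  · rw [if_neg (by rintro rfl; exact hFG subset_rfl)]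
    refine Finset.sum_eq_zero fun W _ => ?_
    split_ifs with hW
    · exact flatMu_eq_zero hF fun h => hFG (h.trans hW)
    · rfl

open scoped Classical in
-- A one-sided inverse of a square matrix over a commutative ring is two-sided, so the dual Möbius
-- relation comes for free.
theorem sum_flatMu_left {Z W : Set α} (hZ : M.IsFlat Z) (hW : M.IsFlat W) :
    ∑ F ∈ M.flatFinset, (if Z ⊆ F then M.flatMu F W else 0) =
      if Z = W then 1 else 0 := by
  let A : Matrix M.flatFinset M.flatFinset ℤ := fun F W => M.flatMu F W
  let B : Matrix M.flatFinset M.flatFinset ℤ := fun F W => if (F : Set α) ⊆ W then 1 else 0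
  have hAB : A * B = 1 := by
    ext F G
    rw [Matrix.mul_apply, Matrix.one_apply]
    have h1 := sum_flatMu_right (mem_flatFinset.1 G.2) (mem_flatFinset.1 F.2)
    rw [← Finset.sum_coe_sort] at h1
    simp only [A, B, mul_ite, mul_one, mul_zero, Subtype.ext_iff]
    exact h1
  have hBA : B * A = 1 := mul_eq_one_comm.1 hAB
  have h2 := congrFun (congrFun hBA ⟨Z, mem_flatFinset.2 hZ⟩) ⟨W, mem_flatFinset.2 hW⟩
  rw [Matrix.mul_apply, Matrix.one_apply] at h2
  rw [← Finset.sum_coe_sort]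
  simp only [A, B, ite_mul, one_mul, zero_mul, Subtype.ext_iff] at h2
  exact h2

open scoped Classical in
theorem intervalChar_eq_sum {F G : Set α} (hG : M.IsFlat G) (hF : M.IsFlat F) (hFG : F ⊆ G) :
    M.intervalChar G F = ∑ W ∈ M.flatFinset,
      if W ⊆ G then Polynomial.C (M.flatMu F W) * Polynomial.X ^ (M.natRk G - M.natRk W) else 0 := by
  rw [intervalChar, sum_filter_closure hG hF hFG]
  refine Finset.sum_congr rfl fun W _ => ?_
  split_ifs with hW
  · rw [flatMu, map_sum, Finset.sum_mul]
    refine Finset.sum_congr rfl fun Y hY => ?_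
    rw [← (Finset.mem_filter.1 hY).2, natRk_closure]
    simp
  · rfl

open scoped Classical in
/-- The characteristic polynomials of the upper minors of an interval sum to a power of `q`. -/
theorem sum_intervalChar {Z G : Set α} (hZ : M.IsFlat Z) (hG : M.IsFlat G) (hZG : Z ⊆ G) :
    ∑ F ∈ M.flatFinset with (Z ⊆ F ∧ F ⊆ G), M.intervalChar G F =
      Polynomial.X ^ (M.natRk G - M.natRk Z) := by
  calc ∑ F ∈ M.flatFinset with (Z ⊆ F ∧ F ⊆ G), M.intervalChar G F
      = ∑ F ∈ M.flatFinset with (Z ⊆ F ∧ F ⊆ G), ∑ W ∈ M.flatFinset,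
          (if W ⊆ G then Polynomial.C (M.flatMu F W) * Polynomial.X ^ (M.natRk G - M.natRk W)
            else 0) := by
        refine Finset.sum_congr rfl fun F hF => ?_
        rw [Finset.mem_filter, mem_flatFinset] at hF
        exact intervalChar_eq_sum hG hF.1 hF.2.2
    _ = ∑ W ∈ M.flatFinset, if W ⊆ G then Polynomial.C (if Z = W then (1 : ℤ) else 0) *
          Polynomial.X ^ (M.natRk G - M.natRk W) else 0 := by
        rw [Finset.sum_comm]
        refine Finset.sum_congr rfl fun W hW => ?_
        by_cases hWG : W ⊆ G
        · simp only [if_pos hWG]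
          rw [← Finset.sum_mul, ← map_sum, ← sum_flatMu_left hZ (mem_flatFinset.1 hW),
            Finset.sum_filter]
          congr 2
          refine Finset.sum_congr rfl fun F hF => ?_
          -- The condition F ⊆ G costs nothing: the Möbius value at (F, W) is zero unless F ⊆ W, and
          -- W ⊆ G.
          by_cases hFG : F ⊆ G
          · simp [hFG]
          · rw [flatMu_eq_zero (mem_flatFinset.1 hF) fun h => hFG (h.trans hWG)]
            simp
        · simp only [if_neg hWG, Finset.sum_const_zero]
    _ = Polynomial.X ^ (M.natRk G - M.natRk Z) := by
        rw [Finset.sum_eq_single Z]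
        · simp [hZG]
        · intro W _ hW
          simp [hW.symm]
        · intro h
          exact absurd (mem_flatFinset.2 hZ) h

end Char

section Inversion

variable {α : Type*} {M : Matroid α} [M.Finite] [M.Loopless] {𝒢 : Set (Set α)}

/-! ### Exchanging the sums over nested sets and flats -/

/-- The flats `φ G`, for `G ∈ T`, contain the joins `⋃ T_{< G}`, and the others are trivial. -/
def IsAdmissible (T : Finset (Set α)) (φ : 𝒢 → Set α) : Prop :=
  ∀ G : 𝒢, ((G : Set α) ∈ T → below T G ⊆ φ G) ∧ ((G : Set α) ∉ T → φ G = G)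

theorem IsAdmissible.mem_of_ne {T : Finset (Set α)} {φ : 𝒢 → Set α} (hT : IsAdmissible T φ)
    {G : 𝒢} (hG : φ G ≠ G) : (G : Set α) ∈ T := by
  by_contra h
  exact hG ((hT G).2 h)

theorem IsAdmissible.erase [DecidableEq (Set α)] {T : Finset (Set α)} {φ : 𝒢 → Set α}
    (hT : IsAdmissible T φ) {K : 𝒢} (hK : φ K = K) : IsAdmissible (T.erase (K : Set α)) φ := by
  intro G
  refine ⟨fun hG => (below_mono (Finset.erase_subset _ _) _).trans
    ((hT G).1 (Finset.mem_of_mem_erase hG)), fun hG => ?_⟩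
  by_cases hGK : G = K
  · rw [hGK, hK]
  · exact (hT G).2 fun h => hG (Finset.mem_erase.2 ⟨fun h0 => hGK (Subtype.ext h0), h⟩)

theorem IsAdmissible.insert [DecidableEq (Set α)] {T : Finset (Set α)} {φ : 𝒢 → Set α}
    (hT : IsAdmissible T φ) {K : 𝒢} (hK : φ K = K)
    (hle : ∀ G : 𝒢, (G : Set α) ∈ T → (K : Set α) ⊂ G → (K : Set α) ⊆ φ G) :
    IsAdmissible (insert (K : Set α) T) φ := by
  intro G
  refine ⟨fun hG => ?_, fun hG => (hT G).2 fun h => hG (Finset.mem_insert_of_mem h)⟩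
  rcases Finset.mem_insert.1 hG with h0 | hGT
  · have : G = K := Subtype.ext h0
    rw [this, hK]
    exact below_subset _ _
  · by_cases hKG : (K : Set α) ⊂ G
    · rw [below_insert_of_ssubset T hKG]
      exact Set.union_subset (hle G hGT hKG) ((hT G).1 hGT)
    · rw [below_insert_of_not_ssubset T hKG]
      exact (hT G).1 hGT

/-- An antichain containing K whose join is in 𝒢 has that join inside K by maximality, so its other
members would be comparable with K. -/
theorem IsBuildingSet.insert_factor_ground_mem [DecidableEq (Set α)] (h : M.IsBuildingSet 𝒢)
    {T : Finset (Set α)} (hT : T ∈ M.nestedSets 𝒢) {K : Set α}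
    (hK : K ∈ buildingFactors 𝒢 M.E) : insert K T ∈ M.nestedSets 𝒢 := by
  refine ⟨by rw [Finset.coe_insert]; exact Set.insert_subset hK.1.1 hT.1, ?_⟩
  intro Q hQ hanti hcard hmem
  have hQG : ∀ H ∈ Q, H ∈ 𝒢 := fun H hH => by
    rcases Finset.mem_insert.1 (hQ hH) with rfl | h1
    · exact hK.1.1
    · exact hT.1 h1
  have hsub : ∀ H ∈ Q, H ⊆ M.closure (⋃₀ (Q : Set (Set α))) := fun H hH =>
    (Set.subset_sUnion_of_mem hH).trans (M.subset_closure _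
      (Set.sUnion_subset fun L hL => (h.isFlat L (hQG L hL)).subset_ground))
  by_cases hKQ : K ∈ Q
  · obtain ⟨H, hH, hHK⟩ := Finset.exists_mem_ne (Nat.lt_of_succ_le hcard) K
    exact hanti hH hKQ hHK ((hsub H hH).trans
      (hK.2 ⟨hmem, M.closure_subset_ground _⟩ (hsub K hKQ)))
  · exact hT.2 Q ((Finset.subset_insert_iff_of_notMem hKQ).1 hQ) hanti hcard hmem

/-- An antichain containing K and contained in G lies inside Y, where maximality of K applies. One
that leaves G is traded for an antichain in T by putting G in place of its members inside G. -/
theorem IsBuildingSet.insert_factor_mem [DecidableEq (Set α)] (h : M.IsBuildingSet 𝒢)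
    {T : Finset (Set α)} (hT : T ∈ M.nestedSets 𝒢) {G Y K : Set α} (hG : G ∈ T)
    (hY : M.IsFlat Y) (hYG : Y ⊂ G) (hTY : below T G ⊆ Y)
    (hK : K ∈ buildingFactors 𝒢 Y) : insert K T ∈ M.nestedSets 𝒢 := by
  have : DecidablePred fun H : Set α => ¬ H ⊆ G := Classical.decPred _
  have hKG : K ⊂ G := hK.1.2.trans_ssubset hYG
  refine ⟨by rw [Finset.coe_insert]; exact Set.insert_subset hK.1.1 hT.1, ?_⟩
  intro Q hQ hanti hcard hmem
  have hQG : ∀ H ∈ Q, H ∈ 𝒢 := fun H hH => by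
    rcases Finset.mem_insert.1 (hQ hH) with rfl | h1
    · exact hK.1.1
    · exact hT.1 h1
  have hQE : ⋃₀ (Q : Set (Set α)) ⊆ M.E :=
    Set.sUnion_subset fun L hL => (h.isFlat L (hQG L hL)).subset_ground
  have hsub : ∀ H ∈ Q, H ⊆ M.closure (⋃₀ (Q : Set (Set α))) := fun H hH =>
    (Set.subset_sUnion_of_mem hH).trans (M.subset_closure _ hQE)
  by_cases hKQ : K ∈ Q
  swap
  · exact hT.2 Q ((Finset.subset_insert_iff_of_notMem hKQ).1 hQ) hanti hcard hmem
  have hQT : ∀ H ∈ Q, H ≠ K → H ∈ T := fun H hH hHK =>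
    (Finset.mem_insert.1 (hQ hH)).resolve_left hHK
  by_cases hall : ∀ H ∈ Q, H ⊆ G
  · have hQY : ⋃₀ (Q : Set (Set α)) ⊆ Y := by
      refine Set.sUnion_subset fun H hH => ?_
      by_cases hHK : H = K
      · rw [hHK]; exact hK.1.2
      · refine (subset_below (hQT H hH hHK) ?_).trans hTY
        refine (hall H hH).ssubset_of_ne ?_
        rintro rfl
        exact hanti hKQ hH (Ne.symm hHK) hKG.subset
    obtain ⟨H, hH, hHK⟩ := Finset.exists_mem_ne (Nat.lt_of_succ_le hcard) K
    exact hanti hH hKQ hHK ((hsub H hH).trans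
      (hK.2 ⟨hmem, hY.closure_subset hQY⟩ (hsub K hKQ)))
  · push Not at hall
    obtain ⟨L, hLQ, hLG⟩ := hall
    set Q' := insert G (Q.filter fun H => ¬ H ⊆ G) with hQ'
    have hne : ∀ H ∈ Q, ¬ H ⊆ G → H ≠ K := fun H _ hHG h0 => hHG (h0 ▸ hKG.subset)
    have hGH : ∀ H ∈ Q, ¬ H ⊆ G → ¬ G ⊆ H := fun H hH hHG hle =>
      hanti hKQ hH (hne H hH hHG).symm (hKG.subset.trans hle)
    have hG' : G ∉ Q.filter fun H => ¬ H ⊆ G := by simp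
    refine hT.2 Q' ?_ ?_ ?_ ?_
    · refine Finset.insert_subset_iff.2 ⟨hG, fun H hH => ?_⟩
      rw [Finset.mem_filter] at hH
      exact hQT H hH.1 (hne H hH.1 hH.2)
    · rw [hQ', Finset.coe_insert]
      intro A hA B hB hAB hle
      rcases hA with rfl | hA <;> rcases hB with rfl | hB
      · exact hAB rfl
      · rw [Finset.mem_coe, Finset.mem_filter] at hB
        exact hGH B hB.1 hB.2 hle
      · rw [Finset.mem_coe, Finset.mem_filter] at hA
        exact hA.2 hle
      · rw [Finset.mem_coe, Finset.mem_filter] at hA hB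
        exact hanti hA.1 hB.1 hAB hle
    · rw [hQ', Finset.card_insert_of_notMem hG']
      have : 0 < (Q.filter fun H => ¬ H ⊆ G).card :=
        Finset.card_pos.2 ⟨L, Finset.mem_filter.2 ⟨hLQ, hLG⟩⟩
      omega
    -- The join of Q and G both contain the nonempty K, so their join is in 𝒢; it is also the join
    -- of Q'.
    · have h1 := h.closure_union_mem hmem (hT.1 hG)
        ((h.nonempty hK.1.1).mono (Set.subset_inter (hsub K hKQ) hKG.subset))
      rw [closure_union_closure_left_eq] at h1
      convert h1 using 2
      rw [hQ', Finset.coe_insert, Set.sUnion_insert]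
      refine subset_antisymm (Set.union_subset Set.subset_union_right ?_)
        (Set.union_subset ?_ Set.subset_union_left)
      · exact Set.subset_union_of_subset_left
          (Set.sUnion_mono (Finset.coe_subset.2 (Finset.filter_subset _ _))) _
      · refine Set.sUnion_subset fun H hH => ?_
        by_cases hHG : H ⊆ G
        · exact Set.subset_union_of_subset_left hHG _
        · exact Set.subset_union_of_subset_right
            (Set.subset_sUnion_of_mem (Finset.mem_coe.2 (Finset.mem_filter.2 ⟨hH, hHG⟩))) _

open scoped Classical in
/-- The admissible choice of flats that belongs to a nested set. -/
def canonicalFlats (S : Finset (Set α)) (G : 𝒢) : Set α :=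
  if (G : Set α) ∈ S then below S G else G

/-- The choice is nontrivial on S, which forces S ⊆ T. For an extra H in T, take a minimal G ∈ S
strictly above H: admissibility puts H inside ⋃ S_{<G}, hence inside a smaller member of S. -/
theorem IsBuildingSet.eq_of_isAdmissible_canonicalFlats (h : M.IsBuildingSet 𝒢)
    {S T : Finset (Set α)} (hS : S ∈ M.fullNestedSets 𝒢) (hT : T ∈ M.nestedSets 𝒢)
    (hST : IsAdmissible T (canonicalFlats S : 𝒢 → Set α)) : T = S := by
  classical
  have hsub : S ⊆ T := by
    intro G hG
    have hG' := hS.1.1 hG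
    refine hST.mem_of_ne (G := ⟨G, hG'⟩) ?_
    simp only [canonicalFlats, hG, if_true]
    exact (h.below_ssubset hS.1 hG').ne
  refine subset_antisymm (fun H hH => ?_) hsub
  by_contra hHS
  have hHG := hT.1 hH
  obtain ⟨K, hK, hHK⟩ := h.exists_mem_buildingFactors hHG (h.isFlat H hHG).subset_ground
  have hlt : ∀ G ∈ S, H ⊆ G → H ⊂ G := fun G hG hle =>
    hle.ssubset_of_ne (by rintro rfl; exact hHS hG)
  obtain ⟨G, hG⟩ := (S.filter (H ⊂ ·)).exists_minimal
    ⟨K, Finset.mem_filter.2 ⟨hS.2 hK, hlt K (hS.2 hK) hHK⟩⟩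
  have hG1 := Finset.mem_filter.1 hG.1
  have h1 := (hST ⟨G, hS.1.1 hG1.1⟩).1 (hsub hG1.1)
  simp only [canonicalFlats, hG1.1, if_true] at h1
  obtain ⟨L, hL, hLG, hHL⟩ := h.exists_of_subset_below hS.1 hHG
    ((subset_below hH hG1.2).trans h1)
  exact hLG.not_subset (hG.2 (Finset.mem_filter.2 ⟨hL, hlt L hL hHL⟩) hLG.subset)

/-- For a noncanonical choice of flats, some member of `𝒢` can be added to and removed from all
admissible nested sets. -/
theorem IsBuildingSet.exists_toggle [DecidableEq (Set α)] (h : M.IsBuildingSet 𝒢)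
    {φ : 𝒢 → Set α} (hφ : ∀ G, M.IsFlat (φ G) ∧ φ G ⊆ G)
    (hcan : ∀ S ∈ M.fullNestedSets 𝒢, φ ≠ canonicalFlats S) {T₀ : Finset (Set α)}
    (hT₀ : T₀ ∈ M.nestedSets 𝒢) (hT₀φ : IsAdmissible T₀ φ) :
    ∃ K : 𝒢, φ K = K ∧ ∀ T ∈ M.nestedSets 𝒢, IsAdmissible T φ →
      insert (K : Set α) T ∈ M.nestedSets 𝒢 ∧ IsAdmissible (insert (K : Set α) T) φ := by
  classical
  by_cases h1 : ∃ K : 𝒢, (K : Set α) ∈ buildingFactors 𝒢 M.E ∧ φ K = K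
  · obtain ⟨K, hK, hφK⟩ := h1
    refine ⟨K, hφK, fun T hT hTφ => ⟨h.insert_factor_ground_mem hT hK, hTφ.insert hφK ?_⟩⟩
    intro G _ hKG
    exact absurd (hK.2 ⟨G.2, (h.isFlat G G.2).subset_ground⟩ hKG.subset) hKG.not_subset
  push Not at h1
  -- S consists of all G with φ G ≠ G, so every admissible nested set contains it. It contains the
  -- factors of the ground set because none of them is fixed by φ here.
  set S : Finset (Set α) := T₀.filter fun A => ∃ G : 𝒢, (G : Set α) = A ∧ φ G ≠ G with hS
  have hSmem : ∀ G : 𝒢, (G : Set α) ∈ S ↔ φ G ≠ G := by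
    intro G
    rw [hS, Finset.mem_filter]
    constructor
    · rintro ⟨-, G', hG', hne⟩
      rwa [Subtype.ext hG'] at hne
    · exact fun hne => ⟨hT₀φ.mem_of_ne hne, G, rfl, hne⟩
  have hST : ∀ T, IsAdmissible T φ → T ∈ M.nestedSets 𝒢 → S ⊆ T := by
    intro T hTφ hT A hA
    have hA𝒢 : A ∈ 𝒢 := hT₀.1 (Finset.mem_filter.1 hA).1
    exact hTφ.mem_of_ne (G := ⟨A, hA𝒢⟩) ((hSmem ⟨A, hA𝒢⟩).1 hA)
  have hSfull : S ∈ M.fullNestedSets 𝒢 := ⟨nestedSets_subset hT₀ (Finset.filter_subset _ _),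
    fun K hK => (hSmem ⟨K, hK.1.1⟩).2 (h1 ⟨K, hK.1.1⟩ hK)⟩
  obtain ⟨G, hG⟩ := Function.ne_iff.1 (hcan S hSfull)
  have hGS : (G : Set α) ∈ S := by
    by_contra hGS
    rw [canonicalFlats, if_neg hGS] at hG
    exact hGS ((hSmem G).2 hG)
  rw [canonicalFlats, if_pos hGS] at hG
  have hGT₀ := hST T₀ hT₀φ hT₀ hGS
  have hlt : φ G ⊂ G := (hφ G).2.ssubset_of_ne ((hSmem G).1 hGS)
  have hnle : ¬ φ G ⊆ below S G := fun hle => hG (subset_antisymm hle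
    ((below_mono (hST T₀ hT₀φ hT₀) _).trans ((hT₀φ G).1 hGT₀)))
  have hne : (φ G).Nonempty := by
    rw [Set.nonempty_iff_ne_empty]
    intro h0
    rw [h0] at hnle
    exact hnle (Set.empty_subset _)
  -- As φ is not canonical for S, some φ G is strictly larger than ⋃ S_{<G}. A factor K of φ G
  -- outside this union cannot be in S, so φ fixes it.
  obtain ⟨K, hK, hKS⟩ : ∃ K ∈ buildingFactors 𝒢 (φ G), ¬ K ⊆ below S G := by
    by_contra! hc
    exact hnle ((h.buildingFactors_spec (hφ G).1 hne).2.1.trans (Set.sUnion_subset hc))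
  have hKG : K ⊂ G := hK.1.2.trans_ssubset hlt
  have hφK : φ ⟨K, hK.1.1⟩ = K := by
    by_contra hc
    exact hKS (subset_below ((hSmem ⟨K, hK.1.1⟩).2 hc) hKG)
  refine ⟨⟨K, hK.1.1⟩, hφK, fun T hT hTφ => ?_⟩
  have hGT := hST T hTφ hT hGS
  refine ⟨h.insert_factor_mem hT hGT (hφ G).1 hlt ((hTφ G).1 hGT) hK, hTφ.insert hφK ?_⟩
  intro G' hG' hKG'
  rcases h.subset_or_subset_or_disjoint hT hGT hG' with h2 | h2 | h2 | h2
  · rw [← Subtype.ext h2]; exact hK.1.2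
  · exact hKG.subset.trans ((subset_below hGT h2).trans ((hTφ G').1 hG'))
  · exact absurd (hK.2 ⟨G'.2, (subset_below hG' h2).trans ((hTφ G).1 hGT)⟩ hKG'.subset)
      hKG'.not_subset
  · exact absurd h2 (Set.not_disjoint_iff_nonempty_inter.2
      ((h.nonempty hK.1.1).mono (Set.subset_inter hKG.subset hKG'.subset)))

variable {R : Type*} [CommRing R]

open scoped Classical in
theorem prod_eq_prod_univ [Fintype 𝒢] {T : Finset (Set α)}
    (hT : (T : Set (Set α)) ⊆ 𝒢) (g : Set α → R) :
    ∏ G ∈ T, g G = ∏ G : 𝒢, if (G : Set α) ∈ T then g G else 1 := by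
  rw [← Finset.prod_filter]
  refine (Finset.prod_nbij (fun G : 𝒢 => (G : Set α)) ?_ ?_ ?_ ?_).symm
  · intro G hG
    exact (Finset.mem_filter.1 hG).2
  · exact Subtype.val_injective.injOn
  · intro G hG
    exact ⟨⟨G, hT hG⟩, by simpa using hG, rfl⟩
  · exact fun _ _ => rfl

open scoped Classical in
-- Adding or removing a K with φ K = K multiplies the term by c K K = -1, so a noncanonical φ
-- contributes zero. For a canonical one, T = S is the only admissible nested set.
theorem IsBuildingSet.sum_isAdmissible [Fintype 𝒢] (h : M.IsBuildingSet 𝒢)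
    (c : Set α → Set α → R) (hc : ∀ G, c G G = -1) {φ : 𝒢 → Set α}
    (hφ : ∀ G, M.IsFlat (φ G) ∧ φ G ⊆ G) :
    ∑ T ∈ h.finite_nestedSets.toFinset with IsAdmissible T φ,
        ∏ G : 𝒢, (if (G : Set α) ∈ T then c G (φ G) else 1) =
      ∑ S ∈ h.finite_nestedSets.toFinset with
          (S ∈ M.fullNestedSets 𝒢 ∧ φ = canonicalFlats S),
        ∏ G ∈ S, c G (below S G) := by
  by_cases hcan : ∃ S ∈ M.fullNestedSets 𝒢, φ = canonicalFlats S
  · obtain ⟨S, hS, rfl⟩ := hcan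
    have hadm : IsAdmissible S (canonicalFlats S : 𝒢 → Set α) := by
      intro G
      by_cases hG : (G : Set α) ∈ S <;> simp [canonicalFlats, hG]
    have e1 : (h.finite_nestedSets.toFinset.filter fun T =>
        IsAdmissible T (canonicalFlats S : 𝒢 → Set α)) = {S} := by
      ext T
      simp only [Finset.mem_filter, Set.Finite.mem_toFinset, Finset.mem_singleton]
      constructor
      · exact fun hT => h.eq_of_isAdmissible_canonicalFlats hS hT.1 hT.2
      · rintro rfl
        exact ⟨hS.1, hadm⟩
    have e2 : (h.finite_nestedSets.toFinset.filter fun T =>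
        T ∈ M.fullNestedSets 𝒢 ∧ (canonicalFlats S : 𝒢 → Set α) = canonicalFlats T) = {S} := by
      ext T
      simp only [Finset.mem_filter, Set.Finite.mem_toFinset, Finset.mem_singleton]
      constructor
      · rintro ⟨-, hT, heq⟩
        rw [heq] at hadm
        exact (h.eq_of_isAdmissible_canonicalFlats hT hS.1 hadm).symm
      · rintro rfl
        exact ⟨hS.1, hS, rfl⟩
    rw [e1, e2, Finset.sum_singleton, Finset.sum_singleton, prod_eq_prod_univ hS.1.1]
    refine Finset.prod_congr rfl fun G _ => ?_
    by_cases hG : (G : Set α) ∈ S <;> simp [canonicalFlats, hG]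
  · push Not at hcan
    rw [Finset.filter_false_of_mem (s := h.finite_nestedSets.toFinset)
      (p := fun S => S ∈ M.fullNestedSets 𝒢 ∧ φ = canonicalFlats S)
      (fun S _ hS => hcan S hS.1 hS.2), Finset.sum_empty]
    by_cases hex : ∃ T₀ ∈ M.nestedSets 𝒢, IsAdmissible T₀ φ
    swap
    · rw [Finset.filter_false_of_mem, Finset.sum_empty]
      intro T hT hTφ
      exact hex ⟨T, (Set.Finite.mem_toFinset _).1 hT, hTφ⟩
    obtain ⟨T₀, hT₀, hT₀φ⟩ := hex
    obtain ⟨K, hφK, hK⟩ := h.exists_toggle hφ hcan hT₀ hT₀φ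
    have hflip : ∀ T : Finset (Set α), (K : Set α) ∉ T →
        ∏ G : 𝒢, (if (G : Set α) ∈ insert (K : Set α) T then c G (φ G) else 1) =
          - ∏ G : 𝒢, (if (G : Set α) ∈ T then c G (φ G) else 1) := by
      intro T hT
      rw [← Finset.mul_prod_erase _ _ (Finset.mem_univ K),
        ← Finset.mul_prod_erase Finset.univ
          (fun G : 𝒢 => if (G : Set α) ∈ T then c G (φ G) else 1) (Finset.mem_univ K),
        if_pos (Finset.mem_insert_self _ _), if_neg hT, hφK, hc, one_mul, neg_one_mul]
      congr 1
      refine Finset.prod_congr rfl fun G hG => ?_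
      have : (G : Set α) ≠ K := fun h0 => Finset.ne_of_mem_erase hG (Subtype.ext h0)
      simp only [Finset.mem_insert, this, false_or]
    refine Finset.sum_involution (fun T _ =>
      if (K : Set α) ∈ T then T.erase (K : Set α) else insert (K : Set α) T) ?_ ?_ ?_ ?_
    · intro T _
      by_cases hKT : (K : Set α) ∈ T
      · simp only [if_pos hKT]
        have := hflip _ (Finset.notMem_erase (K : Set α) T)
        rw [Finset.insert_erase hKT] at this
        rw [this, neg_add_cancel]
      · simp only [if_neg hKT]
        rw [hflip T hKT, add_neg_cancel]
    · intro T _ _ h0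
      by_cases hKT : (K : Set α) ∈ T
      · simp only [if_pos hKT] at h0
        exact Finset.notMem_erase (K : Set α) T (h0.symm ▸ hKT)
      · simp only [if_neg hKT] at h0
        exact hKT (h0 ▸ Finset.mem_insert_self _ _)
    · intro T hT
      simp only [Finset.mem_filter, Set.Finite.mem_toFinset] at hT ⊢
      by_cases hKT : (K : Set α) ∈ T
      · simp only [if_pos hKT]
        exact ⟨nestedSets_subset hT.1 (Finset.erase_subset _ _), hT.2.erase hφK⟩
      · simp only [if_neg hKT]
        exact hK T hT.1 hT.2
    · intro T _
      by_cases hKT : (K : Set α) ∈ T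
      · simp [hKT, Finset.insert_erase]
      · simp [hKT]

open scoped Classical in
/-- A sum over nested sets of sums over flats, with `c G G = -1`, collapses to a sum over the
nested sets that contain the factors of the ground set. -/
theorem IsBuildingSet.sum_nestedSets (h : M.IsBuildingSet 𝒢)
    (c : Set α → Set α → R) (hc : ∀ G, c G G = -1) :
    ∑ T ∈ h.finite_nestedSets.toFinset, ∏ G ∈ T,
        ∑ F ∈ M.flatFinset with (below T G ⊆ F ∧ F ⊆ G), c G F =
      ∑ S ∈ h.finite_nestedSets.toFinset with S ∈ M.fullNestedSets 𝒢,
        ∏ G ∈ S, c G (below S G) := by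
  have := h.finite.fintype
  let Φ : Finset (𝒢 → Set α) :=
    Fintype.piFinset fun G : 𝒢 => M.flatFinset.filter (· ⊆ (G : Set α))
  have hΦ : ∀ φ, φ ∈ Φ ↔ ∀ G, M.IsFlat (φ G) ∧ φ G ⊆ G := by
    intro φ
    simp only [Φ, Fintype.mem_piFinset, Finset.mem_filter, mem_flatFinset]
  -- Setting φ G = G off T lets the expanded products for all T run over one common set of functions
  -- on 𝒢, so the sums can be exchanged.
  have e1 : ∀ T ∈ h.finite_nestedSets.toFinset, ∏ G ∈ T,
        ∑ F ∈ M.flatFinset with (below T G ⊆ F ∧ F ⊆ G), c G F =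
      ∑ φ ∈ Φ with IsAdmissible T φ, ∏ G : 𝒢, (if (G : Set α) ∈ T then c G (φ G) else 1) := by
    intro T hT
    rw [Set.Finite.mem_toFinset] at hT
    rw [prod_eq_prod_univ hT.1]
    have h1 : ∀ G : 𝒢, (if (G : Set α) ∈ T then
        ∑ F ∈ M.flatFinset with (below T G ⊆ F ∧ F ⊆ G), c G F else 1) =
        ∑ F ∈ (if (G : Set α) ∈ T then M.flatFinset.filter fun F => below T G ⊆ F ∧ F ⊆ G
          else {(G : Set α)}), (if (G : Set α) ∈ T then c G F else 1) := by
      intro G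
      split_ifs <;> simp
    rw [Finset.prod_congr rfl fun G _ => h1 G, Finset.prod_univ_sum]
    refine Finset.sum_congr ?_ fun _ _ => rfl
    ext φ
    rw [Finset.mem_filter, hΦ, Fintype.mem_piFinset, IsAdmissible, ← forall_and]
    refine forall_congr' fun G => ?_
    by_cases hG : (G : Set α) ∈ T
    · simp only [hG, if_true, Finset.mem_filter, mem_flatFinset, forall_true_left, not_true,
        IsEmpty.forall_iff, and_true]
      tauto
    · simp only [hG, if_false, Finset.mem_singleton, IsEmpty.forall_iff, not_false_eq_true,
        forall_true_left, true_and]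
      constructor
      · intro h0
        rw [h0]
        exact ⟨⟨h.isFlat G G.2, subset_rfl⟩, rfl⟩
      · exact fun h0 => h0.2
  rw [Finset.sum_congr rfl e1, Finset.sum_comm' (t' := Φ)
    (s' := fun φ => h.finite_nestedSets.toFinset.filter fun T => IsAdmissible T φ)
    (by intro T φ; simp only [Finset.mem_filter]; tauto),
    Finset.sum_congr rfl fun φ hφ => h.sum_isAdmissible c hc ((hΦ φ).1 hφ),
    Finset.sum_comm' (t' := h.finite_nestedSets.toFinset.filter (· ∈ M.fullNestedSets 𝒢))
    (s' := fun S => {canonicalFlats S})]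
  · exact Finset.sum_congr rfl fun S _ => Finset.sum_singleton _ _
  · intro φ S
    simp only [Finset.mem_filter, Finset.mem_singleton, Set.Finite.mem_toFinset]
    constructor
    · rintro ⟨-, hS, hS', rfl⟩
      exact ⟨rfl, hS, hS'⟩
    · rintro ⟨rfl, hS, hS'⟩
      refine ⟨(hΦ _).2 fun G => ?_, hS, hS', rfl⟩
      rw [canonicalFlats]
      split_ifs
      · exact ⟨h.isFlat_below hS G, below_subset S G⟩
      · exact ⟨h.isFlat G G.2, subset_rfl⟩

/-! ### The polynomial -/

/-- The polynomial `∑_T ∏_{G ∈ T} (q + ⋯ + q ^ (rk G - rk (⋃ T_{< G}) - 1))`, over the nested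
sets `T`. -/
noncomputable def nestedPoly (h : M.IsBuildingSet 𝒢) : Polynomial ℤ :=
  ∑ T ∈ h.finite_nestedSets.toFinset, ∏ G ∈ T,
    ∑ i ∈ Finset.Ico 1 (M.natRk G - M.natRk (below T G)), Polynomial.X ^ i

open scoped Classical in
-- With d = rk G - rk Z, q + ⋯ + q^(d-1) = (q^d - 1)/(q - 1) - 1. The numerator is the sum of the
-- χ_{(M|G)/F} without the term 1 of F = G, and the last -1 becomes the new term at F = G.
-- Strictness Z ⊂ G gives d > 0, so the geometric sum has a term 1 to split off.
theorem sum_intervalChar_div {Z G : Set α} (hZ : M.IsFlat Z) (hG : M.IsFlat G) (hZG : Z ⊂ G) :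
    ∑ F ∈ M.flatFinset with (Z ⊆ F ∧ F ⊆ G),
      (if F = G then (-1 : RatFunc ℤ) else
        algebraMap (Polynomial ℤ) (RatFunc ℤ) (M.intervalChar G F) / (RatFunc.X - 1)) =
      algebraMap (Polynomial ℤ) (RatFunc ℤ)
        (∑ i ∈ Finset.Ico 1 (M.natRk G - M.natRk Z), Polynomial.X ^ i) := by
  have hX : (RatFunc.X - 1 : RatFunc ℤ) ≠ 0 := by
    have h1 : (RatFunc.X - 1 : RatFunc ℤ) =
        algebraMap (Polynomial ℤ) (RatFunc ℤ) (Polynomial.X - Polynomial.C 1) := by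
      simp [RatFunc.algebraMap_X]
    rw [h1]
    exact RatFunc.algebraMap_ne_zero (Polynomial.X_sub_C_ne_zero 1)
  have hmem : G ∈ M.flatFinset.filter fun F => Z ⊆ F ∧ F ⊆ G :=
    Finset.mem_filter.2 ⟨mem_flatFinset.2 hG, hZG.subset, subset_rfl⟩
  have hd : 0 < M.natRk G - M.natRk Z := Nat.sub_pos_of_lt (hZ.natRk_lt hZG hG.subset_ground)
  have hGG : M.intervalChar G G = 1 := by
    have : M.sdiffFinset G G = ∅ := by
      rw [← Finset.coe_eq_empty, coe_sdiffFinset hG.subset_ground, Set.sdiff_self]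
    simp [intervalChar, this]
  have h1 := sum_intervalChar hZ hG hZG.subset
  rw [← Finset.add_sum_erase _ _ hmem, hGG] at h1
  have h2 := geom_sum_mul (Polynomial.X : Polynomial ℤ) (M.natRk G - M.natRk Z)
  rw [Finset.range_eq_Ico, Finset.sum_eq_sum_Ico_succ_bot hd, zero_add, pow_zero] at h2
  have h3 : ∑ F ∈ (M.flatFinset.filter fun F => Z ⊆ F ∧ F ⊆ G).erase G, M.intervalChar G F =
      (∑ i ∈ Finset.Ico 1 (M.natRk G - M.natRk Z), Polynomial.X ^ i + 1) *
        (Polynomial.X - 1) := by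
    linear_combination h1 - h2
  have h4 := congrArg (algebraMap (Polynomial ℤ) (RatFunc ℤ)) h3
  rw [map_mul, map_sub, RatFunc.algebraMap_X, map_one, map_add, map_one] at h4
  rw [← Finset.add_sum_erase _ _ hmem, if_pos rfl,
    Finset.sum_congr rfl fun F hF => if_neg (Finset.ne_of_mem_erase hF), ← Finset.sum_div,
    ← map_sum, h4, mul_div_cancel_right₀ _ hX]
  ring

theorem IsBuildingSet.algebraMap_nestedPoly (h : M.IsBuildingSet 𝒢) :
    algebraMap (Polynomial ℤ) (RatFunc ℤ) (nestedPoly h) = M.eulerPoincare 𝒢 := by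
  classical
  let c : Set α → Set α → RatFunc ℤ := fun G F => if F = G then (-1 : RatFunc ℤ) else
        algebraMap (Polynomial ℤ) (RatFunc ℤ) (M.intervalChar G F) / (RatFunc.X - 1)
  have h1 := h.sum_nestedSets c fun G => if_pos rfl
  have hfull : M.fullNestedSets 𝒢 = ((h.finite_nestedSets.toFinset.filter
      (· ∈ M.fullNestedSets 𝒢) : Finset _) : Set _) := by
    ext S
    simp only [Finset.coe_filter, Set.Finite.mem_toFinset, Set.mem_ofPred_eq]
    exact ⟨fun hS => ⟨hS.1, hS⟩, fun hS => hS.2⟩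
  rw [eulerPoincare, hfull, finsum_mem_coe_finset, nestedPoly, map_sum]
  trans ∑ S ∈ h.finite_nestedSets.toFinset with S ∈ M.fullNestedSets 𝒢,
        ∏ G ∈ S, c G (below S G)
  · rw [← h1]
    refine Finset.sum_congr rfl fun T hT => ?_
    rw [Set.Finite.mem_toFinset] at hT
    rw [map_prod]
    exact Finset.prod_congr rfl fun G hG => (sum_intervalChar_div (h.isFlat_below hT G)
      (h.isFlat G (hT.1 hG)) (h.below_ssubset hT (hT.1 hG))).symm
  · refine Finset.sum_congr rfl fun S hS => ?_
    have hS' := (Finset.mem_filter.1 hS).2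
    rw [h.characteristicPoly_nestedMatroid hS', map_prod, ← Finset.prod_const,
      ← Finset.prod_div_distrib]
    exact Finset.prod_congr rfl fun G hG => if_neg (h.below_ssubset hS'.1 (hS'.1.1 hG)).ne

/-! ### Counting normal monomials -/

open scoped Classical in
/-- The exponents of the normal monomials with support `T`. -/
noncomputable def exponentsOf [Fintype 𝒢] (M : Matroid α) (T : Finset (Set α)) :
    Finset (𝒢 → ℕ) :=
  Fintype.piFinset fun G : 𝒢 =>
    if (G : Set α) ∈ T then Finset.Ico 1 (M.natRk (G : Set α) - M.natRk (below T G)) else {0}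

theorem mem_iff_of_mem_exponentsOf [Fintype 𝒢] {T : Finset (Set α)} {m : 𝒢 → ℕ}
    (hm : m ∈ exponentsOf M T) (G : 𝒢) : (G : Set α) ∈ T ↔ m G ≠ 0 := by
  classical
  have h1 := Fintype.mem_piFinset.1 hm G
  by_cases hG : (G : Set α) ∈ T
  · rw [if_pos hG, Finset.mem_Ico] at h1
    exact ⟨fun _ => by omega, fun _ => hG⟩
  · rw [if_neg hG, Finset.mem_singleton] at h1
    exact ⟨fun h => absurd h hG, fun h => absurd h1 h⟩

theorem eq_of_mem_exponentsOf [Fintype 𝒢] {S T : Finset (Set α)} {m : 𝒢 → ℕ}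
    (hS : (S : Set (Set α)) ⊆ 𝒢) (hT : (T : Set (Set α)) ⊆ 𝒢)
    (hmS : m ∈ exponentsOf M S) (hmT : m ∈ exponentsOf M T) : S = T := by
  ext A
  constructor
  · intro hA
    exact (mem_iff_of_mem_exponentsOf hmT ⟨A, hS hA⟩).2
      ((mem_iff_of_mem_exponentsOf hmS ⟨A, hS hA⟩).1 hA)
  · intro hA
    exact (mem_iff_of_mem_exponentsOf hmS ⟨A, hT hA⟩).2
      ((mem_iff_of_mem_exponentsOf hmT ⟨A, hT hA⟩).1 hA)

open scoped Classical in
-- Since exponents on T start at 1, T is recovered as the support; different T contribute disjoint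
-- sets of monomials.
theorem IsBuildingSet.nestedPoly_eq [Fintype 𝒢] (h : M.IsBuildingSet 𝒢) :
    nestedPoly h = ∑ m ∈ h.finite_nestedSets.toFinset.biUnion
      (fun T => (exponentsOf M T : Finset (𝒢 → ℕ))), Polynomial.X ^ (∑ G, m G) := by
  rw [nestedPoly, Finset.sum_biUnion]
  · refine Finset.sum_congr rfl fun T hT => ?_
    rw [Set.Finite.mem_toFinset] at hT
    rw [prod_eq_prod_univ hT.1]
    have h1 : ∀ G : 𝒢, (if (G : Set α) ∈ T then
        ∑ i ∈ Finset.Ico 1 (M.natRk (G : Set α) - M.natRk (below T G)),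
          (Polynomial.X : Polynomial ℤ) ^ i else 1) =
        ∑ i ∈ (if (G : Set α) ∈ T then
          Finset.Ico 1 (M.natRk (G : Set α) - M.natRk (below T G)) else {0}),
            (Polynomial.X : Polynomial ℤ) ^ i := by
      intro G
      split_ifs <;> simp
    rw [Finset.prod_congr rfl fun G _ => h1 G, Finset.prod_univ_sum]
    exact Finset.sum_congr rfl fun m _ => Finset.prod_pow_eq_pow_sum _ _ _
  · intro S hS T hT hne
    rw [Finset.mem_coe, Set.Finite.mem_toFinset] at hS hT
    exact Finset.disjoint_left.2 fun m hm hm' => hne (eq_of_mem_exponentsOf hS.1 hT.1 hm hm')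

theorem exists_mem_exponentsOf_iff [Fintype 𝒢] {m : 𝒢 →₀ ℕ} :
    (∃ T ∈ M.nestedSets 𝒢, ⇑m ∈ exponentsOf M T) ↔
      m ∈ normalExponents M (Finset.univ : Finset 𝒢) ∅ := by
  classical
  rw [mem_normalExponents_univ]
  constructor
  · rintro ⟨T, hT, hm⟩
    have hTm : coeFinset m.support = T := by
      ext A
      constructor
      · intro hA
        obtain ⟨B, hB, rfl⟩ := coe_mem_of_mem_coeFinset hA
        exact (mem_iff_of_mem_exponentsOf hm B).2 (Finsupp.mem_support_iff.1 hB)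
      · intro hA
        exact (mem_coeFinset (A := ⟨A, hT.1 hA⟩)).2 (Finsupp.mem_support_iff.2
          ((mem_iff_of_mem_exponentsOf hm ⟨A, hT.1 hA⟩).1 hA))
    rw [hTm]
    refine ⟨hT, fun G hG => ?_⟩
    have hGT : (G : Set α) ∈ T := hTm ▸ mem_coeFinset.2 hG
    have h1 := Fintype.mem_piFinset.1 hm G
    rw [if_pos hGT, Finset.mem_Ico] at h1
    omega
  · rintro ⟨hn, hm⟩
    refine ⟨_, hn, Fintype.mem_piFinset.2 fun G => ?_⟩
    by_cases hG : G ∈ m.support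
    · rw [if_pos (mem_coeFinset.2 hG), Finset.mem_Ico]
      have h1 := hm G hG
      have h2 := Finsupp.mem_support_iff.1 hG
      omega
    · rw [if_neg (mem_coeFinset.not.2 hG), Finset.mem_singleton]
      exact Finsupp.notMem_support_iff.1 hG

theorem IsBuildingSet.coeff_expand_nestedPoly [Fintype 𝒢] (h : M.IsBuildingSet 𝒢) (i : ℕ) :
    (Polynomial.expand ℤ 2 (nestedPoly h)).coeff i =
      Module.finrank ℤ (M.fyDegree 𝒢 i) := by
  classical
  rw [h.finrank_fyDegree, h.nestedPoly_eq, map_sum, Polynomial.finsetSum_coeff]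
  simp only [map_pow, Polynomial.expand_X, ← pow_mul, Polynomial.coeff_X_pow]
  rw [Finset.sum_boole]
  congr 1
  rw [← Set.ncard_coe_finset]
  refine (Set.ncard_congr (fun (m : 𝒢 →₀ ℕ) _ => (⇑m : 𝒢 → ℕ)) ?_ ?_ ?_).symm
  · rintro m ⟨hm, hw⟩
    simp only [Finset.coe_filter, Finset.mem_biUnion, Set.Finite.mem_toFinset, Set.mem_ofPred_eq]
    refine ⟨exists_mem_exponentsOf_iff.2 hm, ?_⟩
    rw [← hw, Finsupp.weight_apply, Finsupp.sum_fintype _ _ (by simp), Finset.mul_sum]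
    exact Finset.sum_congr rfl fun G _ => by simp [mul_comm]
  · exact fun _ _ _ _ hab => DFunLike.coe_injective hab
  · intro m hm
    simp only [Finset.coe_filter, Finset.mem_biUnion, Set.Finite.mem_toFinset,
      Set.mem_ofPred_eq] at hm
    refine ⟨Finsupp.equivFunOnFinite.symm m, ⟨exists_mem_exponentsOf_iff.1 (by simpa using hm.1), ?_⟩,
      by simp⟩
    rw [Finsupp.weight_apply, Finsupp.sum_fintype _ _ (by simp), hm.2, Finset.mul_sum]
    exact Finset.sum_congr rfl fun G _ => by simp [mul_comm]

end Inversion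

end Matroid

theorem mainTheorem11 {α : Type*} (M : Matroid α) [M.Finite] [M.Loopless]
    (𝒢 : Set (Set α)) (h𝒢 : M.IsBuildingSet 𝒢) :
    ∃ P : Polynomial ℤ,
      algebraMap (Polynomial ℤ) (RatFunc ℤ) P = M.eulerPoincare 𝒢 ∧
      ((Polynomial.expand ℤ 2 P : Polynomial ℤ) : PowerSeries ℤ) =
        PowerSeries.mk fun i => (Module.finrank ℤ (M.fyDegree 𝒢 i) : ℤ) := by
  have := h𝒢.finite.fintype
  refine ⟨Matroid.nestedPoly h𝒢, h𝒢.algebraMap_nestedPoly, ?_⟩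
  ext i
  rw [Polynomial.coeff_coe, PowerSeries.coeff_mk, h𝒢.coeff_expand_nestedPoly]
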